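/- Let $n\ge 1$, $1<p<\infty$ and $\vec q=(q_1,\dots,q_n)$ with $1<q_j<\infty$ for all $j$ and $\frac np\le\sum_{j=1}^n\frac1{q_j}$. For measurable $f:\mathbb{R}^n\to\mathbb{C}$ put $$\|f\|_{\vec q}=\Big(\int_{\mathbb R}\cdots\Big(\int_{\mathbb R}\Big(\int_{\mathbb R}|f(x_1,\dots,x_n)|^{q_1}dx_1\Big)^{q_2/q_1}dx_2\Big)^{q_3/q_2}\cdots dx_n\Big)^{1/q_n},$$ $$\|f\|_{\mathcal M^p_{\vec q}(\mathbb{R}^n)}=\sup_Q|Q|^{\frac1p-\frac1n\sum_{j=1}^n\frac1{q_j}}\|f\chi_Q\|_{\vec q},$$ the supremum being over all cubes $Q$ with sides parallel to the axes, and let $\mathcal M^p_{\vec q}(\mathbb{R}^n)$ be the set of measurable $f$ with $\|f\|_{\mathcal M^p_{\vec q}(\mathbb{R}^n)}<\infty$ (functions equal almost everywhere are identified). Let $T$ be a singular integral operator, that is, a bounded linear operator on $L^2(\mathbb{R}^n)$ with a kernel $k(x,y)$, defined for $x\ne y$, such that 1. $|k(x,y)|\le C|x-y|^{-n}$ for $x\neq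 y$, for some $C>0$; 2. for some $\epsilon>0$ and $C>0$, $|k(x,y)-k(z,y)|+|k(y,x)-k(y,z)|\le C\frac{|x-z|^\epsilon}{|x-y|^{n+\epsilon}}$ whenever $x\ne y$ and $|x-y|\ge 2|x-z|$; 3. for every compactly supported $f\in L^\infty(\mathbb{R}^n)$, $Tf(x)=\int_{\mathbb{R}^n}k(x,y)f(y)\,dy$ for almost every $x\notin\operatorname{supp}f$. For $f\in\mathcal M^p_{\vec q}(\mathbb{R}^n)$, $Tf$ denotes the measurable function such that, for every cube $Q$ (with $2Q$ the concentric cube of twice the side length), $$Tf(x)=T(f\chi_{2Q})(x)+\int_{\mathbb{R}^n\setminus 2Q}k(x,y)f(y)\,dy\qquad\text{for almost every }x\in Q,$$ where the integral converges absolutely, and $T(f\chi_{2Q})$ is understood through the extension of $T$ by continuity from $L^2\cap L^s$ to $L^s(\mathbb{R}^n)$, for some $1<s<\infty$ with $f\chi_{2Q}\in L^s(\mathbb{R}^n)$. Then for every $f\in\mathcal M^p_{\vec q}(\mathbb{R}^n)$ the function $Tf$ exists and is unique up to null sets; it agrees with the given $Tf$ if moreover $f\in L^2(\mathbb{R}^n)$;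 the map $f\mapsto Tf$ is linear on $\mathcal M^p_{\vec q}(\mathbb{R}^n)$; and there is a constant $C>0$, independent of $f$, such that $$\|Tf\|_{\mathcal M^p_{\vec q}(\mathbb{R}^n)}\le C\|f\|_{\mathcal M^p_{\vec q}(\mathbb{R}^n)}\qquad(f\in\mathcal M^p_{\vec q}(\mathbb{R}^n)).$$ -/

import Mathlib

open MeasureTheory
open scoped ENNReal NNReal

namespace MixedMorrey

/-- The Euclidean space `ℝⁿ`. -/
abbrev E (n : ℕ) : Type := EuclideanSpace ℝ (Fin n)

/-- `L⁰(ℝⁿ)`: complex measurable functions on `ℝⁿ`, up to equality almost everywhere. -/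
abbrev L0 (n : ℕ) : Type := E n →ₘ[(volume : Measure (E n))] ℂ

/-- `L²(ℝⁿ)`. -/
abbrev L2 (n : ℕ) : Type := Lp ℂ 2 (volume : Measure (E n))

/-- The iterated norm of a nonnegative function `F(x₁, …, xₙ)`: the `L^{q₁}` norm in `x₁` is
innermost (taken first), the `L^{qₙ}` norm in `xₙ` is outermost. -/
noncomputable def iteratedNorm : (n : ℕ) → (Fin n → ℝ) → ((Fin n → ℝ) → ℝ≥0∞) → ℝ≥0∞
  | 0, _, F => F Fin.elim0
  | n + 1, q, F =>
      iteratedNorm n (fun i => q i.succ)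
        (fun y => (∫⁻ t : ℝ, F (Fin.cons t y) ^ q 0) ^ (1 / q 0))

/-- The mixed Lebesgue norm `‖f‖_{(q₁, …, qₙ)}`, for finite exponents. -/
noncomputable def mixedLebesgueNorm {n : ℕ} (q : Fin n → ℝ) (f : E n → ℂ) : ℝ≥0∞ :=
  iteratedNorm n q (fun v => ‖f (WithLp.toLp 2 v)‖ₑ)

/-- The cube with centre `c` and radius `r` (side length `2r`), with sides parallel to the
coordinate axes. -/
def cube {n : ℕ} (c : E n) (r : ℝ) : Set (E n) := {x | ∀ i, |x i - c i| ≤ r}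

/-- The mixed Morrey norm: the supremum over all cubes `Q` of
`|Q|^(1/p - (1/n) ∑ 1/qⱼ) ‖f χ_Q‖_{(q₁, …, qₙ)}`. -/
noncomputable def mixedMorreyNorm {n : ℕ} (p : ℝ) (q : Fin n → ℝ) (f : E n → ℂ) : ℝ≥0∞ :=
  ⨆ (c : E n) (r : ℝ) (_ : 0 < r),
    volume (cube c r) ^ (1 / p - (1 / (n : ℝ)) * ∑ j, 1 / q j) *
      mixedLebesgueNorm q ((cube c r).indicator f)

/-- The mixed Morrey space. -/
def mixedMorreySpace {n : ℕ} (p : ℝ) (q : Fin n → ℝ) : Set (L0 n) :=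
  {f | mixedMorreyNorm p q f < ∞}

/-- The size and smoothness conditions on a kernel `k(x, y)`, `x ≠ y` (the values on the diagonal
play no role). -/
structure IsStandardKernel {n : ℕ} (k : E n → E n → ℂ) : Prop where
  size : ∃ C : ℝ, 0 < C ∧ ∀ x y, x ≠ y → ‖k x y‖ ≤ C / ‖x - y‖ ^ n
  smooth : ∃ ε C : ℝ, 0 < ε ∧ 0 < C ∧ ∀ x y z, x ≠ y → 2 * ‖x - z‖ ≤ ‖x - y‖ →
    ‖k x y - k z y‖ + ‖k y x - k y z‖ ≤ C * (‖x - z‖ ^ ε / ‖x - y‖ ^ ((n : ℝ) + ε))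

/-- `T`, a bounded linear operator on `L²(ℝⁿ)`, is a singular integral operator with kernel `k`:
for every compactly supported `f ∈ L^∞`, `Tf(x) = ∫ k(x, y) f(y) dy` for almost every `x` outside
the support of `f`. -/
structure IsSingularIntegralOperator {n : ℕ} (T : L2 n →L[ℂ] L2 n) (k : E n → E n → ℂ) :
    Prop where
  kernel : IsStandardKernel k
  repr : ∀ (f : E n → ℂ) (hf : MemLp f 2 volume), MemLp f ∞ volume → HasCompactSupport f →
    ∀ᵐ x : E n, x ∉ tsupport f → T (hf.toLp f) x = ∫ y, k x y * f y

/-- `u = Th` in the sense of the extension of `T` by continuity from `L² ∩ L^s` to `L^s`, for some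
`1 < s < ∞` with `h ∈ L^s`: the pair `(h, u)` is in the closure in `L^s × L^s` of the graph of `T`
on `L² ∩ L^s`. -/
def IsLpValue {n : ℕ} (T : L2 n →L[ℂ] L2 n) (h u : E n → ℂ) : Prop :=
  ∃ s : ℝ≥0∞, 1 < s ∧ s < ∞ ∧ MemLp h s volume ∧ MemLp u s volume ∧
    ∀ ε : ℝ≥0∞, 0 < ε → ∃ φ : L2 n,
      eLpNorm (fun x => φ x - h x) s volume < ε ∧ eLpNorm (fun x => T φ x - u x) s volume < ε

/-- `g = Tf` for a function `f` that is only locally in some `L^s`: for every cube `Q`,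
`g(x) = T(f χ_{2Q})(x) + ∫_{(2Q)ᶜ} k(x, y) f(y) dy` for almost every `x ∈ Q`, with an absolutely
convergent integral. -/
def IsValue {n : ℕ} (T : L2 n →L[ℂ] L2 n) (k : E n → E n → ℂ) (f g : L0 n) : Prop :=
  ∀ (c : E n) (r : ℝ), 0 < r → ∃ u : L0 n,
    IsLpValue T ((cube c (2 * r)).indicator f) u ∧
    ∀ᵐ x : E n, x ∈ cube c r →
      IntegrableOn (fun y => k x y * f y) (cube c (2 * r))ᶜ volume ∧
      g x = u x + ∫ y in (cube c (2 * r))ᶜ, k x y * f y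

end MixedMorrey

namespace MixedMorrey

/-! ### Minkowski's integral inequality -/

/-! On a cube `Q` of side `L`, split `f` into `f χ_{2Q}` and the rest. For the local part, `T` is
bounded on the mixed Lebesgue space with exponents `q`, and the Morrey condition on `2Q` gives the
required power of `L`. For the rest, the size of the kernel on dyadic annuli around `Q` and Hölder's
inequality on cubes give a geometric series, so the tail integral is at most `C L^(-n/p) ‖f‖` at
every point of `Q` (`IsStandardKernel.exists_lintegral_tail_le`); the mixed norm of `χ_Q` is at most
`L^(∑ 1/q_j)`. The two bounds combine in `IsSingularIntegralOperator.exists_mixedMorreyNorm_le`.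

The bulk of the work is the boundedness on mixed Lebesgue spaces (`mixedBounded`), after Benedek,
Calderón and Panzone. The operator is bounded for the exponents `(2, …, 2)`. Separate the variables
into a first group `x`, with its mixed norm, and a last group `y`, in which all exponents equal `r`,
so that the norm is that of `L^r` in `y` of the slice norm in `x`. A Calderón–Zygmund decomposition
in `y` of the slice norm of `f`, with bad parts of mean zero in `y` for each `x`, yields a
distributional inequality (`distribution_sliceNorm_le`). Away from the support of a bad part the
smoothness of the kernel bounds `T b` by a convolution in `x`, which Minkowski's inequality
estimates for any mixed norm. Integrating the distributional inequality replaces `r` by any `s` in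
`(1, r)`. For `s > r` the same argument is applied to the adjoint, which is again a singular
integral operator, and the result is transferred back by the duality of iterated norms. Changing the
exponents of shorter and shorter final blocks of variables leads from `(2, …, 2)` to `q`.

All estimates are made for bounded functions with bounded support. The images under `T` of the
truncations of `h` converge in measure to every extension value of `T` at `h`, whichever `L^s` is
used. This yields uniqueness, and lets the bounds pass to the limit by Fatou's lemma. For existence,
the local definitions on nested cubes agree by the kernel representation, so they glue to one
function. -/

theorem lintegral_rpow_lintegral_le {α β : Type*} [MeasurableSpace α] [MeasurableSpace β]
    {μ : Measure α} {ν : Measure β} [SigmaFinite μ] [SFinite ν] {F : α → β → ℝ≥0∞}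
    (hF : Measurable (Function.uncurry F)) {p : ℝ} (hp : 1 ≤ p) :
    (∫⁻ a, (∫⁻ b, F a b ∂ν) ^ p ∂μ) ^ (1 / p) ≤ ∫⁻ b, (∫⁻ a, F a b ^ p ∂μ) ^ (1 / p) ∂ν := by
  rcases hp.eq_or_lt with rfl | hp1
  · simp only [ENNReal.rpow_one, div_one]
    rw [lintegral_lintegral_swap hF.aemeasurable]
  have hp0 : 0 < p := by linarith
  set R := ∫⁻ b, (∫⁻ a, F a b ^ p ∂μ) ^ (1 / p) ∂ν with hR
  set S : α → ℝ≥0∞ := fun a => ∫⁻ b, F a b ∂ν with hS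
  have hSm : Measurable S := hF.lintegral_prod_right'
  obtain ⟨q, hpq⟩ : ∃ q : ℝ, p.HolderConjugate q := ⟨_, Real.HolderConjugate.conjExponent hp1⟩
  -- Truncating both the domain and the size makes the integral of the `p`-th power finite, so that
  -- a power of it can be cancelled.
  let SN : ℕ → α → ℝ≥0∞ := fun N => (spanningSets μ N).indicator (fun a => min (S a) N)
  have hSNm : ∀ N, Measurable (SN N) := fun N =>
    (hSm.min measurable_const).indicator (measurableSet_spanningSets μ N)
  have hSN_le : ∀ N a, SN N a ≤ S a := fun N a =>
    (Set.indicator_le_self _ _ _).trans (min_le_left _ _)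
  have key : ∀ N, ∫⁻ a, SN N a ^ p ∂μ ≤ R ^ p := by
    intro N
    set I := ∫⁻ a, SN N a ^ p ∂μ with hI
    have hIfin : I ≠ ∞ := by
      refine ne_of_lt (lt_of_le_of_lt (b := ∫⁻ a, (spanningSets μ N).indicator
        (fun _ => (N : ℝ≥0∞) ^ p) a ∂μ) ?_ ?_)
      · refine lintegral_mono fun a => ?_
        by_cases ha : a ∈ spanningSets μ N
        · simp only [SN, Set.indicator_of_mem ha]
          exact ENNReal.rpow_le_rpow (min_le_right _ _) hp0.le
        · simp [SN, Set.indicator_of_notMem ha, hp0]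
      · rw [lintegral_indicator (measurableSet_spanningSets μ N), setLIntegral_const]
        exact ENNReal.mul_lt_top (ENNReal.rpow_lt_top_of_nonneg hp0.le (by simp))
          (measure_spanningSets_lt_top μ N)
    -- One factor of `SN ^ p` is enlarged to `S`; Tonelli and Hölder in `a`, for each fixed `b`,
    -- then reproduce `I` on the right with the exponent `1 / q`.
    have h1 : I ≤ R * I ^ (1 / q) := by
      calc I = ∫⁻ a, SN N a * SN N a ^ (p - 1) ∂μ := by
            refine lintegral_congr fun a => ?_
            rcases eq_or_ne (SN N a) 0 with h | h
            · simp [h, hp0]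
            · have hne : SN N a ≠ ∞ := by
                by_cases ha : a ∈ spanningSets μ N
                · simp only [SN, Set.indicator_of_mem ha]
                  exact ne_of_lt (lt_of_le_of_lt (min_le_right _ _) (by simp))
                · simp [SN, Set.indicator_of_notMem ha]
              conv_rhs => rw [← ENNReal.rpow_one (SN N a), ← ENNReal.rpow_mul, one_mul,
                ← ENNReal.rpow_add _ _ h hne]
              congr 1; ring
        _ ≤ ∫⁻ a, S a * SN N a ^ (p - 1) ∂μ := by
            gcongr with a; exact hSN_le N a
        _ = ∫⁻ a, ∫⁻ b, F a b * SN N a ^ (p - 1) ∂ν ∂μ := by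
            refine lintegral_congr fun a => ?_
            exact (lintegral_mul_const _ (hF.comp measurable_prodMk_left)).symm
        _ = ∫⁻ b, ∫⁻ a, F a b * SN N a ^ (p - 1) ∂μ ∂ν := by
            rw [lintegral_lintegral_swap]
            exact (hF.mul (((hSNm N).comp measurable_fst).pow_const _)).aemeasurable
        _ ≤ ∫⁻ b, (∫⁻ a, F a b ^ p ∂μ) ^ (1 / p) * I ^ (1 / q) ∂ν := by
            refine lintegral_mono fun b => ?_
            exact ENNReal.lintegral_mul_rpow_le_lintegral_rpow_mul_lintegral_rpow hpq
              (hF.comp measurable_prodMk_right).aemeasurable (hSNm N).aemeasurable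
        _ = R * I ^ (1 / q) := by
            rw [lintegral_mul_const]
            exact ((hF.pow_const p).lintegral_prod_left').pow_const _
    rcases eq_or_ne I 0 with h0 | h0
    · simp [h0]
    have h2 : I ^ (1 / p) ≤ R := by
      have hIq0 : I ^ (1 / q) ≠ 0 := by simp [h0, hIfin]
      have hIqt : I ^ (1 / q) ≠ ∞ := ENNReal.rpow_ne_top_of_nonneg
        (by have := hpq.symm.pos; positivity) hIfin
      rw [← ENNReal.mul_le_mul_iff_left hIq0 hIqt]
      convert h1 using 1
      rw [← ENNReal.rpow_add _ _ h0 hIfin]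
      have := hpq.inv_add_inv_eq_one
      simp [this]
    calc I = (I ^ (1 / p)) ^ p := by rw [← ENNReal.rpow_mul]; field_simp; simp
      _ ≤ R ^ p := ENNReal.rpow_le_rpow h2 hp0.le
  have hmono : Monotone SN := by
    intro M N hMN a
    by_cases ha : a ∈ spanningSets μ M
    · have ha' := monotone_spanningSets μ hMN ha
      simp only [SN, Set.indicator_of_mem ha, Set.indicator_of_mem ha']
      gcongr
    · simp [SN, Set.indicator_of_notMem ha]
  have hsup : ∀ a, ⨆ N, SN N a ^ p = S a ^ p := by
    intro a
    have h := ((ENNReal.orderIsoRpow p hp0).map_iSup (fun N => SN N a)).symm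
    simp only [ENNReal.orderIsoRpow_apply] at h
    rw [h]
    congr 1
    apply le_antisymm (iSup_le fun N => hSN_le N a)
    refine le_of_forall_lt fun c hc => ?_
    obtain ⟨M, hM⟩ := ENNReal.exists_nat_gt (ne_top_of_lt hc)
    have ha : a ∈ spanningSets μ (spanningSetsIndex μ a) := mem_spanningSetsIndex μ a
    refine lt_of_lt_of_le ?_ (le_iSup _ (max M (spanningSetsIndex μ a)))
    simp only [SN, Set.indicator_of_mem (monotone_spanningSets μ (le_max_right M _) ha)]
    refine lt_min hc (hM.trans_le ?_)
    exact_mod_cast le_max_left _ _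
  have : ∫⁻ a, S a ^ p ∂μ ≤ R ^ p := by
    simp_rw [← hsup]
    rw [lintegral_iSup (fun N => (hSNm N).pow_const p)
      (fun M N h a => ENNReal.rpow_le_rpow (hmono h a) hp0.le)]
    exact iSup_le key
  calc (∫⁻ a, S a ^ p ∂μ) ^ (1 / p) ≤ (R ^ p) ^ (1 / p) := by gcongr
    _ = R := by rw [← ENNReal.rpow_mul]; field_simp; simp

/-! ### The iterated norm -/

theorem measurePreserving_cons (n : ℕ) : MeasurePreserving
    (fun z : (Fin n → ℝ) × ℝ => (Fin.cons z.2 z.1 : Fin (n + 1) → ℝ)) volume volume := by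
  have h := (volume_preserving_piFinSuccAbove (fun _ : Fin (n + 1) => ℝ) 0).symm
  have h2 := h.comp (Measure.measurePreserving_swap (μ := (volume : Measure (Fin n → ℝ)))
    (ν := (volume : Measure ℝ)))
  have e : (fun z : (Fin n → ℝ) × ℝ => (Fin.cons z.2 z.1 : Fin (n + 1) → ℝ)) =
      (MeasurableEquiv.piFinSuccAbove (fun _ : Fin (n + 1) => ℝ) 0).symm ∘ Prod.swap := by
    ext z i
    simp [MeasurableEquiv.piFinSuccAbove]
  rw [e]
  exact h2
theorem measurable_cons (n : ℕ) : Measurable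
    (fun z : (Fin n → ℝ) × ℝ => (Fin.cons z.2 z.1 : Fin (n + 1) → ℝ)) :=
  (measurePreserving_cons n).measurable

theorem ae_ae_of_ae_cons {n : ℕ} {P : (Fin (n + 1) → ℝ) → Prop} (h : ∀ᵐ x, P x) :
    ∀ᵐ y : Fin n → ℝ, ∀ᵐ t : ℝ, P (Fin.cons t y) :=
  Measure.ae_ae_of_ae_prod ((measurePreserving_cons n).quasiMeasurePreserving.ae h)

theorem lintegral_cons {n : ℕ} {F : (Fin (n + 1) → ℝ) → ℝ≥0∞} (hF : Measurable F) :
    ∫⁻ x, F x = ∫⁻ y : Fin n → ℝ, ∫⁻ t : ℝ, F (Fin.cons t y) := by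
  rw [← (measurePreserving_cons n).lintegral_comp hF]
  exact lintegral_prod _ (hF.comp (measurable_cons n)).aemeasurable

/-- The volume on the one-point space is a Dirac mass. This is the base case of the inductions with
almost everywhere hypotheses. -/
theorem ae_fin_zero {P : (Fin 0 → ℝ) → Prop} (h : ∀ᵐ x, P x) (x : Fin 0 → ℝ) : P x := by
  rw [volume_pi, Measure.pi_of_empty _ x, ae_dirac_eq] at h
  exact h

theorem iteratedNorm_mono_ae {n : ℕ} {q : Fin n → ℝ} (hq : ∀ i, 0 ≤ q i)
    {F G : (Fin n → ℝ) → ℝ≥0∞} (h : ∀ᵐ x, F x ≤ G x) :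
    iteratedNorm n q F ≤ iteratedNorm n q G := by
  induction n with
  | zero => exact ae_fin_zero h _
  | succ n ih =>
    refine ih (fun i => hq _) ?_
    filter_upwards [ae_ae_of_ae_cons h] with y hy
    refine ENNReal.rpow_le_rpow (lintegral_mono_ae ?_) (by simpa using hq 0)
    filter_upwards [hy] with t ht using ENNReal.rpow_le_rpow ht (hq 0)

theorem iteratedNorm_mono {n : ℕ} {q : Fin n → ℝ} (hq : ∀ i, 0 ≤ q i)
    {F G : (Fin n → ℝ) → ℝ≥0∞} (h : ∀ x, F x ≤ G x) :
    iteratedNorm n q F ≤ iteratedNorm n q G :=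
  iteratedNorm_mono_ae hq (Filter.Eventually.of_forall h)

theorem iteratedNorm_congr_ae {n : ℕ} {q : Fin n → ℝ} (hq : ∀ i, 0 ≤ q i)
    {F G : (Fin n → ℝ) → ℝ≥0∞} (h : F =ᵐ[volume] G) :
    iteratedNorm n q F = iteratedNorm n q G :=
  le_antisymm (iteratedNorm_mono_ae hq h.le) (iteratedNorm_mono_ae hq h.symm.le)

theorem measurable_innerNorm {n : ℕ} {Z : Type*} [MeasurableSpace Z] (p : ℝ)
    {F : Z → (Fin (n + 1) → ℝ) → ℝ≥0∞} (hF : Measurable (Function.uncurry F)) :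
    Measurable (Function.uncurry fun (z : Z) (y : Fin n → ℝ) =>
      (∫⁻ t : ℝ, F z (Fin.cons t y) ^ p) ^ (1 / p)) := by
  refine Measurable.pow_const ?_ _
  refine Measurable.lintegral_prod_right' (f := fun w : (Z × (Fin n → ℝ)) × ℝ =>
    F w.1.1 (Fin.cons w.2 w.1.2) ^ p) ?_
  refine Measurable.pow_const ?_ _
  exact hF.comp ((measurable_fst.comp measurable_fst).prodMk
    ((measurable_cons n).comp ((measurable_snd.comp measurable_fst).prodMk measurable_snd)))

theorem measurable_innerNorm' {n : ℕ} (p : ℝ)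
    {F : (Fin (n + 1) → ℝ) → ℝ≥0∞} (hF : Measurable F) :
    Measurable fun (y : Fin n → ℝ) => (∫⁻ t : ℝ, F (Fin.cons t y) ^ p) ^ (1 / p) := by
  refine Measurable.pow_const ?_ _
  refine Measurable.lintegral_prod_right' (f := fun w : (Fin n → ℝ) × ℝ =>
    F (Fin.cons w.2 w.1) ^ p) ?_
  exact (hF.comp (measurable_cons n)).pow_const _

/-- The parameter is carried along because iterated norms are later integrated over it; the
induction needs the inner norm to be jointly measurable in the parameter and the remaining
variables. -/
theorem measurable_iteratedNorm {n : ℕ} {Z : Type*} [MeasurableSpace Z] (q : Fin n → ℝ)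
    {F : Z → (Fin n → ℝ) → ℝ≥0∞} (hF : Measurable (Function.uncurry F)) :
    Measurable fun z => iteratedNorm n q (F z) := by
  induction n with
  | zero => exact hF.comp (measurable_id.prodMk measurable_const)
  | succ n ih => exact ih _ (measurable_innerNorm _ hF)

/-- Minkowski's integral inequality is applied in one variable at a time, the innermost first. -/
theorem iteratedNorm_lintegral_le {n : ℕ} {Z : Type*} [MeasurableSpace Z] {ν : Measure Z}
    [SFinite ν] {q : Fin n → ℝ} (hq : ∀ i, 1 ≤ q i)
    {F : Z → (Fin n → ℝ) → ℝ≥0∞} (hF : Measurable (Function.uncurry F)) :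
    iteratedNorm n q (fun x => ∫⁻ z, F z x ∂ν) ≤ ∫⁻ z, iteratedNorm n q (F z) ∂ν := by
  induction n with
  | zero => exact le_rfl
  | succ n ih =>
    refine le_trans ?_ (ih (fun i => hq _) (measurable_innerNorm (q 0) hF))
    refine iteratedNorm_mono (fun i => zero_le_one.trans (hq _)) fun y => ?_
    exact lintegral_rpow_lintegral_le (F := fun t z => F z (Fin.cons t y))
      (hF.comp (measurable_snd.prodMk ((measurable_cons n).comp
        (measurable_const.prodMk measurable_fst)))) (hq 0)

theorem iteratedNorm_add_le {n : ℕ} {q : Fin n → ℝ} (hq : ∀ i, 1 ≤ q i)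
    {F G : (Fin n → ℝ) → ℝ≥0∞} (hF : Measurable F) (hG : Measurable G) :
    iteratedNorm n q (fun x => F x + G x) ≤ iteratedNorm n q F + iteratedNorm n q G := by
  induction n with
  | zero => exact le_rfl
  | succ n ih =>
    refine le_trans ?_ (ih (fun i => hq _) (measurable_innerNorm' (q 0) hF)
      (measurable_innerNorm' (q 0) hG))
    refine iteratedNorm_mono (fun i => zero_le_one.trans (hq _)) fun y => ?_
    have hc : Measurable fun t : ℝ => (Fin.cons t y : Fin (n + 1) → ℝ) :=
      (measurable_cons n).comp (measurable_const.prodMk measurable_id)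
    exact ENNReal.lintegral_Lp_add_le (hF.comp hc).aemeasurable (hG.comp hc).aemeasurable (hq 0)

theorem iteratedNorm_zero {n : ℕ} {q : Fin n → ℝ} (hq : ∀ i, 0 < q i) :
    iteratedNorm n q (fun _ => 0) = 0 := by
  induction n with
  | zero => rfl
  | succ n ih =>
    have := hq 0
    simpa [iteratedNorm, ENNReal.zero_rpow_of_pos this, ENNReal.zero_rpow_of_pos (inv_pos.2 this)]
      using ih (fun i => hq _)

theorem iteratedNorm_const_mul {n : ℕ} {q : Fin n → ℝ} (hq : ∀ i, 0 < q i)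
    {F : (Fin n → ℝ) → ℝ≥0∞} (hF : Measurable F) (c : ℝ≥0∞) :
    iteratedNorm n q (fun x => c * F x) = c * iteratedNorm n q F := by
  induction n with
  | zero => rfl
  | succ n ih =>
    have h0 := hq 0
    refine Eq.trans ?_ (ih (fun i => hq _) (measurable_innerNorm' (q 0) hF))
    change iteratedNorm n _ _ = _
    congr 1
    ext y
    have hc : Measurable fun t : ℝ => (Fin.cons t y : Fin (n + 1) → ℝ) :=
      (measurable_cons n).comp (measurable_const.prodMk measurable_id)
    simp_rw [ENNReal.mul_rpow_of_nonneg _ _ h0.le]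
    have hm : Measurable fun t : ℝ => F (Fin.cons t y) := hF.comp hc
    rw [lintegral_const_mul _ (hm.pow_const _),
      ENNReal.mul_rpow_of_nonneg _ _ (by positivity), ← ENNReal.rpow_mul]
    simp [h0.ne']

theorem iteratedNorm_finset_sum_le {n : ℕ} {q : Fin n → ℝ} (hq : ∀ i, 1 ≤ q i) {ι : Type*}
    (s : Finset ι) {F : ι → (Fin n → ℝ) → ℝ≥0∞} (hF : ∀ i, Measurable (F i)) :
    iteratedNorm n q (fun x => ∑ i ∈ s, F i x) ≤ ∑ i ∈ s, iteratedNorm n q (F i) := by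
  classical
  induction s using Finset.induction_on with
  | empty => simp [iteratedNorm_zero fun i => zero_lt_one.trans_le (hq i)]
  | insert a s ha ih =>
    simp_rw [Finset.sum_insert ha]
    refine (iteratedNorm_add_le hq (hF a) (Finset.measurable_sum _ fun i _ => hF i)).trans ?_
    gcongr

theorem iteratedNorm_iSup {n : ℕ} {q : Fin n → ℝ} (hq : ∀ i, 0 < q i)
    {F : ℕ → (Fin n → ℝ) → ℝ≥0∞} (hF : ∀ k, Measurable (F k)) (hmono : Monotone F) :
    iteratedNorm n q (fun x => ⨆ k, F k x) = ⨆ k, iteratedNorm n q (F k) := by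
  induction n with
  | zero => rfl
  | succ n ih =>
    have h0 := hq 0
    have h0' : 0 < 1 / q 0 := by positivity
    refine Eq.trans ?_ (ih (fun i => hq _) (fun k => measurable_innerNorm' (q 0) (hF k)) ?_)
    · change iteratedNorm n _ _ = _
      congr 1
      ext y
      have hc : Measurable fun t : ℝ => (Fin.cons t y : Fin (n + 1) → ℝ) :=
        (measurable_cons n).comp (measurable_const.prodMk measurable_id)
      have e1 : ∀ t : ℝ, (⨆ k, F k (Fin.cons t y)) ^ q 0 = ⨆ k, F k (Fin.cons t y) ^ q 0 :=
        fun t => (ENNReal.orderIsoRpow (q 0) h0).map_iSup _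
      simp_rw [e1]
      have hm : ∀ k, Measurable fun t : ℝ => F k (Fin.cons t y) := fun k => (hF k).comp hc
      rw [lintegral_iSup (fun k => (hm k).pow_const _)
        (fun a b h t => ENNReal.rpow_le_rpow (hmono h _) h0.le)]
      exact (ENNReal.orderIsoRpow (1 / q 0) h0').map_iSup _
    · intro a b h y
      exact ENNReal.rpow_le_rpow (lintegral_mono fun t =>
        ENNReal.rpow_le_rpow (hmono h _) h0.le) h0'.le

/-- Fatou's lemma follows from monotone convergence applied to the increasing infima of the tails.
-/
theorem iteratedNorm_liminf_le {n : ℕ} {q : Fin n → ℝ} (hq : ∀ i, 0 < q i)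
    {F : ℕ → (Fin n → ℝ) → ℝ≥0∞} (hF : ∀ k, Measurable (F k)) :
    iteratedNorm n q (fun x => Filter.liminf (fun k => F k x) Filter.atTop) ≤
      Filter.liminf (fun k => iteratedNorm n q (F k)) Filter.atTop := by
  simp_rw [Filter.liminf_eq_iSup_iInf_of_nat]
  rw [iteratedNorm_iSup hq (fun k => Measurable.iInf fun i => Measurable.iInf fun _ => hF i)]
  · refine iSup_mono fun k => le_iInf₂ fun i hi => ?_
    exact iteratedNorm_mono (fun i => (hq i).le) fun x => iInf₂_le i hi
  · intro a b hab x
    exact le_iInf₂ fun i hi => iInf₂_le i (hab.trans hi)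

/-- For equal exponents each root is undone by the next power, and Tonelli reassembles the integral.
-/
theorem iteratedNorm_const_exponent {n : ℕ} {r : ℝ} (hr : 0 < r) {F : (Fin n → ℝ) → ℝ≥0∞}
    (hF : Measurable F) :
    iteratedNorm n (fun _ => r) F = (∫⁻ x, F x ^ r) ^ (1 / r) := by
  induction n with
  | zero =>
    rw [volume_pi, Measure.pi_of_empty _ Fin.elim0, lintegral_dirac, ← ENNReal.rpow_mul]
    simp [iteratedNorm, hr.ne']
  | succ n ih =>
    rw [lintegral_cons (hF.pow_const r)]
    refine (ih (measurable_innerNorm' r hF)).trans ?_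
    congr 2
    ext y
    rw [← ENNReal.rpow_mul]; simp [hr.ne']


/-! ### Hölder's inequality and duality for iterated norms -/

theorem measurable_cons_left {n : ℕ} {F : (Fin (n + 1) → ℝ) → ℝ≥0∞} (hF : Measurable F)
    (y : Fin n → ℝ) : Measurable fun t : ℝ => F (Fin.cons t y) :=
  hF.comp ((measurable_cons n).comp (measurable_const.prodMk measurable_id))

theorem measurable_fin_tail (n : ℕ) : Measurable fun x : Fin (n + 1) → ℝ => (Fin.tail x) :=
  measurable_pi_lambda _ fun i => measurable_pi_apply i.succ

theorem lintegral_mul_le_iteratedNorm_mul {n : ℕ} {q q' : Fin n → ℝ}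
    (hq : ∀ i, (q i).HolderConjugate (q' i)) {F G : (Fin n → ℝ) → ℝ≥0∞} (hF : Measurable F)
    (hG : Measurable G) :
    ∫⁻ x, F x * G x ≤ iteratedNorm n q F * iteratedNorm n q' G := by
  induction n with
  | zero =>
    rw [volume_pi, Measure.pi_of_empty _ Fin.elim0, lintegral_dirac]
    rfl
  | succ n ih =>
    rw [lintegral_cons (F := fun x => F x * G x) (hF.mul hG)]
    refine le_trans (lintegral_mono fun y => ?_) (ih (fun i => hq _)
      (measurable_innerNorm' (q 0) hF) (measurable_innerNorm' (q' 0) hG))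
    exact ENNReal.lintegral_mul_le_Lp_mul_Lq _ (hq 0) (measurable_cons_left hF y).aemeasurable
      (measurable_cons_left hG y).aemeasurable

/-- In the innermost variable the support lies in an interval of length `2 * R`. Together with
`innerNorm_support`, this keeps boundedness and bounded support through inductions on the number of
variables. -/
theorem innerNorm_le_of_bounded {n : ℕ} {F : (Fin (n + 1) → ℝ) → ℝ≥0∞} {p : ℝ} (hp : 0 < p)
    {M : ℝ≥0∞} {c : Fin (n + 1) → ℝ} {R : ℝ} (hM : ∀ x, F x ≤ M)
    (hR : ∀ x, F x ≠ 0 → ∀ i, |x i - c i| ≤ R) (y : Fin n → ℝ) :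
    (∫⁻ t : ℝ, F (Fin.cons t y) ^ p) ^ (1 / p) ≤ M * ENNReal.ofReal (2 * R) ^ (1 / p) := by
  calc (∫⁻ t : ℝ, F (Fin.cons t y) ^ p) ^ (1 / p)
      ≤ (∫⁻ t : ℝ, (Set.Icc (c 0 - R) (c 0 + R)).indicator (fun _ => M ^ p) t) ^ (1 / p) := by
        gcongr with t
        by_cases h : F (Fin.cons t y) = 0
        · simp [h, hp]
        · have := hR _ h 0
          rw [Fin.cons_zero, abs_le] at this
          rw [Set.indicator_of_mem (by constructor <;> linarith)]
          exact ENNReal.rpow_le_rpow (hM _) hp.le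
    _ = M * ENNReal.ofReal (2 * R) ^ (1 / p) := by
        rw [lintegral_indicator measurableSet_Icc, setLIntegral_const, Real.volume_Icc,
          ENNReal.mul_rpow_of_nonneg _ _ (by positivity), ← ENNReal.rpow_mul]
        have : c 0 + R - (c 0 - R) = 2 * R := by ring
        simp [hp.ne', this]

theorem innerNorm_support {n : ℕ} {F : (Fin (n + 1) → ℝ) → ℝ≥0∞} {p : ℝ} (hp : 0 < p)
    {c : Fin (n + 1) → ℝ} {R : ℝ}
    (hR : ∀ x, F x ≠ 0 → ∀ i, |x i - c i| ≤ R) (y : Fin n → ℝ)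
    (hy : (∫⁻ t : ℝ, F (Fin.cons t y) ^ p) ^ (1 / p) ≠ 0) (i : Fin n) :
    |y i - c i.succ| ≤ R := by
  by_contra hlt
  apply hy
  have : ∀ t : ℝ, F (Fin.cons t y) = 0 := fun t => by
    by_contra h
    exact hlt (by simpa using hR _ h i.succ)
  simp [this, hp, ENNReal.zero_rpow_of_pos hp]

/-- The iterated norm of a bounded function with bounded support is attained in the duality with
the iterated norm of the conjugate exponents. -/
theorem exists_lintegral_mul_eq_iteratedNorm {n : ℕ} {q q' : Fin n → ℝ}
    (hq : ∀ i, (q i).HolderConjugate (q' i)) {F : (Fin n → ℝ) → ℝ≥0∞} (hF : Measurable F)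
    {M : ℝ≥0∞} (hMt : M ≠ ∞) {c : Fin n → ℝ} {R : ℝ} (hM : ∀ x, F x ≤ M)
    (hR : ∀ x, F x ≠ 0 → ∀ i, |x i - c i| ≤ R) :
    ∃ G : (Fin n → ℝ) → ℝ≥0∞, Measurable G ∧ ∫⁻ x, F x * G x = iteratedNorm n q F ∧
      iteratedNorm n q' G ≤ 1 := by
  induction n generalizing M with
  | zero =>
    refine ⟨fun _ => 1, measurable_const, ?_, le_rfl⟩
    rw [volume_pi, Measure.pi_of_empty _ Fin.elim0, lintegral_dirac, mul_one]
    rfl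
  | succ n ih =>
    have hp : 0 < q 0 := (hq 0).pos
    have hp' : 0 < q' 0 := (hq 0).symm.pos
    set N : (Fin n → ℝ) → ℝ≥0∞ := fun y => (∫⁻ t : ℝ, F (Fin.cons t y) ^ q 0) ^ (1 / q 0) with hN
    have hNm : Measurable N := measurable_innerNorm' (q 0) hF
    have hB : M * ENNReal.ofReal (2 * R) ^ (1 / q 0) ≠ ∞ :=
      ENNReal.mul_ne_top hMt (ENNReal.rpow_ne_top_of_nonneg (by positivity) ENNReal.ofReal_ne_top)
    have hNB : ∀ y, N y ≤ _ := innerNorm_le_of_bounded hp hM hR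
    obtain ⟨H, hHm, hH1, hH2⟩ := ih (q := fun i => q i.succ) (q' := fun i => q' i.succ)
      (fun i => hq _) hNm hB (c := fun i => c i.succ) hNB
      (fun y hy i => innerNorm_support hp hR y hy i)
    have hNt : ∀ y, N y ≠ ∞ := fun y => ((hNB y).trans_lt hB.lt_top).ne
    have hNpow : ∀ y, ∫⁻ t : ℝ, F (Fin.cons t y) ^ q 0 = N y ^ q 0 := fun y => by
      simp only [hN]
      rw [← ENNReal.rpow_mul]; simp [hp.ne']
    -- The factor `N ^ (1 - q 0) * F ^ (q 0 - 1)` is the normalized extremal function for `F` in the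
    -- innermost variable, and `H` is extremal for `N` in the others. Where `N` vanishes, `N ^ (1 -
    -- q 0)` is `∞`; the convention `0 * ∞ = 0` makes the inner integrals zero there.
    set G : (Fin (n + 1) → ℝ) → ℝ≥0∞ := fun x =>
      (H (Fin.tail x) * N (Fin.tail x) ^ (1 - q 0)) * F x ^ (q 0 - 1) with hG
    have hGm : Measurable G := ((hHm.comp (measurable_fin_tail n)).mul
      ((hNm.comp (measurable_fin_tail n)).pow_const _)).mul (hF.pow_const _)
    refine ⟨G, hGm, ?_, ?_⟩
    · rw [lintegral_cons (F := fun x => F x * G x) (hF.mul hGm)]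
      refine Eq.trans (lintegral_congr fun y => ?_) hH1
      have hFy := measurable_cons_left hF y
      have e1 : ∀ t : ℝ, F (Fin.cons t y) * G (Fin.cons t y) =
          (H y * N y ^ (1 - q 0)) * F (Fin.cons t y) ^ q 0 := fun t => by
        simp only [hG, Fin.tail_cons]
        have : F (Fin.cons t y) * F (Fin.cons t y) ^ (q 0 - 1) = F (Fin.cons t y) ^ q 0 := by
          rcases eq_or_ne (F (Fin.cons t y)) 0 with h | h
          · simp [h, hp]
          · conv_lhs => rw [← ENNReal.rpow_one (F (Fin.cons t y)), ← ENNReal.rpow_mul, one_mul,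
              ← ENNReal.rpow_add _ _ h ((hM _).trans_lt hMt.lt_top).ne]
            congr 1; ring
        rw [← this]; ring
      simp_rw [e1]
      rw [lintegral_const_mul _ (hFy.pow_const _), hNpow]
      rcases eq_or_ne (N y) 0 with h | h
      · simp [h, hp]
      · rw [mul_assoc, ← ENNReal.rpow_add _ _ h (hNt y)]
        simp [mul_comm]
    · refine le_trans ?_ hH2
      refine iteratedNorm_mono (fun i => (hq _).symm.pos.le) fun y => ?_
      have hFy := measurable_cons_left hF y
      simp only [hG, Fin.tail_cons]
      simp_rw [ENNReal.mul_rpow_of_nonneg _ _ hp'.le]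
      rw [lintegral_const_mul _ ((hFy.pow_const _).pow_const _)]
      simp_rw [← ENNReal.rpow_mul, (hq 0).sub_one_mul_conj]
      rw [hNpow]
      have hNty := hNt y
      generalize N y = v at hNty ⊢
      rw [ENNReal.mul_rpow_of_nonneg _ _ (by positivity), ENNReal.mul_rpow_of_nonneg _ _ (by positivity), ← ENNReal.rpow_mul, ← ENNReal.rpow_mul,
        ← ENNReal.rpow_mul]
      have e2 : q 0 * (1 / q' 0) = q 0 - 1 := by
        have := (hq 0).sub_one_mul_conj
        field_simp; linarith
      have e3 : q' 0 * (1 / q' 0) = 1 := by field_simp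
      rw [e2, mul_assoc (1 - q 0), e3, mul_one, ENNReal.rpow_one, mul_assoc]
      rcases eq_or_ne v 0 with h | h
      · have h1 := (hq 0).lt
        simp [h, h1]
      · rw [← ENNReal.rpow_add _ _ h hNty]
        simp

/-! ### Iterated norms on cubes -/

/-- This is Hölder's inequality on an interval of length `2 * r` that carries the support of `f`. -/
theorem innerNorm_holder {f : ℝ → ℝ≥0∞} (hf : Measurable f) {s p : ℝ} (hs : 0 < s) (hsp : s ≤ p)
    {c r : ℝ} (hr : ∀ t, f t ≠ 0 → |t - c| ≤ r) :
    (∫⁻ t, f t ^ s) ^ (1 / s) ≤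
      ENNReal.ofReal (2 * r) ^ (1 / s - 1 / p) * (∫⁻ t, f t ^ p) ^ (1 / p) := by
  have key := eLpNorm'_le_eLpNorm'_mul_rpow_measure_univ (ε := ℝ≥0∞)
    (μ := volume.restrict (Set.Icc (c - r) (c + r)))
    hs hsp hf.aestronglyMeasurable
  have hres : ∀ u : ℝ, 0 < u → ∫⁻ t in Set.Icc (c - r) (c + r), f t ^ u = ∫⁻ t, f t ^ u := by
    intro u hu
    rw [← lintegral_indicator measurableSet_Icc]
    refine lintegral_congr fun t => ?_
    by_cases h : f t = 0
    · simp [Set.indicator, h, hu]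
    · have := hr t h
      rw [abs_le] at this
      rw [Set.indicator_of_mem]
      constructor <;> linarith
  simp only [eLpNorm', enorm_eq_self, hres s hs, hres p (hs.trans_le hsp),
    Measure.restrict_apply_univ, Real.volume_Icc] at key
  rw [mul_comm]
  convert key using 4
  ring

/-- Each variable contributes one factor `(2 * r) ^ (1 / s - 1 / q i)`. This embeds the mixed norm
on a cube into `L^s`, for any `s` below all the exponents. -/
theorem iteratedNorm_holder {n : ℕ} {q : Fin n → ℝ} {s : ℝ} (hs : 0 < s) (hq : ∀ i, s ≤ q i)
    {F : (Fin n → ℝ) → ℝ≥0∞} (hF : Measurable F) {c : Fin n → ℝ} {r : ℝ} (hr0 : 0 < r)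
    (hr : ∀ x, F x ≠ 0 → ∀ i, |x i - c i| ≤ r) :
    (∫⁻ x, F x ^ s) ^ (1 / s) ≤
      ENNReal.ofReal (2 * r) ^ (∑ i, (1 / s - 1 / q i)) * iteratedNorm n q F := by
  rw [← iteratedNorm_const_exponent hs hF]
  induction n with
  | zero => simp [iteratedNorm]
  | succ n ih =>
    have hp : 0 < q 0 := hs.trans_le (hq 0)
    have hNm := measurable_innerNorm' (q 0) hF
    calc iteratedNorm (n + 1) (fun _ => s) F
        ≤ iteratedNorm n (fun _ => s) (fun y => ENNReal.ofReal (2 * r) ^ (1 / s - 1 / q 0) *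
            (∫⁻ t : ℝ, F (Fin.cons t y) ^ q 0) ^ (1 / q 0)) := by
          refine iteratedNorm_mono (fun _ => hs.le) fun y => ?_
          refine innerNorm_holder (measurable_cons_left hF y) hs (hq 0) (c := c 0) fun t ht => ?_
          simpa using hr _ ht 0
      _ = ENNReal.ofReal (2 * r) ^ (1 / s - 1 / q 0) * iteratedNorm n (fun _ => s) (fun y =>
            (∫⁻ t : ℝ, F (Fin.cons t y) ^ q 0) ^ (1 / q 0)) :=
          iteratedNorm_const_mul (fun _ => hs) hNm _
      _ ≤ ENNReal.ofReal (2 * r) ^ (1 / s - 1 / q 0) *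
          (ENNReal.ofReal (2 * r) ^ (∑ i : Fin n, (1 / s - 1 / q i.succ)) *
            iteratedNorm n (fun i => q i.succ) (fun y =>
            (∫⁻ t : ℝ, F (Fin.cons t y) ^ q 0) ^ (1 / q 0))) := by
          gcongr
          exact ih (fun i => hq _) hNm (c := fun i => c i.succ) fun y hy i =>
            innerNorm_support hp hr y hy i
      _ = _ := by
          rw [← mul_assoc, ← ENNReal.rpow_add _ _ (by simp [hr0]) ENNReal.ofReal_ne_top, Fin.sum_univ_succ]
          rfl

theorem iteratedNorm_cube_le {n : ℕ} {q : Fin n → ℝ} (hq : ∀ i, 0 < q i)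
    {c : Fin n → ℝ} {r : ℝ} (hr0 : 0 < r) :
    iteratedNorm n q ({x | ∀ i, |x i - c i| ≤ r}.indicator fun _ => 1) ≤
      ENNReal.ofReal (2 * r) ^ (∑ i, 1 / q i) := by
  induction n with
  | zero => simp [iteratedNorm]
  | succ n ih =>
    have hp : 0 < q 0 := hq 0
    have hm : Measurable ({x : Fin n → ℝ | ∀ i, |x i - c i.succ| ≤ r}.indicator
        fun _ => (1 : ℝ≥0∞)) := by
      refine measurable_const.indicator ?_
      rw [Set.ofPred_forall]
      refine MeasurableSet.iInter fun i => measurableSet_le ?_ measurable_const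
      exact ((measurable_pi_apply i).sub_const _).abs
    calc iteratedNorm (n + 1) q ({x | ∀ i, |x i - c i| ≤ r}.indicator fun _ => 1)
        ≤ iteratedNorm n (fun i => q i.succ) (fun y => ENNReal.ofReal (2 * r) ^ (1 / q 0) *
            ({x : Fin n → ℝ | ∀ i, |x i - c i.succ| ≤ r}.indicator fun _ => 1) y) := by
          refine iteratedNorm_mono (fun i => (hq _).le) fun y => ?_
          by_cases hy : ∀ i, |y i - c i.succ| ≤ r
          · rw [Set.indicator_of_mem (by exact hy), mul_comm]
            refine innerNorm_le_of_bounded hp (c := c) (fun x => ?_) (fun x hx => ?_) y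
            · exact Set.indicator_le_self _ _ _
            · by_contra h
              exact hx (Set.indicator_of_notMem (by exact h) _)
          · have : ∀ t : ℝ, ({x : Fin (n + 1) → ℝ | ∀ i, |x i - c i| ≤ r}.indicator
                (fun _ => (1 : ℝ≥0∞))) (Fin.cons t y) = 0 := fun t => by
              refine Set.indicator_of_notMem (fun h => hy fun i => ?_) _
              simpa using h i.succ
            simp [this, hp, ENNReal.zero_rpow_of_pos hp]
      _ = ENNReal.ofReal (2 * r) ^ (1 / q 0) * _ := iteratedNorm_const_mul (fun i => hq _) hm _
      _ ≤ ENNReal.ofReal (2 * r) ^ (1 / q 0) *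
          ENNReal.ofReal (2 * r) ^ (∑ i : Fin n, 1 / q i.succ) := by
          gcongr
          exact ih (fun i => hq _)
      _ = _ := by
          rw [← ENNReal.rpow_add _ _ (by simp [hr0]) ENNReal.ofReal_ne_top, Fin.sum_univ_succ]

/-! ### Splitting the variables -/

/-- The measurable equivalence which lets the first `j` coordinates be `x` and the remaining `m`
coordinates be `y`. -/
noncomputable def glue (m j : ℕ) : (Fin j → ℝ) × (Fin m → ℝ) ≃ᵐ (Fin (m + j) → ℝ) :=
  (MeasurableEquiv.sumPiEquivProdPi (fun _ : Fin j ⊕ Fin m => ℝ)).symm.trans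
    (MeasurableEquiv.piCongrLeft (fun _ => ℝ) (finSumFinEquiv.trans (finCongr (add_comm j m))))

theorem measurePreserving_glue (m j : ℕ) : MeasurePreserving (glue m j) volume volume :=
  (volume_measurePreserving_piCongrLeft (fun _ => ℝ)
    (finSumFinEquiv.trans (finCongr (add_comm j m)))).comp
    (volume_measurePreserving_sumPiEquivProdPi_symm (fun _ : Fin j ⊕ Fin m => ℝ))

theorem glue_apply_left (m j : ℕ) (z : (Fin j → ℝ) × (Fin m → ℝ)) (i : Fin j) :
    glue m j z (finCongr (add_comm j m) (Fin.castAdd m i)) = z.1 i := by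
  have := MeasurableEquiv.piCongrLeft_apply_apply (β := fun _ => ℝ)
    (finSumFinEquiv.trans (finCongr (add_comm j m)))
    ((MeasurableEquiv.sumPiEquivProdPi (fun _ : Fin j ⊕ Fin m => ℝ)).symm z) (Sum.inl i)
  exact this

theorem glue_apply_right (m j : ℕ) (z : (Fin j → ℝ) × (Fin m → ℝ)) (i : Fin m) :
    glue m j z (finCongr (add_comm j m) (Fin.natAdd j i)) = z.2 i := by
  have := MeasurableEquiv.piCongrLeft_apply_apply (β := fun _ => ℝ)
    (finSumFinEquiv.trans (finCongr (add_comm j m)))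
    ((MeasurableEquiv.sumPiEquivProdPi (fun _ : Fin j ⊕ Fin m => ℝ)).symm z) (Sum.inr i)
  exact this

theorem forall_fin_glue {m j : ℕ} {P : Fin (m + j) → Prop} :
    (∀ i, P i) ↔ (∀ i : Fin j, P (finCongr (add_comm j m) (Fin.castAdd m i))) ∧
      ∀ i : Fin m, P (finCongr (add_comm j m) (Fin.natAdd j i)) := by
  refine ⟨fun h => ⟨fun i => h _, fun i => h _⟩, fun h i => ?_⟩
  obtain ⟨i, rfl⟩ := (finSumFinEquiv.trans (finCongr (add_comm j m))).surjective i
  rcases i with i | i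
  · exact h.1 i
  · exact h.2 i

theorem glue_zero (m : ℕ) (x : Fin 0 → ℝ) (y : Fin m → ℝ) : glue m 0 (x, y) = y := by
  ext i
  have := glue_apply_right m 0 (x, y) i
  convert this using 2
  ext; simp

theorem glue_cons (m j : ℕ) (t : ℝ) (x : Fin j → ℝ) (y : Fin m → ℝ) :
    glue m (j + 1) (Fin.cons t x, y) = (Fin.cons t (glue m j (x, y)) : Fin (m + j + 1) → ℝ) := by
  refine funext ((forall_fin_glue (P := fun i => glue m (j + 1) (Fin.cons t x, y) i =
    (Fin.cons t (glue m j (x, y)) : Fin (m + j + 1) → ℝ) i)).2 ⟨fun i => ?_, fun i => ?_⟩)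
  · rw [glue_apply_left]
    refine Fin.cases ?_ (fun i => ?_) i
    · have : (finCongr (add_comm (j + 1) m)) (Fin.castAdd m 0) = (0 : Fin (m + j + 1)) := by
        ext; simp
      rw [this]; simp
    · have : (finCongr (add_comm (j + 1) m)) (Fin.castAdd m i.succ) =
          ((finCongr (add_comm j m) (Fin.castAdd m i)).succ : Fin (m + j + 1)) := by
        ext; simp
      rw [this, Fin.cons_succ, glue_apply_left]; simp
  · have : (finCongr (add_comm (j + 1) m)) (Fin.natAdd (j + 1) i) =
        ((finCongr (add_comm j m) (Fin.natAdd j i)).succ : Fin (m + j + 1)) := by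
      ext; simp; omega
    rw [glue_apply_right, this, Fin.cons_succ, glue_apply_right]

/-- The outer integrations all have the exponent `r` and collapse into a single `L^r` norm. The
dimension is written `m + j` because `m + (j + 1)` is by definition `(m + j) + 1`, so that the
recursion strips the first coordinate in an induction on `j`. -/
theorem iteratedNorm_glue {m j : ℕ} {q : Fin (m + j) → ℝ} {r : ℝ} (hr : 0 < r)
    (hq : ∀ i : Fin m, q (finCongr (add_comm j m) (Fin.natAdd j i)) = r)
    {F : (Fin (m + j) → ℝ) → ℝ≥0∞} (hF : Measurable F) :
    iteratedNorm (m + j) q F = (∫⁻ y : Fin m → ℝ, iteratedNorm j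
      (fun i => q (finCongr (add_comm j m) (Fin.castAdd m i)))
      (fun x => F (glue m j (x, y))) ^ r) ^ (1 / r) := by
  induction j with
  | zero =>
    have : q = fun _ => r := by
      ext i
      rw [← hq i]
      congr 1
      ext; simp
    subst this
    simp only [iteratedNorm, glue_zero]
    exact iteratedNorm_const_exponent hr hF
  | succ j ih =>
    refine (ih (q := fun i => q i.succ) (fun i => ?_) (measurable_innerNorm' (q 0) hF)).trans ?_
    · rw [← hq i]
      congr 1
      ext; simp; omega
    · simp only [iteratedNorm, glue_cons]
      rfl


/-! ### From distributional estimates to norm estimates -/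

theorem lintegral_Ioo_rpow {e w : ℝ} (he : 0 < e) (hw : 0 ≤ w) :
    ∫⁻ t in Set.Ioo 0 w, ENNReal.ofReal (t ^ (e - 1)) = ENNReal.ofReal (w ^ e / e) := by
  have hint : IntegrableOn (fun t : ℝ => t ^ (e - 1)) (Set.Ioc 0 w) :=
    (intervalIntegrable_iff_integrableOn_Ioc_of_le hw).1
      (intervalIntegral.intervalIntegrable_rpow' (by linarith))
  rw [← ofReal_integral_eq_lintegral_ofReal (hint.mono_set Set.Ioo_subset_Ioc_self),
    ← integral_Ioc_eq_integral_Ioo, ← intervalIntegral.integral_of_le hw, integral_rpow]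
  · simp [he.ne']
  · left; linarith
  · filter_upwards [self_mem_ae_restrict measurableSet_Ioo] with t ht
    exact Real.rpow_nonneg ht.1.le _

theorem lintegral_Ioi_rpow {e a : ℝ} (he : 0 < e) (ha : 0 < a) :
    ∫⁻ t in Set.Ioi a, ENNReal.ofReal (t ^ (-e - 1)) = ENNReal.ofReal (a ^ (-e) / e) := by
  have hint : IntegrableOn (fun t : ℝ => t ^ (-e - 1)) (Set.Ioi a) :=
    integrableOn_Ioi_rpow_of_lt (by linarith) ha
  rw [← ofReal_integral_eq_lintegral_ofReal hint, integral_Ioi_rpow_of_lt (by linarith) ha]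
  · congr 1
    have : -e - 1 + 1 = -e := by ring
    rw [this, div_neg, neg_div, neg_neg]
  · filter_upwards [self_mem_ae_restrict measurableSet_Ioi] with t ht
    exact Real.rpow_nonneg (ha.trans ht).le _

/-- This is the layer cake formula at the levels `2 * t`, where the distributional estimate is
available; the factor `2 ^ s` pays for the doubling. -/
theorem rpow_le_lintegral_layer (v : ℝ≥0∞) {s : ℝ} (hs : 0 < s) :
    v ^ s ≤ ENNReal.ofReal (s * 2 ^ s) *
      ∫⁻ t in Set.Ioi (0 : ℝ), if 2 * ENNReal.ofReal t < v then ENNReal.ofReal (t ^ (s - 1))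
        else 0 := by
  -- Working with finite `c < v ^ s` covers the case `v = ∞` as well.
  refine ENNReal.le_of_forall_nnreal_lt fun c hc => ?_
  set w : ℝ≥0 := c ^ (1 / s) with hw
  have hcw : (w : ℝ) ^ s = c := by
    rw [hw, NNReal.coe_rpow, ← Real.rpow_mul c.coe_nonneg]; simp [hs.ne']
  have hwv : (w : ℝ≥0∞) < v := by
    rw [hw, ENNReal.coe_rpow_of_nonneg _ (by positivity)]
    calc (c : ℝ≥0∞) ^ (1 / s) < (v ^ s) ^ (1 / s) := ENNReal.rpow_lt_rpow hc (by positivity)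
      _ = v := by rw [← ENNReal.rpow_mul]; simp [hs.ne']
  have hw0 : (0 : ℝ) ≤ w := w.2
  calc (c : ℝ≥0∞) = ENNReal.ofReal (s * 2 ^ s) * ENNReal.ofReal ((w / 2 : ℝ) ^ s / s) := by
        rw [← ENNReal.ofReal_mul (by positivity), Real.div_rpow hw0 (by norm_num), hcw]
        have : s * 2 ^ s * ((c : ℝ) / 2 ^ s / s) = c := by field_simp
        rw [this, ENNReal.ofReal_coe_nnreal]
    _ = ENNReal.ofReal (s * 2 ^ s) *
        ∫⁻ t in Set.Ioo 0 (w / 2 : ℝ), ENNReal.ofReal (t ^ (s - 1)) := by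
        rw [lintegral_Ioo_rpow hs (by positivity)]
    _ ≤ _ := by
        refine mul_le_mul_right ?_ _
        rw [← lintegral_indicator measurableSet_Ioo, ← lintegral_indicator measurableSet_Ioi]
        refine lintegral_mono fun t => ?_
        by_cases ht : t ∈ Set.Ioo 0 (w / 2 : ℝ)
        · rw [Set.indicator_of_mem ht, Set.indicator_of_mem (show t ∈ Set.Ioi 0 from ht.1), if_pos]
          refine lt_trans ?_ hwv
          have h2 : (2 : ℝ≥0∞) = ENNReal.ofReal 2 := by simp
          rw [h2, ← ENNReal.ofReal_mul (by norm_num), ← ENNReal.ofReal_coe_nnreal]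
          exact (ENNReal.ofReal_lt_ofReal_iff_of_nonneg (by have := ht.1; linarith)).2
            (by have := ht.2; linarith)
        · rw [Set.indicator_of_notMem ht]; exact zero_le

/-- Integrating the good term over the levels `t ≥ a` converges at infinity because `s < r`, and
returns `a ^ s`. -/
theorem lintegral_layer_low {a : ℝ≥0∞} (ha : a ≠ ∞) {r s : ℝ} (hs : 0 < s) (hsr : s < r) :
    a ^ r * ∫⁻ t in Set.Ioi (0 : ℝ), (if a ≤ ENNReal.ofReal t then ENNReal.ofReal (t ^ (s - 1 - r))
      else 0) ≤ ENNReal.ofReal (1 / (r - s)) * a ^ s := by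
  lift a to ℝ≥0 using ha
  rcases eq_or_ne a 0 with rfl | h0
  · simp [hs.trans hsr]
  have ha : (0 : ℝ) < a := by positivity
  have e1 : ∫⁻ t in Set.Ioi (0 : ℝ), (if (a : ℝ≥0∞) ≤ ENNReal.ofReal t then
      ENNReal.ofReal (t ^ (s - 1 - r)) else 0) =
      ∫⁻ t in Set.Ioi (a : ℝ), ENNReal.ofReal (t ^ (-(r - s) - 1)) := by
    rw [setLIntegral_congr (Ioi_ae_eq_Ici' (a := (a : ℝ)) (by simp)),
      ← lintegral_indicator measurableSet_Ioi, ← lintegral_indicator measurableSet_Ici]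
    refine lintegral_congr fun t => ?_
    by_cases ht : (a : ℝ) ≤ t
    · have : (a : ℝ≥0∞) ≤ ENNReal.ofReal t := by
        rw [← ENNReal.ofReal_coe_nnreal]; exact ENNReal.ofReal_le_ofReal ht
      rw [Set.indicator_of_mem (show t ∈ Set.Ici (a : ℝ) from ht),
        Set.indicator_of_mem (show t ∈ Set.Ioi 0 from ha.trans_le ht), if_pos this]
      congr 2; ring
    · rw [Set.indicator_of_notMem (show t ∉ Set.Ici (a : ℝ) from ht)]
      by_cases h0t : 0 < t
      · rw [Set.indicator_of_mem (show t ∈ Set.Ioi 0 from h0t), if_neg]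
        rw [← ENNReal.ofReal_coe_nnreal, ENNReal.ofReal_le_ofReal_iff h0t.le]
        exact ht
      · exact Set.indicator_of_notMem h0t _
  rw [e1, lintegral_Ioi_rpow (by linarith) ha, ← ENNReal.ofReal_coe_nnreal,
    ENNReal.ofReal_rpow_of_pos ha, ENNReal.ofReal_rpow_of_pos ha,
    ← ENNReal.ofReal_mul (by positivity),
    ← ENNReal.ofReal_mul (by have := sub_pos.2 hsr; positivity)]
  apply le_of_eq
  congr 1
  have : (a : ℝ) ^ s = a ^ r * a ^ (-(r - s)) := by rw [← Real.rpow_add ha]; congr 1; ring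
  rw [this]; ring

/-- Integrating the bad term over the levels `t < 2 * a` converges at `0` because `1 < s`, and again
returns a multiple of `a ^ s`. -/
theorem lintegral_layer_high {a : ℝ≥0∞} (ha : a ≠ ∞) {s : ℝ} (hs : 1 < s) :
    a * ∫⁻ t in Set.Ioi (0 : ℝ), (if ENNReal.ofReal t < 2 * a then ENNReal.ofReal (t ^ (s - 2))
      else 0) ≤ ENNReal.ofReal (2 ^ (s - 1) / (s - 1)) * a ^ s := by
  lift a to ℝ≥0 using ha
  rcases eq_or_ne a 0 with rfl | h0
  · simp
  have ha : (0 : ℝ) < a := by positivity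
  have hs1 : 0 < s - 1 := by linarith
  have e1 : ∫⁻ t in Set.Ioi (0 : ℝ), (if ENNReal.ofReal t < 2 * (a : ℝ≥0∞) then
      ENNReal.ofReal (t ^ (s - 2)) else 0) =
      ∫⁻ t in Set.Ioo 0 (2 * a : ℝ), ENNReal.ofReal (t ^ ((s - 1) - 1)) := by
    rw [← lintegral_indicator measurableSet_Ioi, ← lintegral_indicator measurableSet_Ioo]
    refine lintegral_congr fun t => ?_
    have h2 : 2 * (a : ℝ≥0∞) = ENNReal.ofReal (2 * a) := by
      rw [ENNReal.ofReal_mul (by norm_num)]; simp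
    by_cases h0t : 0 < t
    · rw [Set.indicator_of_mem (show t ∈ Set.Ioi 0 from h0t), h2]
      simp only [ENNReal.ofReal_lt_ofReal_iff_of_nonneg h0t.le]
      by_cases ht : t < 2 * a
      · rw [Set.indicator_of_mem (show t ∈ Set.Ioo 0 (2 * a : ℝ) from ⟨h0t, ht⟩), if_pos ht]
        congr 2; ring
      · rw [Set.indicator_of_notMem (fun h => ht h.2), if_neg ht]
    · rw [Set.indicator_of_notMem (show t ∉ Set.Ioi 0 from h0t),
        Set.indicator_of_notMem (fun h : t ∈ Set.Ioo 0 (2 * a : ℝ) => h0t h.1)]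
  rw [e1, lintegral_Ioo_rpow hs1 (by positivity), ← ENNReal.ofReal_coe_nnreal,
    ENNReal.ofReal_rpow_of_pos ha, ← ENNReal.ofReal_mul (by positivity),
    ← ENNReal.ofReal_mul (by positivity)]
  apply le_of_eq
  congr 1
  have : (a : ℝ) ^ s = a * a ^ (s - 1) := by
    conv_rhs => rw [← Real.rpow_one_add' ha.le (by linarith)]
    congr 1; ring
  rw [this, Real.mul_rpow (by norm_num) ha.le]; ring

/-- The integration of a distributional inequality, as in the interpolation theorem of
Marcinkiewicz. -/
theorem lintegral_rpow_le_of_distribution {β : Type*} [MeasurableSpace β] {μ : Measure β}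
    [SFinite μ] {u N : β → ℝ≥0∞} (hu : Measurable u) (hN : Measurable N) (hNt : ∀ y, N y ≠ ∞)
    {r s : ℝ} (hs : 1 < s) (hsr : s < r) {A : ℝ≥0∞}
    (h : ∀ t : ℝ, 0 < t → μ {y | 2 * ENNReal.ofReal t < u y} ≤
      A * (ENNReal.ofReal (t ^ (-r)) * (∫⁻ y, if N y ≤ ENNReal.ofReal t then N y ^ r else 0 ∂μ) +
        ENNReal.ofReal (t ^ (-1 : ℝ)) *
          ∫⁻ y, if ENNReal.ofReal t < 2 * N y then N y else 0 ∂μ)) :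
    ∫⁻ y, u y ^ s ∂μ ≤ ENNReal.ofReal (s * 2 ^ s) *
      (ENNReal.ofReal (1 / (r - s)) + ENNReal.ofReal (2 ^ (s - 1) / (s - 1))) * A *
        ∫⁻ y, N y ^ s ∂μ := by
  have hs0 : 0 < s := by linarith
  have hmt : Measurable fun z : β × ℝ => ENNReal.ofReal z.2 :=
    ENNReal.measurable_ofReal.comp measurable_snd
  have hpow : ∀ e : ℝ, Measurable fun t : ℝ => ENNReal.ofReal (t ^ e) := fun e =>
    ENNReal.measurable_ofReal.comp (measurable_id.pow_const e)
  have m1 : Measurable fun z : β × ℝ => if 2 * ENNReal.ofReal z.2 < u z.1 then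
      ENNReal.ofReal (z.2 ^ (s - 1)) else 0 :=
    Measurable.ite (measurableSet_lt (hmt.const_mul 2) (hu.comp measurable_fst))
      ((hpow _).comp measurable_snd) measurable_const
  have sA : MeasurableSet {z : ℝ × β | N z.2 ≤ ENNReal.ofReal z.1} :=
    measurableSet_le (hN.comp measurable_snd) (ENNReal.measurable_ofReal.comp measurable_fst)
  have sB : MeasurableSet {z : ℝ × β | ENNReal.ofReal z.1 < 2 * N z.2} :=
    measurableSet_lt (ENNReal.measurable_ofReal.comp measurable_fst)
      ((hN.comp measurable_snd).const_mul 2)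
  have m2 : Measurable fun z : ℝ × β => if N z.2 ≤ ENNReal.ofReal z.1 then
      ENNReal.ofReal (z.1 ^ (s - 1 - r)) * N z.2 ^ r else 0 :=
    Measurable.ite sA (((hpow _).comp measurable_fst).mul
      ((hN.comp measurable_snd).pow_const r)) measurable_const
  have m3 : Measurable fun z : ℝ × β => if ENNReal.ofReal z.1 < 2 * N z.2 then
      ENNReal.ofReal (z.1 ^ (s - 2)) * N z.2 else 0 :=
    Measurable.ite sB (((hpow _).comp measurable_fst).mul (hN.comp measurable_snd))
      measurable_const
  calc ∫⁻ y, u y ^ s ∂μ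
      ≤ ∫⁻ y, ENNReal.ofReal (s * 2 ^ s) * (∫⁻ t in Set.Ioi (0 : ℝ),
          if 2 * ENNReal.ofReal t < u y then ENNReal.ofReal (t ^ (s - 1)) else 0) ∂μ :=
        lintegral_mono fun y => rpow_le_lintegral_layer _ hs0
    _ = ENNReal.ofReal (s * 2 ^ s) * ∫⁻ t in Set.Ioi (0 : ℝ), ∫⁻ y,
          (if 2 * ENNReal.ofReal t < u y then ENNReal.ofReal (t ^ (s - 1)) else 0) ∂μ := by
        rw [lintegral_const_mul _ (m1.lintegral_prod_right' (ν := volume.restrict (Set.Ioi 0))),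
          lintegral_lintegral_swap m1.aemeasurable]
    _ ≤ ENNReal.ofReal (s * 2 ^ s) * ∫⁻ t in Set.Ioi (0 : ℝ),
          A * ((∫⁻ y, (if N y ≤ ENNReal.ofReal t then
            ENNReal.ofReal (t ^ (s - 1 - r)) * N y ^ r else 0) ∂μ) +
          ∫⁻ y, (if ENNReal.ofReal t < 2 * N y then
            ENNReal.ofReal (t ^ (s - 2)) * N y else 0) ∂μ) := by
        gcongr 1
        refine setLIntegral_mono' measurableSet_Ioi fun t (ht : 0 < t) => ?_
        have e0 : ∫⁻ y, (if 2 * ENNReal.ofReal t < u y then ENNReal.ofReal (t ^ (s - 1)) else 0) ∂μ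
            = ENNReal.ofReal (t ^ (s - 1)) * μ {y | 2 * ENNReal.ofReal t < u y} := by
          rw [← lintegral_indicator_const (measurableSet_lt measurable_const hu)]
          refine lintegral_congr fun y => ?_
          simp [Set.indicator]
        have e1 : ∀ y, (if N y ≤ ENNReal.ofReal t then
            ENNReal.ofReal (t ^ (s - 1 - r)) * N y ^ r else 0) =
            ENNReal.ofReal (t ^ (s - 1)) * (ENNReal.ofReal (t ^ (-r)) *
              if N y ≤ ENNReal.ofReal t then N y ^ r else 0) := by
          intro y
          rw [← mul_assoc, ← ENNReal.ofReal_mul (by positivity), ← Real.rpow_add ht]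
          split_ifs
          · rfl
          · simp
        have e2 : ∀ y, (if ENNReal.ofReal t < 2 * N y then
            ENNReal.ofReal (t ^ (s - 2)) * N y else 0) =
            ENNReal.ofReal (t ^ (s - 1)) * (ENNReal.ofReal (t ^ (-1 : ℝ)) *
              if ENNReal.ofReal t < 2 * N y then N y else 0) := by
          intro y
          rw [← mul_assoc, ← ENNReal.ofReal_mul (by positivity), ← Real.rpow_add ht]
          split_ifs
          · congr 3; ring
          · simp
        rw [e0]
        simp_rw [e1, e2]
        rw [lintegral_const_mul' _ _ ENNReal.ofReal_ne_top,
          lintegral_const_mul' _ _ ENNReal.ofReal_ne_top,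
          lintegral_const_mul' _ _ ENNReal.ofReal_ne_top,
          lintegral_const_mul' _ _ ENNReal.ofReal_ne_top]
        calc _ ≤ ENNReal.ofReal (t ^ (s - 1)) * _ := mul_le_mul_right (h t ht) _
          _ = _ := by ring
    -- Tonelli's theorem brings the integration over the levels inside, where it is done for each
    -- fixed value of `N`.
    _ = ENNReal.ofReal (s * 2 ^ s) * (A * ((∫⁻ y, N y ^ r * (∫⁻ t in Set.Ioi (0 : ℝ),
            (if N y ≤ ENNReal.ofReal t then ENNReal.ofReal (t ^ (s - 1 - r)) else 0)) ∂μ) +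
          ∫⁻ y, N y * (∫⁻ t in Set.Ioi (0 : ℝ), (if ENNReal.ofReal t < 2 * N y then
            ENNReal.ofReal (t ^ (s - 2)) else 0)) ∂μ)) := by
        have m2' : Measurable fun t : ℝ => ∫⁻ y, (if N y ≤ ENNReal.ofReal t then
            ENNReal.ofReal (t ^ (s - 1 - r)) * N y ^ r else 0) ∂μ :=
          m2.lintegral_prod_right' (ν := μ)
        have m3' : Measurable fun t : ℝ => ∫⁻ y, (if ENNReal.ofReal t < 2 * N y then
            ENNReal.ofReal (t ^ (s - 2)) * N y else 0) ∂μ := m3.lintegral_prod_right' (ν := μ)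
        rw [lintegral_const_mul _ (m2'.fun_add m3'), lintegral_add_left m2',
          lintegral_lintegral_swap (f := fun (t : ℝ) y => if N y ≤ ENNReal.ofReal t then
            ENNReal.ofReal (t ^ (s - 1 - r)) * N y ^ r else 0) m2.aemeasurable,
          lintegral_lintegral_swap (f := fun (t : ℝ) y => if ENNReal.ofReal t < 2 * N y then
            ENNReal.ofReal (t ^ (s - 2)) * N y else 0) m3.aemeasurable]
        congr 3
        · refine lintegral_congr fun y => ?_
          rw [← lintegral_const_mul' _ _ (ENNReal.rpow_ne_top_of_nonneg (hs0.trans hsr).le (hNt y))]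
          refine lintegral_congr fun t => ?_
          split_ifs
          · ring
          · simp
        · refine lintegral_congr fun y => ?_
          rw [← lintegral_const_mul' _ _ (hNt y)]
          refine lintegral_congr fun t => ?_
          split_ifs
          · ring
          · simp
    _ ≤ ENNReal.ofReal (s * 2 ^ s) * (A * ((∫⁻ y, ENNReal.ofReal (1 / (r - s)) * N y ^ s ∂μ) +
          ∫⁻ y, ENNReal.ofReal (2 ^ (s - 1) / (s - 1)) * N y ^ s ∂μ)) := by
        refine mul_le_mul_right (mul_le_mul_right (add_le_add ?_ ?_) _) _
        · exact lintegral_mono fun y => lintegral_layer_low (hNt y) hs0 hsr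
        · exact lintegral_mono fun y => lintegral_layer_high (hNt y) hs
    _ = _ := by
        rw [lintegral_const_mul _ (hN.pow_const _), lintegral_const_mul _ (hN.pow_const _)]
        ring

/-! ### Dyadic cubes and the Calderón–Zygmund decomposition -/

/-- The dyadic cube of generation `k` and index `v`, of side length `2 ^ k`. -/
def dyadicCube {m : ℕ} (d : ℤ × (Fin m → ℤ)) : Set (Fin m → ℝ) :=
  {y | ∀ i, ⌊y i / 2 ^ d.1⌋ = d.2 i}

/-- The centre of a dyadic cube. -/
noncomputable def dyadicCenter {m : ℕ} (d : ℤ × (Fin m → ℤ)) : Fin m → ℝ :=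
  fun i => (d.2 i + 1 / 2) * 2 ^ d.1

theorem dyadicCube_eq_pi {m : ℕ} (d : ℤ × (Fin m → ℤ)) : dyadicCube d =
    Set.univ.pi fun i => Set.Ico (d.2 i * (2 : ℝ) ^ d.1) ((d.2 i + 1) * 2 ^ d.1) := by
  ext y
  have h2 : (0 : ℝ) < 2 ^ d.1 := by positivity
  simp only [dyadicCube, Set.mem_ofPred_eq, Set.mem_pi, Set.mem_univ, true_imp_iff, Set.mem_Ico,
    Int.floor_eq_iff, le_div_iff₀ h2, div_lt_iff₀ h2]

theorem measurableSet_dyadicCube {m : ℕ} (d : ℤ × (Fin m → ℤ)) :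
    MeasurableSet (dyadicCube d) := by
  rw [dyadicCube_eq_pi]
  exact MeasurableSet.univ_pi fun i => measurableSet_Ico

theorem volume_dyadicCube {m : ℕ} (d : ℤ × (Fin m → ℤ)) :
    volume (dyadicCube d) = ENNReal.ofReal (2 ^ d.1) ^ m := by
  rw [dyadicCube_eq_pi, Real.volume_pi_Ico]
  have : ∀ i, ((d.2 i + 1) * (2 : ℝ) ^ d.1 - d.2 i * 2 ^ d.1) = 2 ^ d.1 := fun i => by ring
  simp [this]

theorem dyadicCube_subset_closedBall {m : ℕ} (d : ℤ × (Fin m → ℤ)) :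
    dyadicCube d ⊆ Metric.closedBall (dyadicCenter d) (2 ^ d.1 / 2) := by
  intro y hy
  rw [dyadicCube_eq_pi] at hy
  rw [mem_closedBall_iff_norm, pi_norm_le_iff_of_nonneg (by positivity)]
  intro i
  have := hy i trivial
  rw [Set.mem_Ico] at this
  rw [Pi.sub_apply, Real.norm_eq_abs, abs_le, dyadicCenter]
  constructor <;> nlinarith

theorem volume_closedBall_dyadicCenter {m : ℕ} (d : ℤ × (Fin m → ℤ)) {K : ℝ} (hK : 0 ≤ K) :
    volume (Metric.closedBall (dyadicCenter d) (K * (2 ^ d.1 / 2))) =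
      ENNReal.ofReal K ^ m * volume (dyadicCube d) := by
  rw [Real.volume_pi_closedBall _ (by positivity), volume_dyadicCube, ← mul_pow,
    ← ENNReal.ofReal_mul hK, ENNReal.ofReal_pow (by positivity)]
  simp only [Fintype.card_fin]
  congr 2
  ring

/-- The dyadic cube of generation `k` around a point. -/
noncomputable def dyadicIndex {m : ℕ} (k : ℤ) (y : Fin m → ℝ) : ℤ × (Fin m → ℤ) :=
  (k, fun i => ⌊y i / 2 ^ k⌋)

theorem mem_dyadicCube_dyadicIndex {m : ℕ} (k : ℤ) (y : Fin m → ℝ) :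
    y ∈ dyadicCube (dyadicIndex k y) := fun _ => rfl

theorem eq_dyadicIndex_of_mem {m : ℕ} {d : ℤ × (Fin m → ℤ)} {y : Fin m → ℝ}
    (h : y ∈ dyadicCube d) : d = dyadicIndex d.1 y :=
  Prod.ext rfl (funext fun i => (h i).symm)

/-- Passing to a coarser generation divides by a natural number, and the floor of such a quotient
depends only on the floor of the numerator. Hence dyadic cubes are nested. -/
theorem floor_div_two_zpow_eq {k k' : ℤ} (hk : k ≤ k') {a b : ℝ}
    (h : ⌊a / 2 ^ k⌋ = ⌊b / 2 ^ k⌋) : ⌊a / 2 ^ k'⌋ = ⌊b / 2 ^ k'⌋ := by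
  obtain ⟨e, rfl⟩ := Int.le.dest hk
  have : ∀ a : ℝ, a / 2 ^ (k + e : ℤ) = (a / 2 ^ k) / ((2 ^ e : ℕ) : ℝ) := fun a => by
    rw [zpow_add₀ (by norm_num)]
    push_cast
    rw [zpow_natCast, div_div]
  rw [this, this, Int.floor_div_natCast, Int.floor_div_natCast, h]

theorem dyadicCube_subset_of_mem {m : ℕ} {d d' : ℤ × (Fin m → ℤ)} (hd : d.1 ≤ d'.1)
    {y : Fin m → ℝ} (h : y ∈ dyadicCube d) (h' : y ∈ dyadicCube d') :
    dyadicCube d ⊆ dyadicCube d' := by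
  intro z hz i
  rw [← h' i]
  exact floor_div_two_zpow_eq hd ((hz i).trans (h i).symm)

theorem nonempty_dyadicCube {m : ℕ} (d : ℤ × (Fin m → ℤ)) : (dyadicCube d).Nonempty := by
  refine ⟨fun i => d.2 i * 2 ^ d.1, fun i => ?_⟩
  have h2 : (2 : ℝ) ^ d.1 ≠ 0 := by positivity
  simp [h2]

/-- Closed balls of the sup norm are cubes, so a dyadic cube agrees up to a null set with a ball
that contains `y`, not necessarily as its centre. The differentiation theorem for the Vitali family
allows such balls. -/
theorem ae_tendsto_dyadic_average {m : ℕ} {N : (Fin m → ℝ) → ℝ≥0∞} (hN : Measurable N)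
    (hint : ∫⁻ y, N y ≠ ∞) : ∀ᵐ y, ∀ b : ℝ≥0∞,
      (∀ k : ℤ, ∫⁻ z in dyadicCube (dyadicIndex k y), N z ≤
        b * volume (dyadicCube (dyadicIndex k y))) → N y ≤ b := by
  filter_upwards [(IsUnifLocDoublingMeasure.vitaliFamily
    (volume : Measure (Fin m → ℝ)) 1).ae_tendsto_lintegral_div' hN hint] with y hy b hb
  have hlim := hy.comp (IsUnifLocDoublingMeasure.tendsto_closedBall_filterAt (K := 1)
    (l := Filter.atTop) (x := y) volume
    (fun j : ℕ => dyadicCenter (dyadicIndex (-(j : ℤ)) y)) (fun j => 2 ^ (-(j : ℤ)) / 2) ?_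
    (Filter.Eventually.of_forall fun j => ?_))
  · refine le_of_tendsto hlim (Filter.Eventually.of_forall fun j => ?_)
    set d := dyadicIndex (-(j : ℤ)) y with hd
    have hv : volume (Metric.closedBall (dyadicCenter d) (2 ^ d.1 / 2)) =
        volume (dyadicCube d) := by
      have := volume_closedBall_dyadicCenter d zero_le_one
      simpa using this
    have hfin : volume (dyadicCube d) ≠ ∞ := by
      rw [volume_dyadicCube]; exact ENNReal.pow_ne_top ENNReal.ofReal_ne_top
    have hae : (dyadicCube d : Set (Fin m → ℝ)) =ᵐ[volume]
        Metric.closedBall (dyadicCenter d) (2 ^ d.1 / 2) :=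
      ae_eq_of_subset_of_measure_ge (dyadicCube_subset_closedBall d) hv.le
        (measurableSet_dyadicCube d).nullMeasurableSet (by rw [hv]; exact hfin)
    change (∫⁻ z in Metric.closedBall (dyadicCenter d) (2 ^ d.1 / 2), N z) /
      volume (Metric.closedBall (dyadicCenter d) (2 ^ d.1 / 2)) ≤ b
    rw [hv, ← setLIntegral_congr hae]
    exact ENNReal.div_le_of_le_mul (hb _)
  · refine tendsto_nhdsWithin_iff.2 ⟨?_, Filter.Eventually.of_forall fun j => ?_⟩
    · have := (tendsto_pow_atTop_nhds_zero_of_lt_one (r := (1 / 2 : ℝ)) (by norm_num)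
        (by norm_num)).div_const 2
      simpa using this
    · have : (0 : ℝ) < 2 ^ (-(j : ℤ)) / 2 := by positivity
      exact this
  · rw [one_mul]
    exact dyadicCube_subset_closedBall _ (mem_dyadicCube_dyadicIndex _ y)

/-- The maximal dyadic cubes on which the average of `N` exceeds `b`. -/
theorem exists_maximal_dyadicCubes {m : ℕ} (hm : 0 < m) {N : (Fin m → ℝ) → ℝ≥0∞}
    (hN : Measurable N) (hint : ∫⁻ y, N y ≠ ∞) {b : ℝ≥0∞} (hb0 : b ≠ 0) (hbt : b ≠ ∞) :
    ∃ S : Set (ℤ × (Fin m → ℤ)), S.PairwiseDisjoint dyadicCube ∧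
      (∀ d ∈ S, b * volume (dyadicCube d) ≤ ∫⁻ y in dyadicCube d, N y ∧
        ∫⁻ y in dyadicCube d, N y ≤ 2 ^ m * b * volume (dyadicCube d)) ∧
      ∀ᵐ y, y ∉ ⋃ d ∈ S, dyadicCube d → N y ≤ b := by
  set S : Set (ℤ × (Fin m → ℤ)) := {d | b * volume (dyadicCube d) < ∫⁻ y in dyadicCube d, N y ∧
    ∀ d' : ℤ × (Fin m → ℤ), d.1 < d'.1 → dyadicCube d ⊆ dyadicCube d' →
      ∫⁻ y in dyadicCube d', N y ≤ b * volume (dyadicCube d')} with hS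
  refine ⟨S, ?_, fun d hd => ⟨hd.1.le, ?_⟩, ?_⟩
  -- Two dyadic cubes that meet are nested, so a strictly larger one in `S` would contradict the
  -- maximality of the smaller.
  · have aux : ∀ d ∈ S, ∀ d' ∈ S, ∀ z ∈ dyadicCube d, z ∈ dyadicCube d' → ¬ d.1 < d'.1 := by
      intro d hd d' hd' z hz hz' hlt
      exact absurd (hd.2 d' hlt (dyadicCube_subset_of_mem hlt.le hz hz')) (not_le.2 hd'.1)
    intro d hd d' hd' hne
    refine Set.disjoint_left.2 fun z hz hz' => hne ?_
    have heq : d.1 = d'.1 := le_antisymm (not_lt.1 (aux d' hd' d hd z hz' hz))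
      (not_lt.1 (aux d hd d' hd' z hz hz'))
    rw [eq_dyadicIndex_of_mem hz, eq_dyadicIndex_of_mem hz', heq]
  · obtain ⟨y, hy⟩ := nonempty_dyadicCube d
    -- The dyadic parent is not among the cubes of large average, and its volume is `2 ^ m` times
    -- that of `d`.
    set d' := dyadicIndex (d.1 + 1) y with hd'
    have hsub : dyadicCube d ⊆ dyadicCube d' :=
      dyadicCube_subset_of_mem (by simp [hd', dyadicIndex]) hy (mem_dyadicCube_dyadicIndex _ y)
    calc ∫⁻ y in dyadicCube d, N y ≤ ∫⁻ y in dyadicCube d', N y := lintegral_mono_set hsub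
      _ ≤ b * volume (dyadicCube d') := hd.2 d' (by simp [hd', dyadicIndex]) hsub
      _ = 2 ^ m * b * volume (dyadicCube d) := by
        rw [volume_dyadicCube, volume_dyadicCube]
        have : (2 : ℝ) ^ d'.1 = 2 * 2 ^ d.1 := by
          simp only [hd', dyadicIndex]
          rw [zpow_add₀ (by norm_num), zpow_one, mul_comm]
        rw [this, ENNReal.ofReal_mul (by norm_num), mul_pow]
        simp
        ring
  · filter_upwards [ae_tendsto_dyadic_average hN hint] with y hy hyS
    refine hy b fun k => ?_
    by_contra hk
    rw [not_le] at hk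
    let P : ℤ → Prop := fun k => b * volume (dyadicCube (dyadicIndex k y)) <
      ∫⁻ z in dyadicCube (dyadicIndex k y), N z
    -- Since `m > 0`, the volumes grow without bound with the generation, while the integral over a
    -- cube never exceeds the finite total. Hence a cube of greatest generation exists.
    have hbdd : ∃ K : ℤ, ∀ k, P k → k ≤ K := by
      obtain ⟨K, hK⟩ := ENNReal.exists_nat_gt (ENNReal.div_ne_top hint hb0)
      refine ⟨K, fun k hPk => ?_⟩
      by_contra hlt
      rw [not_le] at hlt
      have h1 : (K : ℝ≥0∞) ≤ volume (dyadicCube (dyadicIndex k y)) := by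
        rw [volume_dyadicCube]
        have hk1 : (1 : ℝ) ≤ 2 ^ k := one_le_zpow₀ (by norm_num) (by omega)
        calc (K : ℝ≥0∞) = ENNReal.ofReal K := by simp
          _ ≤ ENNReal.ofReal (2 ^ k) := by
            refine ENNReal.ofReal_le_ofReal ?_
            calc (K : ℝ) ≤ 2 ^ K := by exact_mod_cast K.lt_two_pow_self.le
              _ = 2 ^ (K : ℤ) := by simp
              _ ≤ 2 ^ k := zpow_le_zpow_right₀ (by norm_num) hlt.le
          _ ≤ ENNReal.ofReal (2 ^ k) ^ m :=
            le_self_pow (by rw [← ENNReal.ofReal_one]; exact ENNReal.ofReal_le_ofReal hk1) hm.ne'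
      have h2 : ∫⁻ z, N z < b * volume (dyadicCube (dyadicIndex k y)) := by
        calc ∫⁻ z, N z < b * K := by
              rw [ENNReal.div_lt_iff (Or.inl hb0) (Or.inl hbt)] at hK
              rwa [mul_comm]
          _ ≤ _ := by gcongr
      exact absurd (h2.trans hPk) (not_lt.2 (setLIntegral_le_lintegral _ _))
    obtain ⟨k₀, hk₀, hmax⟩ := Int.exists_greatest_of_bdd hbdd ⟨k, hk⟩
    refine hyS (Set.mem_biUnion (x := dyadicIndex k₀ y) ⟨hk₀, fun d' hlt hsub => ?_⟩
      (mem_dyadicCube_dyadicIndex _ y))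
    have hyd' : y ∈ dyadicCube d' := hsub (mem_dyadicCube_dyadicIndex _ y)
    rw [eq_dyadicIndex_of_mem hyd']
    by_contra hcon
    exact absurd (hmax d'.1 (not_le.1 hcon)) (not_le.2 hlt)


/-! ### Bounded functions with bounded support -/

/-- Bounded measurable functions with bounded support. -/
def IsNice {X : Type*} [NormedAddCommGroup X] [MeasurableSpace X] (f : X → ℂ) : Prop :=
  Measurable f ∧ ∃ M R : ℝ, ∀ z, ‖f z‖ ≤ M ∧ (f z ≠ 0 → ‖z‖ ≤ R)

namespace IsNice

variable {X : Type*} [NormedAddCommGroup X] [MeasurableSpace X] {f g : X → ℂ}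

theorem memLp [ProperSpace X] [OpensMeasurableSpace X] {μ : Measure X}
    [IsFiniteMeasureOnCompacts μ] (hf : IsNice f) (p : ℝ≥0∞) : MemLp f p μ := by
  obtain ⟨hm, M, R, h⟩ := hf
  have e : f = (Metric.closedBall 0 R).indicator f := by
    ext z
    by_cases hz : f z = 0
    · simp [Set.indicator, hz]
    · rw [Set.indicator_of_mem]
      simpa using (h z).2 hz
  have : IsFiniteMeasure (μ.restrict (Metric.closedBall 0 R)) :=
    ⟨by rw [Measure.restrict_apply_univ]; exact (isCompact_closedBall _ _).measure_lt_top⟩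
  rw [e, memLp_indicator_iff_restrict Metric.isClosed_closedBall.measurableSet]
  exact MemLp.of_bound hm.aestronglyMeasurable M (Filter.Eventually.of_forall fun z => (h z).1)

theorem add (hf : IsNice f) (hg : IsNice g) : IsNice fun z => f z + g z := by
  obtain ⟨hm, M, R, h⟩ := hf
  obtain ⟨hm', M', R', h'⟩ := hg
  refine ⟨hm.add hm', M + M', max R R', fun z => ⟨(norm_add_le _ _).trans
    (add_le_add (h z).1 (h' z).1), fun hz => ?_⟩⟩
  by_cases hfz : f z = 0
  · exact ((h' z).2 (fun hgz => hz (by simp [hfz, hgz]))).trans (le_max_right _ _)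
  · exact ((h z).2 hfz).trans (le_max_left _ _)

theorem neg (hf : IsNice f) : IsNice fun z => -f z := by
  obtain ⟨hm, M, R, h⟩ := hf
  exact ⟨hm.neg, M, R, fun z => by simpa using h z⟩

theorem sub (hf : IsNice f) (hg : IsNice g) : IsNice fun z => f z - g z := by
  simpa only [sub_eq_add_neg] using hf.add hg.neg

theorem zero : IsNice fun _ : X => (0 : ℂ) :=
  ⟨measurable_const, 0, 0, fun z => by simp⟩

theorem finset_sum {ι : Type*} (s : Finset ι) {b : ι → X → ℂ} (hb : ∀ i, IsNice (b i)) :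
    IsNice fun z => ∑ i ∈ s, b i z := by
  classical
  induction s using Finset.induction_on with
  | empty => simpa using zero
  | insert a s ha ih =>
    simp_rw [Finset.sum_insert ha]
    exact (hb a).add ih

end IsNice

/-! ### An integrable majorant -/

/-- The function `ℓ ^ ε / (ℓ + ‖z‖) ^ (D + ε)` on a space of dimension `D`. -/
noncomputable def bracket {X : Type*} [NormedAddCommGroup X] [NormedSpace ℝ X] (ε ℓ : ℝ) (z : X) :
    ℝ≥0∞ :=
  ENNReal.ofReal (ℓ ^ ε * (ℓ + ‖z‖) ^ (-(Module.finrank ℝ X + ε)))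

theorem measurable_bracket {X : Type*} [NormedAddCommGroup X] [NormedSpace ℝ X]
    [MeasurableSpace X] [OpensMeasurableSpace X] (ε ℓ : ℝ) :
    Measurable (bracket ε ℓ : X → ℝ≥0∞) := by
  unfold bracket
  fun_prop

/-- The substitution `z = ℓ • w` reduces the integral to `ℓ = 1`, so the estimates of the bad parts
have one constant for cubes of all sizes. -/
theorem lintegral_bracket {X : Type*} [NormedAddCommGroup X] [NormedSpace ℝ X]
    [FiniteDimensional ℝ X] [MeasurableSpace X] [BorelSpace X] (μ : Measure X)
    [μ.IsAddHaarMeasure] {ε ℓ : ℝ} (hℓ : 0 < ℓ) :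
    ∫⁻ z, bracket ε ℓ z ∂μ =
      ∫⁻ z : X, ENNReal.ofReal ((1 + ‖z‖) ^ (-(Module.finrank ℝ X + ε))) ∂μ := by
  set D := Module.finrank ℝ X with hD
  have h1 : ∀ w : X, ENNReal.ofReal (ℓ ^ D) * bracket ε ℓ (ℓ • w) =
      ENNReal.ofReal ((1 + ‖w‖) ^ (-(D + ε))) := by
    intro w
    rw [bracket, ← ENNReal.ofReal_mul (by positivity), norm_smul, Real.norm_of_nonneg hℓ.le]
    congr 1
    have : ℓ + ℓ * ‖w‖ = ℓ * (1 + ‖w‖) := by ring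
    rw [this, Real.mul_rpow hℓ.le (by positivity), ← Real.rpow_natCast, ← mul_assoc, ← mul_assoc,
      ← Real.rpow_add hℓ, ← Real.rpow_add hℓ]
    simp [hD]
  have h2 : ∫⁻ w, bracket ε ℓ (ℓ • w) ∂μ = ENNReal.ofReal (ℓ ^ D)⁻¹ * ∫⁻ z, bracket ε ℓ z ∂μ := by
    rw [← lintegral_map (measurable_bracket ε ℓ) (measurable_const_smul ℓ),
      Measure.map_addHaar_smul μ hℓ.ne', lintegral_smul_measure, smul_eq_mul,
      abs_of_pos (by positivity)]
  simp_rw [← h1]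
  rw [lintegral_const_mul' _ _ ENNReal.ofReal_ne_top, h2, ← mul_assoc,
    ← ENNReal.ofReal_mul (by positivity), mul_inv_cancel₀ (by positivity), ENNReal.ofReal_one,
    one_mul]

/-- The integral of `bracket`, which does not depend on the scale. -/
theorem exists_lintegral_bracket_le {X : Type*} [NormedAddCommGroup X] [NormedSpace ℝ X]
    [FiniteDimensional ℝ X] [MeasurableSpace X] [BorelSpace X] (μ : Measure X)
    [μ.IsAddHaarMeasure] {ε : ℝ} (hε : 0 < ε) :
    ∃ I : ℝ≥0, ∀ ℓ : ℝ, 0 < ℓ → ∫⁻ z, bracket ε ℓ z ∂μ ≤ I := by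
  have hfin : ∫⁻ z : X, ENNReal.ofReal ((1 + ‖z‖) ^ (-(Module.finrank ℝ X + ε))) ∂μ < ∞ :=
    finite_integral_one_add_norm (by linarith)
  refine ⟨(∫⁻ z : X, ENNReal.ofReal ((1 + ‖z‖) ^ (-(Module.finrank ℝ X + ε))) ∂μ).toNNReal,
    fun ℓ hℓ => ?_⟩
  rw [lintegral_bracket μ hℓ, ENNReal.coe_toNNReal hfin.ne]

/-! ### Slice norms -/

/-- Translation invariance in each variable is what makes Minkowski's inequality usable for
convolutions in the first group of variables. -/
theorem iteratedNorm_sub_right {n : ℕ} (q : Fin n → ℝ) (F : (Fin n → ℝ) → ℝ≥0∞) (a : Fin n → ℝ) :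
    iteratedNorm n q (fun x => F (x - a)) = iteratedNorm n q F := by
  induction n with
  | zero => exact congrArg F (Subsingleton.elim _ _)
  | succ n ih =>
    refine Eq.trans ?_ (ih (fun i => q i.succ)
      (fun y => (∫⁻ t : ℝ, F (Fin.cons t y) ^ q 0) ^ (1 / q 0)) (Fin.tail a))
    change iteratedNorm n _ _ = _
    congr 1
    ext y
    congr 1
    refine (lintegral_congr fun t => ?_).trans (lintegral_sub_right_eq_self
      (fun t => F (Fin.cons t (y - Fin.tail a)) ^ q 0) (a 0))
    have : (Fin.cons t y - a : Fin (n + 1) → ℝ) = Fin.cons (t - a 0) (y - Fin.tail a) := by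
      funext i
      refine Fin.cases ?_ (fun i => ?_) i <;> simp [Fin.tail]
    exact congrArg (fun v => F v ^ q 0) this

section slice

variable {j m : ℕ}

theorem ae_ae_snd {P : (Fin j → ℝ) × (Fin m → ℝ) → Prop} (h : ∀ᵐ z, P z) :
    ∀ᵐ y : Fin m → ℝ, ∀ᵐ x : Fin j → ℝ, P (x, y) :=
  Measure.ae_ae_of_ae_prod ((Measure.measurePreserving_swap (μ := (volume : Measure (Fin m → ℝ)))
    (ν := (volume : Measure (Fin j → ℝ)))).quasiMeasurePreserving.ae h)

/-- The iterated norm in the first group of variables. -/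
noncomputable def sliceNorm (q : Fin j → ℝ) (f : (Fin j → ℝ) × (Fin m → ℝ) → ℂ)
    (y : Fin m → ℝ) : ℝ≥0∞ :=
  iteratedNorm j q fun x => ‖f (x, y)‖ₑ

theorem measurable_sliceNorm (q : Fin j → ℝ) {f : (Fin j → ℝ) × (Fin m → ℝ) → ℂ}
    (hf : Measurable f) : Measurable (sliceNorm q f) :=
  measurable_iteratedNorm q (F := fun y x => ‖f (x, y)‖ₑ)
    (hf.enorm.comp measurable_swap)

theorem IsNice.exists_sliceNorm_le {q : Fin j → ℝ} (hq : ∀ i, 0 < q i)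
    {f : (Fin j → ℝ) × (Fin m → ℝ) → ℂ} (hf : IsNice f) :
    ∃ (B : ℝ≥0) (R : ℝ), ∀ y, sliceNorm q f y ≤ B ∧ (sliceNorm q f y ≠ 0 → ‖y‖ ≤ R) := by
  obtain ⟨hm, M, R, h⟩ := hf
  set R' : ℝ := max R 1 with hR'
  have hR0 : 0 < R' := lt_of_lt_of_le one_pos (le_max_right _ _)
  set b : ℝ≥0∞ := ENNReal.ofReal M * ENNReal.ofReal (2 * R') ^ (∑ i, 1 / q i) with hb
  have hbt : b ≠ ∞ := ENNReal.mul_ne_top ENNReal.ofReal_ne_top (ENNReal.rpow_ne_top_of_nonneg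
    (Finset.sum_nonneg fun i _ => by have := hq i; positivity) ENNReal.ofReal_ne_top)
  refine ⟨b.toNNReal, R, fun y => ⟨?_, fun hy => ?_⟩⟩
  · rw [ENNReal.coe_toNNReal hbt]
    have hms : MeasurableSet {x : Fin j → ℝ | ∀ i, |x i - (0 : Fin j → ℝ) i| ≤ R'} := by
      rw [Set.ofPred_forall]
      refine MeasurableSet.iInter fun i => measurableSet_le ?_ measurable_const
      exact ((measurable_pi_apply i).sub_const _).abs
    calc sliceNorm q f y ≤ iteratedNorm j q (fun x => ENNReal.ofReal M *
          ({x : Fin j → ℝ | ∀ i, |x i - (0 : Fin j → ℝ) i| ≤ R'}.indicator fun _ => 1) x) := by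
          refine iteratedNorm_mono (fun i => (hq i).le) fun x => ?_
          by_cases hx : f (x, y) = 0
          · simp [hx]
          · rw [Set.indicator_of_mem, mul_one]
            · rw [← ofReal_norm]
              exact ENNReal.ofReal_le_ofReal (h _).1
            · intro i
              have h1 := (h (x, y)).2 hx
              have h2 : ‖x i‖ ≤ ‖x‖ := norm_le_pi_norm x i
              have h3 : ‖x‖ ≤ ‖(x, y)‖ := by rw [Prod.norm_def]; exact le_max_left _ _
              simp only [Pi.zero_apply, sub_zero]
              rw [← Real.norm_eq_abs]
              exact (h2.trans h3).trans (h1.trans (le_max_left _ _))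
      _ = ENNReal.ofReal M * _ := iteratedNorm_const_mul hq (measurable_const.indicator hms) _
      _ ≤ b := by
          rw [hb]
          gcongr
          exact iteratedNorm_cube_le hq hR0
  · by_contra hlt
    apply hy
    have : ∀ x, f (x, y) = 0 := fun x => by
      by_contra hx
      have h1 := (h (x, y)).2 hx
      have h3 : ‖y‖ ≤ ‖(x, y)‖ := by rw [Prod.norm_def]; exact le_max_right _ _
      exact hlt (h3.trans h1)
    simp [sliceNorm, this, iteratedNorm_zero hq]

theorem IsNice.lintegral_sliceNorm_rpow_ne_top {q : Fin j → ℝ} (hq : ∀ i, 0 < q i)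
    {f : (Fin j → ℝ) × (Fin m → ℝ) → ℂ} (hf : IsNice f) {e : ℝ} (he : 0 < e) :
    ∫⁻ y, sliceNorm q f y ^ e ≠ ∞ := by
  obtain ⟨B, R, h⟩ := hf.exists_sliceNorm_le hq
  refine ne_of_lt (lt_of_le_of_lt (b := ∫⁻ y, (Metric.closedBall (0 : Fin m → ℝ) R).indicator
    (fun _ => (B : ℝ≥0∞) ^ e) y) (lintegral_mono fun y => ?_) ?_)
  · by_cases hy : sliceNorm q f y = 0
    · simp [hy, he]
    · rw [Set.indicator_of_mem (by simpa using (h y).2 hy)]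
      exact ENNReal.rpow_le_rpow (h y).1 he.le
  · rw [lintegral_indicator Metric.isClosed_closedBall.measurableSet, setLIntegral_const]
    exact ENNReal.mul_lt_top (ENNReal.rpow_lt_top_of_nonneg he.le (by simp))
      (isCompact_closedBall _ _).measure_lt_top

theorem IsNice.lintegral_sliceNorm_ne_top {q : Fin j → ℝ} (hq : ∀ i, 0 < q i)
    {f : (Fin j → ℝ) × (Fin m → ℝ) → ℂ} (hf : IsNice f) :
    ∫⁻ y, sliceNorm q f y ≠ ∞ := by
  simpa using hf.lintegral_sliceNorm_rpow_ne_top hq one_pos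

/-- Minkowski's inequality for a convolution in the first variable. -/
theorem sliceNorm_le_of_convolution_bound {q : Fin j → ℝ} (hq : ∀ i, 1 ≤ q i)
    {u b : (Fin j → ℝ) × (Fin m → ℝ) → ℂ} (hb : Measurable b)
    {h : (Fin j → ℝ) × (Fin m → ℝ) → ℝ≥0∞} (hh : Measurable h) (C : ℝ≥0∞) {c y : Fin m → ℝ}
    (hu : ∀ᵐ x, ‖u (x, y)‖ₑ ≤ C * ∫⁻ w, h ((x, y) - (w.1, c)) * ‖b w‖ₑ) :
    sliceNorm q u y ≤ C * ((∫⁻ x, h (x, y - c)) * ∫⁻ y', sliceNorm q b y') := by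
  have hq0 : ∀ i, 0 < q i := fun i => zero_lt_one.trans_le (hq i)
  -- The reflection `x' ↦ x - x'` moves the dependence on `x` from `h` to `b`. The integrand then
  -- contains only translates of slices of `b`, whose norms do not depend on the translation.
  have hconv : ∀ x, ∫⁻ w : (Fin j → ℝ) × (Fin m → ℝ), h ((x, y) - (w.1, c)) * ‖b w‖ₑ =
      ∫⁻ w : (Fin j → ℝ) × (Fin m → ℝ), h (w.1, y - c) * ‖b (x - w.1, w.2)‖ₑ := by
    intro x
    have m1 : Measurable fun w : (Fin j → ℝ) × (Fin m → ℝ) => h ((x, y) - (w.1, c)) * ‖b w‖ₑ :=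
      (hh.comp (measurable_const.sub (measurable_fst.prodMk measurable_const))).mul hb.enorm
    have m2 : Measurable fun w : (Fin j → ℝ) × (Fin m → ℝ) =>
        h (w.1, y - c) * ‖b (x - w.1, w.2)‖ₑ :=
      (hh.comp (measurable_fst.prodMk measurable_const)).mul
        (hb.comp ((measurable_const.sub measurable_fst).prodMk measurable_snd)).enorm
    rw [Measure.volume_eq_prod, lintegral_prod_symm _ m1.aemeasurable,
      lintegral_prod_symm _ m2.aemeasurable]
    refine lintegral_congr fun y' => ?_
    rw [← lintegral_sub_left_eq_self _ x]
    refine lintegral_congr fun x' => ?_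
    simp
  have m3 : Measurable (Function.uncurry fun (w : (Fin j → ℝ) × (Fin m → ℝ)) (x : Fin j → ℝ) =>
      h (w.1, y - c) * ‖b (x - w.1, w.2)‖ₑ) := by
    refine Measurable.mul (hh.comp ((measurable_fst.comp measurable_fst).prodMk measurable_const))
      (hb.comp ((measurable_snd.sub (measurable_fst.comp measurable_fst)).prodMk
        (measurable_snd.comp measurable_fst))).enorm
  have m4 : ∀ w : (Fin j → ℝ) × (Fin m → ℝ), Measurable fun x => ‖b (x - w.1, w.2)‖ₑ := fun w =>
    (hb.comp ((measurable_id.sub_const _).prodMk measurable_const)).enorm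
  calc sliceNorm q u y
      ≤ iteratedNorm j q (fun x => C * ∫⁻ w : (Fin j → ℝ) × (Fin m → ℝ),
          h (w.1, y - c) * ‖b (x - w.1, w.2)‖ₑ) := by
        refine iteratedNorm_mono_ae (fun i => (hq0 i).le) ?_
        filter_upwards [hu] with x hx
        rw [← hconv]; exact hx
    _ = C * iteratedNorm j q (fun x => ∫⁻ w : (Fin j → ℝ) × (Fin m → ℝ),
          h (w.1, y - c) * ‖b (x - w.1, w.2)‖ₑ) :=
        iteratedNorm_const_mul hq0 (m3.lintegral_prod_left') _
    _ ≤ C * ∫⁻ w : (Fin j → ℝ) × (Fin m → ℝ),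
          iteratedNorm j q (fun x => h (w.1, y - c) * ‖b (x - w.1, w.2)‖ₑ) := by
        gcongr
        exact iteratedNorm_lintegral_le hq m3
    _ = C * ∫⁻ w : (Fin j → ℝ) × (Fin m → ℝ), h (w.1, y - c) * sliceNorm q b w.2 := by
        congr 1
        refine lintegral_congr fun w => ?_
        rw [iteratedNorm_const_mul hq0 (m4 w),
          iteratedNorm_sub_right q (fun x => ‖b (x, w.2)‖ₑ) w.1]
        rfl
    _ = _ := by
        congr 1
        have mh : Measurable fun x => h (x, y - c) :=
          hh.comp (measurable_id.prodMk measurable_const)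
        have := lintegral_prod_mul (μ := (volume : Measure (Fin j → ℝ)))
          (ν := (volume : Measure (Fin m → ℝ))) mh.aemeasurable
          (measurable_sliceNorm q hb).aemeasurable
        rw [Measure.volume_eq_prod, ← this]

end slice


section CalderonZygmund

variable {j m : ℕ}

/-! ### The bad part of a function on a cube -/

/-- The mean of a function over `Q` in the second variable. -/
noncomputable def sliceMean (f : (Fin j → ℝ) × (Fin m → ℝ) → ℂ) (Q : Set (Fin m → ℝ))
    (x : Fin j → ℝ) : ℂ :=
  (volume Q).toReal⁻¹ • ∫ y in Q, f (x, y)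

/-- The function on `Q` with its mean over `Q` subtracted. -/
noncomputable def badPart (f : (Fin j → ℝ) × (Fin m → ℝ) → ℂ) (Q : Set (Fin m → ℝ)) :
    (Fin j → ℝ) × (Fin m → ℝ) → ℂ :=
  (Prod.snd ⁻¹' Q).indicator fun z => f z - sliceMean f Q z.1

variable {f : (Fin j → ℝ) × (Fin m → ℝ) → ℂ} {Q : Set (Fin m → ℝ)}

theorem measurable_sliceMean (hf : Measurable f) : Measurable (sliceMean f Q) := by
  have : StronglyMeasurable fun x => ∫ y in Q, f (x, y) :=
    hf.stronglyMeasurable.integral_prod_right' (ν := volume.restrict Q)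
  exact this.measurable.const_smul ((volume Q).toReal⁻¹ : ℝ)

theorem IsNice.integrable_slice (hf : IsNice f) (x : Fin j → ℝ) :
    Integrable fun y => f (x, y) := by
  obtain ⟨hm, M, R, h⟩ := hf
  have : IsNice fun y => f (x, y) := ⟨hm.comp measurable_prodMk_left, M, R, fun y =>
    ⟨(h _).1, fun hy => le_trans (by rw [Prod.norm_def]; exact le_max_right _ _) ((h _).2 hy)⟩⟩
  exact memLp_one_iff_integrable.1 (this.memLp 1)

theorem enorm_sliceMean_le (x : Fin j → ℝ) :
    ‖sliceMean f Q x‖ₑ ≤ (volume Q)⁻¹ * ∫⁻ y in Q, ‖f (x, y)‖ₑ := by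
  rw [sliceMean, enorm_smul]
  gcongr
  · rw [← ENNReal.toReal_inv, Real.enorm_eq_ofReal ENNReal.toReal_nonneg]
    exact ENNReal.ofReal_toReal_le
  · exact enorm_integral_le_lintegral_enorm _

theorem norm_sliceMean_le {M : ℝ} (hQ0 : volume Q ≠ 0) (hQt : volume Q ≠ ∞)
    (hM : ∀ z, ‖f z‖ ≤ M) (x : Fin j → ℝ) : ‖sliceMean f Q x‖ ≤ M := by
  have h1 : ‖∫ y in Q, f (x, y)‖ ≤ M * (volume Q).toReal :=
    norm_setIntegral_le_of_norm_le_const hQt.lt_top fun y _ => hM _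
  have h2 : 0 < (volume Q).toReal := ENNReal.toReal_pos hQ0 hQt
  rw [sliceMean, norm_smul, norm_inv, Real.norm_of_nonneg h2.le, inv_mul_le_iff₀ h2, mul_comm]
  exact h1

theorem isNice_badPart (hf : IsNice f) (hQm : MeasurableSet Q) (hQ0 : volume Q ≠ 0)
    {c : Fin m → ℝ} {ℓ : ℝ} (hQ : Q ⊆ Metric.closedBall c ℓ) : IsNice (badPart f Q) := by
  obtain ⟨hm, M, R, h⟩ := hf
  have hQt : volume Q ≠ ∞ :=
    ((measure_mono hQ).trans_lt (isCompact_closedBall _ _).measure_lt_top).ne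
  refine ⟨(hm.sub ((measurable_sliceMean hm).comp measurable_fst)).indicator
    (measurable_snd hQm), M + M, max R (‖c‖ + ℓ), fun z => ⟨?_, fun hz => ?_⟩⟩
  · refine (norm_indicator_le_norm_self _ _).trans ((norm_sub_le _ _).trans ?_)
    exact add_le_add (h z).1 (norm_sliceMean_le hQ0 hQt (fun z => (h z).1) _)
  · have hzQ : z.2 ∈ Q := by
      by_contra hcon
      exact hz (Set.indicator_of_notMem (by exact hcon) _)
    rw [Prod.norm_def]
    refine max_le (le_max_of_le_left ?_) (le_max_of_le_right ?_)
    -- For a first coordinate outside the ball the whole slice of `f` vanishes, and so does its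
    -- mean.
    · by_contra hlt
      have h0 : ∀ y, f (z.1, y) = 0 := fun y => by
        by_contra hy
        exact hlt (le_trans (by rw [Prod.norm_def]; exact le_max_left _ _) ((h _).2 hy))
      apply hz
      rw [badPart, Set.indicator_of_mem (by exact hzQ), show z = (z.1, z.2) from rfl]
      simp [sliceMean, h0]
    · have := hQ hzQ
      rw [mem_closedBall_iff_norm] at this
      calc ‖z.2‖ = ‖c + (z.2 - c)‖ := by simp
        _ ≤ _ := (norm_add_le _ _).trans (by linarith)

theorem integral_badPart (hf : IsNice f) (hQm : MeasurableSet Q) (hQ0 : volume Q ≠ 0)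
    (hQt : volume Q ≠ ∞) (x : Fin j → ℝ) : ∫ y, badPart f Q (x, y) = 0 := by
  have e : (fun y => badPart f Q (x, y)) = Q.indicator fun y => f (x, y) - sliceMean f Q x := by
    ext y
    rfl
  rw [e, integral_indicator hQm, integral_sub (hf.integrable_slice x).integrableOn
    (integrableOn_const hQt), setIntegral_const, sliceMean, Measure.real, smul_smul,
    mul_inv_cancel₀ (ENNReal.toReal_pos hQ0 hQt).ne', one_smul, sub_self]

variable {q : Fin j → ℝ}

theorem iteratedNorm_sliceMean_le (hq : ∀ i, 1 ≤ q i) (hf : IsNice f) :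
    iteratedNorm j q (fun x => ‖sliceMean f Q x‖ₑ) ≤
      (volume Q)⁻¹ * ∫⁻ y in Q, sliceNorm q f y := by
  have hm : Measurable (Function.uncurry fun (y : Fin m → ℝ) (x : Fin j → ℝ) => ‖f (x, y)‖ₑ) :=
    hf.1.enorm.comp measurable_swap
  calc iteratedNorm j q (fun x => ‖sliceMean f Q x‖ₑ)
      ≤ iteratedNorm j q (fun x => (volume Q)⁻¹ * ∫⁻ y in Q, ‖f (x, y)‖ₑ) :=
        iteratedNorm_mono (fun i => zero_le_one.trans (hq i)) fun x => enorm_sliceMean_le x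
    _ = (volume Q)⁻¹ * iteratedNorm j q (fun x => ∫⁻ y in Q, ‖f (x, y)‖ₑ) :=
        iteratedNorm_const_mul (fun i => zero_lt_one.trans_le (hq i)) hm.lintegral_prod_left' _
    _ ≤ _ := by
        gcongr
        exact iteratedNorm_lintegral_le hq hm

/-- The function and its mean contribute the same amount, since by Minkowski the norm of the mean is
at most the mean of the slice norms. -/
theorem lintegral_sliceNorm_badPart_le (hq : ∀ i, 1 ≤ q i) (hf : IsNice f)
    (hQm : MeasurableSet Q) (hQ0 : volume Q ≠ 0) (hQt : volume Q ≠ ∞) :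
    ∫⁻ y, sliceNorm q (badPart f Q) y ≤ 2 * ∫⁻ y in Q, sliceNorm q f y := by
  have hq0 : ∀ i, 0 < q i := fun i => zero_lt_one.trans_le (hq i)
  have hpt : ∀ y, sliceNorm q (badPart f Q) y ≤ Q.indicator (fun y => sliceNorm q f y +
      (volume Q)⁻¹ * ∫⁻ y in Q, sliceNorm q f y) y := by
    intro y
    by_cases hy : y ∈ Q
    · rw [Set.indicator_of_mem hy]
      refine le_trans ?_ (add_le_add_right (iteratedNorm_sliceMean_le hq hf) _)
      refine le_trans ?_ (iteratedNorm_add_le hq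
        (hf.1.comp measurable_prodMk_right).enorm (measurable_sliceMean hf.1).enorm)
      refine iteratedNorm_mono (fun i => (hq0 i).le) fun x => ?_
      rw [badPart, Set.indicator_of_mem (by exact hy)]
      exact enorm_sub_le
    · rw [Set.indicator_of_notMem hy]
      have : ∀ x, badPart f Q (x, y) = 0 := fun x => Set.indicator_of_notMem (by exact hy) _
      simp [sliceNorm, this, iteratedNorm_zero hq0]
  calc ∫⁻ y, sliceNorm q (badPart f Q) y ≤ _ := lintegral_mono hpt
    _ = ∫⁻ y in Q, sliceNorm q f y + (volume Q)⁻¹ * ∫⁻ y in Q, sliceNorm q f y := by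
        rw [lintegral_indicator hQm]
    _ = 2 * ∫⁻ y in Q, sliceNorm q f y := by
        rw [lintegral_add_left (measurable_sliceNorm q hf.1), setLIntegral_const, mul_comm _⁻¹,
          mul_assoc, ENNReal.inv_mul_cancel hQ0 hQt, mul_one, two_mul]

/-! ### Operators with a cancellation estimate -/

/-- The estimate for `T b` away from the support of a function `b` with mean zero in the second
variable. -/
def HasCancellation (T : Lp ℂ 2 (volume : Measure ((Fin j → ℝ) × (Fin m → ℝ))) →L[ℂ]
    Lp ℂ 2 (volume : Measure ((Fin j → ℝ) × (Fin m → ℝ)))) (ε : ℝ) (K C : ℝ≥0) : Prop :=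
  ∀ (b : (Fin j → ℝ) × (Fin m → ℝ) → ℂ) (hb : IsNice b) (c : Fin m → ℝ) (ℓ : ℝ), 0 < ℓ →
    (∀ z, b z ≠ 0 → ‖z.2 - c‖ ≤ ℓ) → (∀ x, ∫ y, b (x, y) = 0) →
    ∀ᵐ z, K * ℓ < ‖z.2 - c‖ →
      ‖T ((hb.memLp 2).toLp b) z‖ₑ ≤ C * ∫⁻ w, bracket ε ℓ (z - (w.1, c)) * ‖b w‖ₑ

/-- The value of an operator on `L²` at a nice function, as a function. -/
noncomputable def applyNice {X : Type*} [NormedAddCommGroup X] [ProperSpace X] [MeasureSpace X]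
    [OpensMeasurableSpace X] [IsFiniteMeasureOnCompacts (volume : Measure X)]
    (T : Lp ℂ 2 (volume : Measure X) →L[ℂ] Lp ℂ 2 (volume : Measure X)) {f : X → ℂ}
    (hf : IsNice f) : X → ℂ :=
  T ((hf.memLp 2).toLp f)

theorem measurable_applyNice {X : Type*} [NormedAddCommGroup X] [ProperSpace X] [MeasureSpace X]
    [OpensMeasurableSpace X] [IsFiniteMeasureOnCompacts (volume : Measure X)]
    (T : Lp ℂ 2 (volume : Measure X) →L[ℂ] Lp ℂ 2 (volume : Measure X)) {f : X → ℂ}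
    (hf : IsNice f) : Measurable (applyNice T hf) :=
  (Lp.stronglyMeasurable _).measurable

theorem applyNice_add {X : Type*} [NormedAddCommGroup X] [ProperSpace X] [MeasureSpace X]
    [OpensMeasurableSpace X] [IsFiniteMeasureOnCompacts (volume : Measure X)]
    (T : Lp ℂ 2 (volume : Measure X) →L[ℂ] Lp ℂ 2 (volume : Measure X)) {f g : X → ℂ}
    (hf : IsNice f) (hg : IsNice g) :
    applyNice T (hf.add hg) =ᵐ[volume] fun z => applyNice T hf z + applyNice T hg z := by
  have e : (((hf.add hg).memLp 2).toLp _ : Lp ℂ 2 (volume : Measure X)) =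
      (hf.memLp 2).toLp f + (hg.memLp 2).toLp g := (MemLp.toLp_add (hf.memLp 2) (hg.memLp 2)).symm
  rw [applyNice, e, map_add]
  exact Lp.coeFn_add _ _

theorem applyNice_congr {X : Type*} [NormedAddCommGroup X] [ProperSpace X] [MeasureSpace X]
    [OpensMeasurableSpace X] [IsFiniteMeasureOnCompacts (volume : Measure X)]
    (T : Lp ℂ 2 (volume : Measure X) →L[ℂ] Lp ℂ 2 (volume : Measure X)) {f g : X → ℂ}
    (hf : IsNice f) (hg : IsNice g) (h : f =ᵐ[volume] g) :
    applyNice T hf = applyNice T hg := by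
  rw [applyNice, applyNice, MemLp.toLp_congr (hf.memLp 2) (hg.memLp 2) h]

theorem enorm_applyNice_sum_le {X : Type*} [NormedAddCommGroup X] [ProperSpace X] [MeasureSpace X]
    [OpensMeasurableSpace X] [IsFiniteMeasureOnCompacts (volume : Measure X)]
    (T : Lp ℂ 2 (volume : Measure X) →L[ℂ] Lp ℂ 2 (volume : Measure X)) {ι : Type*}
    (s : Finset ι) {b : ι → X → ℂ} (hb : ∀ i, IsNice (b i)) :
    ∀ᵐ z, ‖applyNice T (IsNice.finset_sum s hb) z‖ₑ ≤ ∑ i ∈ s, ‖applyNice T (hb i) z‖ₑ := by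
  classical
  induction s using Finset.induction_on with
  | empty =>
    have e : (((IsNice.finset_sum ∅ hb).memLp 2).toLp _ : Lp ℂ 2 (volume : Measure X)) = 0 := by
      refine (Lp.eq_zero_iff_ae_eq_zero).2 ?_
      filter_upwards [((IsNice.finset_sum ∅ hb).memLp 2).coeFn_toLp (μ := volume)] with z hz
      exact hz.trans Finset.sum_empty
    filter_upwards [Lp.coeFn_zero ℂ 2 (volume : Measure X)] with z hz
    rw [applyNice, e, map_zero, hz]
    simp
  | insert a s ha ih =>
    filter_upwards [ih, applyNice_add T (hb a) (IsNice.finset_sum s hb)] with z h1 h2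
    rw [applyNice_congr T (IsNice.finset_sum (insert a s) hb) ((hb a).add (IsNice.finset_sum s hb))
      (Filter.Eventually.of_forall fun z => Finset.sum_insert ha), h2, Finset.sum_insert ha]
    exact (enorm_add_le _ _).trans (by gcongr)

/-- The distributional estimate of Benedek, Calderón and Panzone. -/
theorem distribution_sliceNorm_le (hm : 0 < m) (hq : ∀ i, 1 ≤ q i)
    {T : Lp ℂ 2 (volume : Measure ((Fin j → ℝ) × (Fin m → ℝ))) →L[ℂ]
      Lp ℂ 2 (volume : Measure ((Fin j → ℝ) × (Fin m → ℝ)))} {ε : ℝ} {K C I : ℝ≥0}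
    (hT : HasCancellation T ε K C)
    (hI : ∀ ℓ : ℝ, 0 < ℓ → ∫⁻ z : (Fin j → ℝ) × (Fin m → ℝ), bracket ε ℓ z ≤ I) {r : ℝ}
    (hr : 0 < r) {D : ℝ≥0} (hD : ∀ (g : (Fin j → ℝ) × (Fin m → ℝ) → ℂ) (hg : IsNice g),
      ∫⁻ y, sliceNorm q (applyNice T hg) y ^ r ≤ D * ∫⁻ y, sliceNorm q g y ^ r)
    (hf : IsNice f) {t : ℝ} (ht : 0 < t) :
    volume {y | 2 * ENNReal.ofReal t < sliceNorm q (applyNice T hf) y} ≤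
      (D + 2 * (D * (2 ^ m) ^ r + K ^ m + C * I * 2 * 2 ^ m)) *
      (ENNReal.ofReal (t ^ (-r)) *
        (∫⁻ y, if sliceNorm q f y ≤ ENNReal.ofReal t then sliceNorm q f y ^ r else 0) +
      ENNReal.ofReal (t ^ (-1 : ℝ)) *
        ∫⁻ y, if ENNReal.ofReal t < 2 * sliceNorm q f y then sliceNorm q f y else 0) := by
  classical
  have hq0 : ∀ i, 0 < q i := fun i => zero_lt_one.trans_le (hq i)
  -- The cubes are chosen from the averages of the slice norm, a scalar function of `y`; `f` itself
  -- is decomposed as a function of `y` with values in the mixed Lebesgue space in `x`.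
  set N := sliceNorm q f with hN
  have hNm : Measurable N := measurable_sliceNorm q hf.1
  rw [← ENNReal.ofReal_rpow_of_pos ht, ← ENNReal.ofReal_rpow_of_pos ht]
  set τ := ENNReal.ofReal t with hτ
  have hτ0 : τ ≠ 0 := by simpa [hτ] using ht
  have hτt : τ ≠ ∞ := ENNReal.ofReal_ne_top
  set J := ∫⁻ y, (if N y ≤ τ then N y ^ r else 0) with hJ
  set W := ∫⁻ y, (if τ < 2 * N y then N y else 0) with hW
  obtain ⟨S, hdisj, havg, hout⟩ := exists_maximal_dyadicCubes hm hNm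
    (hf.lintegral_sliceNorm_ne_top hq0) hτ0 hτt
  let Q : S → Set (Fin m → ℝ) := fun d => dyadicCube d.1
  have hQm : ∀ i, MeasurableSet (Q i) := fun i => measurableSet_dyadicCube _
  have hQ0 : ∀ i, volume (Q i) ≠ 0 := fun i => by
    simp only [Q, volume_dyadicCube]
    exact pow_ne_zero _ (by simp only [ne_eq, ENNReal.ofReal_eq_zero, not_le]; positivity)
  have hQt : ∀ i, volume (Q i) ≠ ∞ := fun i => by
    simp only [Q, volume_dyadicCube]
    exact ENNReal.pow_ne_top ENNReal.ofReal_ne_top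
  have hQdisj : Pairwise fun i i' => Disjoint (Q i) (Q i') := fun i i' hne =>
    hdisj i.2 i'.2 (fun h => hne (Subtype.ext h))
  let ball : S → Set (Fin m → ℝ) := fun i =>
    Metric.closedBall (dyadicCenter i.1) (K * (2 ^ i.1.1 / 2))
  have hball : ∀ i, volume (ball i) = K ^ m * volume (Q i) := fun i => by
    have := volume_closedBall_dyadicCenter i.1 K.2
    rw [NNReal.val_eq_coe, ENNReal.ofReal_coe_nnreal] at this
    exact this
  -- the total volume of the cubes
  set V := ∑' i, volume (Q i) with hV
  have hVW : V ≤ 2 * (τ ^ (-1 : ℝ) * W) := by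
    have hwm : Measurable fun y => if τ < 2 * N y then N y else 0 :=
      Measurable.ite (measurableSet_lt measurable_const (hNm.const_mul 2)) hNm measurable_const
    have h1 : ∀ i, volume (Q i) ≤ 2 * (τ ^ (-1 : ℝ) *
        ∫⁻ y in Q i, if τ < 2 * N y then N y else 0) := by
      intro i
      set w := ∫⁻ y in Q i, if τ < 2 * N y then N y else 0 with hw
      -- The points with `2 * N ≤ τ` contribute at most half of `τ * volume (Q i)` and are absorbed,
      -- so only the large values of `N` are needed to control the volume.
      have h2 : τ * volume (Q i) ≤ w + τ / 2 * volume (Q i) := by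
        refine (havg i.1 i.2).1.trans ?_
        rw [hw, ← setLIntegral_const, ← lintegral_add_left hwm]
        refine lintegral_mono fun y => ?_
        by_cases hy : τ < 2 * N y
        · simp only [if_pos hy]; exact le_self_add
        · simp only [if_neg hy, zero_add]
          rw [ENNReal.le_div_iff_mul_le (by simp) (by simp), mul_comm]
          exact not_lt.1 hy
      have h3 : τ * volume (Q i) = τ / 2 * volume (Q i) + τ / 2 * volume (Q i) := by
        rw [← add_mul, ENNReal.add_halves]
      rw [h3] at h2
      have h4 : τ / 2 * volume (Q i) ≤ w :=
        (ENNReal.add_le_add_iff_right (ENNReal.mul_ne_top (ENNReal.div_ne_top hτt (by simp))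
          (hQt i))).1 h2
      calc volume (Q i) = 2 * (τ ^ (-1 : ℝ) * (τ / 2 * volume (Q i))) := by
            rw [ENNReal.rpow_neg_one, ENNReal.div_eq_inv_mul]
            calc volume (Q i) = (2 * 2⁻¹) * (τ⁻¹ * τ) * volume (Q i) := by
                  rw [ENNReal.inv_mul_cancel hτ0 hτt, ENNReal.mul_inv_cancel (by simp) (by simp)]
                  simp
              _ = _ := by ring
        _ ≤ _ := by gcongr
    calc V ≤ ∑' i, 2 * (τ ^ (-1 : ℝ) * ∫⁻ y in Q i, if τ < 2 * N y then N y else 0) :=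
          ENNReal.tsum_le_tsum h1
      _ = 2 * (τ ^ (-1 : ℝ) * ∫⁻ y in ⋃ i, Q i, if τ < 2 * N y then N y else 0) := by
          rw [ENNReal.tsum_mul_left, ENNReal.tsum_mul_left, lintegral_iUnion hQm hQdisj]
      _ ≤ _ := by gcongr; exact setLIntegral_le_lintegral _ _
  -- the bad and the good parts
  let b : S → (Fin j → ℝ) × (Fin m → ℝ) → ℂ := fun i => badPart f (Q i)
  have hb : ∀ i, IsNice (b i) := fun i =>
    isNice_badPart hf (hQm i) (hQ0 i) (dyadicCube_subset_closedBall i.1)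
  have hb_off : ∀ i x y, y ∉ Q i → b i (x, y) = 0 := fun i x y hy =>
    Set.indicator_of_notMem (by exact hy) _
  have hg : ∀ F : Finset S, IsNice fun z => f z - ∑ i ∈ F, b i z := fun F =>
    hf.sub (IsNice.finset_sum F hb)
  -- Only finitely many bad parts are removed, so that the linearity of `T` suffices; `e F` is the
  -- error from the cubes left untouched, and it tends to `0` along the finite sets.
  let e : Finset S → ℝ≥0∞ := fun F => ∑' i : {i // i ∉ F}, ∫⁻ y in Q i, N y ^ r
  have hgood : ∀ F : Finset S, ∫⁻ y, sliceNorm q (fun z => f z - ∑ i ∈ F, b i z) y ^ r ≤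
      (2 ^ m * τ) ^ r * V + J + e F := by
    intro F
    -- On a cube of `F` what remains of `f` is its mean, of slice norm at most `2 ^ m * τ`;
    -- elsewhere `f` is unchanged, and off all the cubes `N ≤ τ` almost everywhere.
    have hpt : ∀ᵐ y, sliceNorm q (fun z => f z - ∑ i ∈ F, b i z) y ^ r ≤
        (∑ i ∈ F, (Q i).indicator (fun _ => (2 ^ m * τ) ^ r) y) +
        (if N y ≤ τ then N y ^ r else 0) +
        ∑' i : {i // i ∉ F}, (Q i).indicator (fun y => N y ^ r) y := by
      filter_upwards [hout] with y hy
      by_cases hyF : ∃ i ∈ F, y ∈ Q i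
      · obtain ⟨i, hiF, hyi⟩ := hyF
        have hval : ∀ x, f (x, y) - ∑ i ∈ F, b i (x, y) = sliceMean f (Q i) x := by
          intro x
          rw [Finset.sum_eq_single i (fun i' _ hne => hb_off i' x y fun hy' =>
            Set.disjoint_left.1 (hQdisj hne) hy' hyi) (fun h => absurd hiF h)]
          simp only [b, badPart]
          rw [Set.indicator_of_mem (by exact hyi)]
          simp
        refine le_trans ?_ (le_self_add.trans le_self_add)
        refine le_trans ?_ (Finset.single_le_sum (fun i _ => zero_le) hiF)
        rw [Set.indicator_of_mem hyi]
        refine ENNReal.rpow_le_rpow ?_ hr.le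
        simp only [sliceNorm, hval]
        refine (iteratedNorm_sliceMean_le hq hf).trans ?_
        rw [mul_comm, ← div_eq_mul_inv]
        exact ENNReal.div_le_of_le_mul (havg i.1 i.2).2
      · push Not at hyF
        have hval : ∀ x, f (x, y) - ∑ i ∈ F, b i (x, y) = f (x, y) := fun x => by
          rw [Finset.sum_eq_zero fun i hi => hb_off i x y (hyF i hi), sub_zero]
        have hsl : sliceNorm q (fun z => f z - ∑ i ∈ F, b i z) y = N y := by
          simp only [sliceNorm, hval, hN]
        rw [hsl]
        by_cases hyS : ∃ i, y ∈ Q i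
        · obtain ⟨i, hyi⟩ := hyS
          refine le_trans ?_ le_add_self
          refine le_trans ?_ (ENNReal.le_tsum (⟨i, fun hi => hyF i hi hyi⟩ : {i // i ∉ F}))
          rw [Set.indicator_of_mem hyi]
        · refine le_trans ?_ (le_add_self.trans le_self_add)
          rw [if_pos]
          refine hy fun hmem => hyS ?_
          obtain ⟨d, hd, hyd⟩ := Set.mem_iUnion₂.1 hmem
          exact ⟨⟨d, hd⟩, hyd⟩
    have mA : Measurable fun y => ∑ i ∈ F, (Q i).indicator (fun _ => (2 ^ m * τ) ^ r) y :=
      Finset.measurable_sum _ fun i _ => measurable_const.indicator (hQm i)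
    have mB : Measurable fun y => if N y ≤ τ then N y ^ r else 0 :=
      Measurable.ite (measurableSet_le hNm measurable_const) (hNm.pow_const _) measurable_const
    refine (lintegral_mono_ae hpt).trans ?_
    rw [lintegral_add_left (mA.fun_add mB), lintegral_add_left mA,
      lintegral_finsetSum _ fun i _ => measurable_const.indicator (hQm i),
      lintegral_tsum fun (i : {i // i ∉ F}) => ((hNm.pow_const r).indicator (hQm i)).aemeasurable]
    gcongr ?_ + _ + ?_
    · simp_rw [fun i => lintegral_indicator_const (μ := volume) (hQm i) ((2 ^ m * τ) ^ r)]
      rw [← Finset.mul_sum]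
      gcongr
      exact ENNReal.sum_le_tsum F
    · refine ENNReal.tsum_le_tsum fun i => ?_
      rw [lintegral_indicator (hQm i)]
  -- The cancellation estimate holds off the dilated ball; integrating its majorant in `y` gives the
  -- full integral of `bracket`, which is at most `I` at every scale.
  have hbad : ∀ i, ∫⁻ y in (ball i)ᶜ, sliceNorm q (applyNice T (hb i)) y ≤
      C * I * 2 * 2 ^ m * τ * volume (Q i) := by
    intro i
    have hℓ : (0 : ℝ) < 2 ^ i.1.1 / 2 := by positivity
    have h1 := ae_ae_snd (hT (b i) (hb i) (dyadicCenter i.1) _ hℓ (fun z hz => by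
      rw [← mem_closedBall_iff_norm]
      refine dyadicCube_subset_closedBall i.1 ?_
      by_contra hcon
      exact hz (hb_off i z.1 z.2 hcon)) (integral_badPart hf (hQm i) (hQ0 i) (hQt i)))
    calc ∫⁻ y in (ball i)ᶜ, sliceNorm q (applyNice T (hb i)) y
        ≤ ∫⁻ y in (ball i)ᶜ, C * ((∫⁻ x : Fin j → ℝ, bracket ε (2 ^ i.1.1 / 2)
            (x, y - dyadicCenter i.1)) * ∫⁻ y', sliceNorm q (b i) y') := by
          refine lintegral_mono_ae ?_
          filter_upwards [ae_restrict_of_ae h1,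
            ae_restrict_mem Metric.isClosed_closedBall.measurableSet.compl] with y hy hyb
          refine sliceNorm_le_of_convolution_bound hq (hb i).1 (measurable_bracket _ _) C ?_
          filter_upwards [hy] with x hx
          refine hx ?_
          rw [Set.mem_compl_iff, mem_closedBall_iff_norm, not_le] at hyb
          exact hyb
      _ ≤ ∫⁻ y, C * ((∫⁻ x : Fin j → ℝ, bracket ε (2 ^ i.1.1 / 2)
            (x, y - dyadicCenter i.1)) * ∫⁻ y', sliceNorm q (b i) y') :=
          setLIntegral_le_lintegral _ _
      _ = C * ((∫⁻ z : (Fin j → ℝ) × (Fin m → ℝ), bracket ε (2 ^ i.1.1 / 2) z) *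
            ∫⁻ y', sliceNorm q (b i) y') := by
          have mbr : Measurable fun y : Fin m → ℝ => ∫⁻ x : Fin j → ℝ,
              bracket ε (2 ^ i.1.1 / 2) (x, y) := (measurable_bracket _ _).lintegral_prod_left'
          have mbr' : Measurable fun y : Fin m → ℝ => ∫⁻ x : Fin j → ℝ,
              bracket ε (2 ^ i.1.1 / 2) (x, y - dyadicCenter i.1) :=
            mbr.comp (measurable_id.sub_const _)
          rw [lintegral_const_mul _ (mbr'.mul_const _), lintegral_mul_const _ mbr',
            lintegral_sub_right_eq_self (fun y : Fin m → ℝ => ∫⁻ x : Fin j → ℝ,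
              bracket ε (2 ^ i.1.1 / 2) (x, y)), Measure.volume_eq_prod,
            lintegral_prod_symm _ (measurable_bracket _ _).aemeasurable]
      _ ≤ C * (I * (2 * (2 ^ m * τ * volume (Q i)))) := by
          gcongr
          · exact hI _ hℓ
          · exact (lintegral_sliceNorm_badPart_le hq hf (hQm i) (hQ0 i) (hQt i)).trans
              (by gcongr; exact (havg i.1 i.2).2)
      _ = _ := by ring
  have hfin : ∀ F : Finset S, volume {y | 2 * τ < sliceNorm q (applyNice T hf) y} ≤
      τ ^ (-r) * (D * ((2 ^ m * τ) ^ r * V + J + e F)) + K ^ m * V +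
        C * I * 2 * 2 ^ m * V := by
    intro F
    set u := sliceNorm q (applyNice T (hg F)) with hu
    have hum : Measurable u := measurable_sliceNorm q (measurable_applyNice T _)
    have hvm : ∀ i, Measurable (sliceNorm q (applyNice T (hb i))) := fun i =>
      measurable_sliceNorm q (measurable_applyNice T _)
    have hsplit : ∀ᵐ y, sliceNorm q (applyNice T hf) y ≤
        u y + ∑ i ∈ F, sliceNorm q (applyNice T (hb i)) y := by
      have h1 := applyNice_add T (hg F) (IsNice.finset_sum F hb)
      have h2 := applyNice_congr T hf ((hg F).add (IsNice.finset_sum F hb))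
        (Filter.Eventually.of_forall fun z => by simp)
      filter_upwards [ae_ae_snd h1, ae_ae_snd (enorm_applyNice_sum_le T F hb)] with y hy1 hy2
      have hmx : ∀ {v : (Fin j → ℝ) × (Fin m → ℝ) → ℂ}, Measurable v →
          Measurable fun x => ‖v (x, y)‖ₑ := fun hv => (hv.comp measurable_prodMk_right).enorm
      refine le_trans (iteratedNorm_mono_ae (fun i => (hq0 i).le)
        (G := fun x => ‖applyNice T (hg F) (x, y)‖ₑ + ∑ i ∈ F, ‖applyNice T (hb i) (x, y)‖ₑ) ?_)
        ((iteratedNorm_add_le hq (hmx (measurable_applyNice T _))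
          (Finset.measurable_sum _ fun i _ => hmx (measurable_applyNice T _))).trans
          (add_le_add_right (iteratedNorm_finset_sum_le hq F fun i =>
            hmx (measurable_applyNice T (hb i))) _))
      filter_upwards [hy1, hy2] with x hx1 hx2
      rw [h2, hx1]
      exact (enorm_add_le _ _).trans (by gcongr)
    -- Outside the dilated balls, a total above `2 * τ` forces the good part or the sum of the bad
    -- parts to reach `τ`. Chebyshev's inequality is used with the `r`-th power for the former and
    -- the first power for the latter.
    have hsub : {y | 2 * τ < sliceNorm q (applyNice T hf) y} ≤ᵐ[volume]
        ((({y | τ ≤ u y} ∪ ⋃ i ∈ F, ball i) ∪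
          {y | τ ≤ ∑ i ∈ F, (ball i)ᶜ.indicator (sliceNorm q (applyNice T (hb i))) y} :
            Set (Fin m → ℝ))) := by
      filter_upwards [hsplit] with y hy hlt
      by_contra hcon
      replace hcon : ¬ ((τ ≤ u y ∨ y ∈ ⋃ i ∈ F, ball i) ∨
        τ ≤ ∑ i ∈ F, (ball i)ᶜ.indicator (sliceNorm q (applyNice T (hb i))) y) := hcon
      simp only [not_or] at hcon
      obtain ⟨⟨h1, h2⟩, h3⟩ := hcon
      have h1' : u y < τ := not_le.1 h1
      have h3' : ∑ i ∈ F, (ball i)ᶜ.indicator (sliceNorm q (applyNice T (hb i))) y < τ :=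
        not_le.1 h3
      have h4 : ∑ i ∈ F, (ball i)ᶜ.indicator (sliceNorm q (applyNice T (hb i))) y =
          ∑ i ∈ F, sliceNorm q (applyNice T (hb i)) y :=
        Finset.sum_congr rfl fun i hi => Set.indicator_of_mem
          (show y ∈ (ball i)ᶜ from fun hmem => h2 (Set.mem_iUnion₂.2 ⟨i, hi, hmem⟩)) _
      rw [h4] at h3'
      have h5 := hy.trans_lt (ENNReal.add_lt_add h1' h3')
      rw [← two_mul] at h5
      exact lt_irrefl _ (h5.trans hlt)
    have hneg : ∀ {x y : ℝ≥0∞} {a : ℝ}, 0 < a → τ ^ a * x ≤ y → x ≤ τ ^ (-a) * y := by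
      intro x y a ha h
      calc x = τ ^ (-a) * (τ ^ a * x) := by
            rw [← mul_assoc, ← ENNReal.rpow_add _ _ hτ0 hτt]; simp
        _ ≤ _ := by gcongr
    refine (measure_mono_ae hsub).trans ((measure_union_le _ _).trans
      (add_le_add ((measure_union_le _ _).trans (add_le_add ?_ ?_)) ?_))
    · refine hneg hr ?_
      refine le_trans ?_ ((hD _ (hg F)).trans (by gcongr; exact hgood F))
      refine le_trans ?_ (mul_meas_ge_le_lintegral (hum.pow_const r) (τ ^ r))
      refine mul_le_mul_right (measure_mono fun y hy => ?_) _
      exact ENNReal.rpow_le_rpow hy hr.le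
    · refine (measure_biUnion_finset_le F _).trans ?_
      simp_rw [hball]
      rw [← Finset.mul_sum]
      gcongr
      exact ENNReal.sum_le_tsum F
    · have hmi : ∀ i, Measurable ((ball i)ᶜ.indicator (sliceNorm q (applyNice T (hb i)))) :=
        fun i => (hvm i).indicator Metric.isClosed_closedBall.measurableSet.compl
      have := mul_meas_ge_le_lintegral (μ := volume)
        (Finset.measurable_sum F fun i _ => hmi i) τ
      have h2 := hneg one_pos ((congrArg (· * _) (ENNReal.rpow_one τ)).trans_le this)
      refine h2.trans ?_
      rw [lintegral_finsetSum _ fun i _ => hmi i]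
      calc τ ^ (-1 : ℝ) * ∑ i ∈ F, ∫⁻ y, (ball i)ᶜ.indicator (sliceNorm q (applyNice T (hb i))) y
          ≤ τ ^ (-1 : ℝ) * ∑ i ∈ F, C * I * 2 * 2 ^ m * τ * volume (Q i) := by
            gcongr with i _
            rw [lintegral_indicator Metric.isClosed_closedBall.measurableSet.compl]
            exact hbad i
        _ = (τ⁻¹ * τ) * (C * I * 2 * 2 ^ m * ∑ i ∈ F, volume (Q i)) := by
            rw [← Finset.mul_sum, ENNReal.rpow_neg_one]; ring
        _ ≤ _ := by
            rw [ENNReal.inv_mul_cancel hτ0 hτt, one_mul]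
            gcongr
            exact ENNReal.sum_le_tsum F
  -- passage to the limit
  have he : Filter.Tendsto e Filter.atTop (nhds 0) := by
    refine ENNReal.tendsto_tsum_compl_atTop_zero (f := fun i : S => ∫⁻ y in Q i, N y ^ r) ?_
    rw [← lintegral_iUnion hQm hQdisj]
    exact ne_top_of_le_ne_top (hf.lintegral_sliceNorm_rpow_ne_top hq0 hr)
      (setLIntegral_le_lintegral _ _)
  have hlim : Filter.Tendsto (fun F => τ ^ (-r) * (D * ((2 ^ m * τ) ^ r * V + J + e F)) +
      K ^ m * V + C * I * 2 * 2 ^ m * V) Filter.atTop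
      (nhds (τ ^ (-r) * (D * ((2 ^ m * τ) ^ r * V + J + 0)) + K ^ m * V +
        C * I * 2 * 2 ^ m * V)) := by
    refine Filter.Tendsto.add_const _ (Filter.Tendsto.add_const _ ?_)
    refine ENNReal.Tendsto.const_mul (ENNReal.Tendsto.const_mul (he.const_add _)
      (Or.inr (by simp))) (Or.inr ?_)
    exact ENNReal.rpow_ne_top_of_ne_zero hτ0 hτt
  refine (ge_of_tendsto' hlim hfin).trans ?_
  have hpow : τ ^ (-r) * (2 ^ m * τ) ^ r = (2 ^ m) ^ r := by
    rw [ENNReal.mul_rpow_of_nonneg _ _ hr.le, mul_left_comm, ← ENNReal.rpow_add _ _ hτ0 hτt]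
    simp
  calc τ ^ (-r) * (D * ((2 ^ m * τ) ^ r * V + J + 0)) + K ^ m * V + C * I * 2 * 2 ^ m * V
      = D * (τ ^ (-r) * J) + (D * (τ ^ (-r) * (2 ^ m * τ) ^ r) + K ^ m + C * I * 2 * 2 ^ m) * V := by
        rw [add_zero]; ring
    _ ≤ D * (τ ^ (-r) * J + τ ^ (-1 : ℝ) * W) + (D * (2 ^ m) ^ r + K ^ m + C * I * 2 * 2 ^ m) *
          (2 * (τ ^ (-r) * J + τ ^ (-1 : ℝ) * W)) := by
        rw [hpow]
        gcongr
        · exact le_self_add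
        · exact hVW.trans (by gcongr; exact le_add_self)
    _ = _ := by ring

/-- The theorem of Benedek, Calderón and Panzone, for exponents below the given one. -/
theorem exists_lintegral_sliceNorm_applyNice_le (hm : 0 < m) (hq : ∀ i, 1 ≤ q i)
    {T : Lp ℂ 2 (volume : Measure ((Fin j → ℝ) × (Fin m → ℝ))) →L[ℂ]
      Lp ℂ 2 (volume : Measure ((Fin j → ℝ) × (Fin m → ℝ)))} {ε : ℝ} (hε : 0 < ε) {K C : ℝ≥0}
    (hT : HasCancellation T ε K C) {r s : ℝ} (hs : 1 < s) (hsr : s < r)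
    {D : ℝ≥0} (hD : ∀ (g : (Fin j → ℝ) × (Fin m → ℝ) → ℂ) (hg : IsNice g),
      ∫⁻ y, sliceNorm q (applyNice T hg) y ^ r ≤ D * ∫⁻ y, sliceNorm q g y ^ r) :
    ∃ D' : ℝ≥0, ∀ (g : (Fin j → ℝ) × (Fin m → ℝ) → ℂ) (hg : IsNice g),
      ∫⁻ y, sliceNorm q (applyNice T hg) y ^ s ≤ D' * ∫⁻ y, sliceNorm q g y ^ s := by
  have : (volume : Measure ((Fin j → ℝ) × (Fin m → ℝ))).IsAddHaarMeasure :=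
    Measure.prod.instIsAddHaarMeasure (volume : Measure (Fin j → ℝ))
      (volume : Measure (Fin m → ℝ))
  obtain ⟨I, hI⟩ := exists_lintegral_bracket_le
    (volume : Measure ((Fin j → ℝ) × (Fin m → ℝ))) hε
  have hr0 : 0 < r := by linarith
  have hq0 : ∀ i, 0 < q i := fun i => zero_lt_one.trans_le (hq i)
  set D' : ℝ≥0∞ := ENNReal.ofReal (s * 2 ^ s) *
      (ENNReal.ofReal (1 / (r - s)) + ENNReal.ofReal (2 ^ (s - 1) / (s - 1))) *
      (D + 2 * (D * (2 ^ m) ^ r + K ^ m + C * I * 2 * 2 ^ m)) with hD'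
  have hD't : D' ≠ ∞ := by
    have : ((2 : ℝ≥0∞) ^ m) ^ r ≠ ∞ := ENNReal.rpow_ne_top_of_nonneg hr0.le (by simp)
    rw [hD']
    finiteness
  refine ⟨D'.toNNReal, fun g hg => ?_⟩
  rw [ENNReal.coe_toNNReal hD't]
  obtain ⟨B, R, hB⟩ := hg.exists_sliceNorm_le hq0
  exact lintegral_rpow_le_of_distribution (measurable_sliceNorm q (measurable_applyNice T hg))
    (measurable_sliceNorm q hg.1) (fun y => ((hB y).1.trans_lt (by simp)).ne) hs hsr
    fun t ht => distribution_sliceNorm_le hm hq hT hI hr0 hD hg ht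

end CalderonZygmund


/-! ### Standard kernels -/

section kernel

variable {n : ℕ} {k : E n → E n → ℂ}

/-- The smoothness condition is applied in one variable at a time, through the intermediate value `k
x₀ z.2`. This is the source of all measurability of the kernel. -/
theorem IsStandardKernel.continuousOn (hk : IsStandardKernel k) :
    ContinuousOn (Function.uncurry k) {z | z.1 ≠ z.2} := by
  obtain ⟨ε, C, hε, hC, h⟩ := hk.smooth
  rintro ⟨x₀, y₀⟩ (hne : x₀ ≠ y₀)
  refine ContinuousAt.continuousWithinAt ?_
  have hd : 0 < ‖x₀ - y₀‖ := norm_pos_iff.2 (sub_ne_zero.2 hne)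
  rw [ContinuousAt, tendsto_iff_norm_sub_tendsto_zero]
  have c1 : Filter.Tendsto (fun z : E n × E n => ‖x₀ - z.1‖) (nhds (x₀, y₀)) (nhds 0) := by
    have : Continuous fun z : E n × E n => ‖x₀ - z.1‖ := by fun_prop
    simpa using this.tendsto (x₀, y₀)
  have c2 : Filter.Tendsto (fun z : E n × E n => ‖y₀ - z.2‖) (nhds (x₀, y₀)) (nhds 0) := by
    have : Continuous fun z : E n × E n => ‖y₀ - z.2‖ := by fun_prop
    simpa using this.tendsto (x₀, y₀)
  have c3 : Filter.Tendsto (fun z : E n × E n => ‖x₀ - z.2‖) (nhds (x₀, y₀))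
      (nhds ‖x₀ - y₀‖) := by
    have : Continuous fun z : E n × E n => ‖x₀ - z.2‖ := by fun_prop
    exact this.tendsto (x₀, y₀)
  have hlim : Filter.Tendsto (fun z : E n × E n =>
      C * (‖x₀ - z.1‖ ^ ε / ‖x₀ - z.2‖ ^ ((n : ℝ) + ε)) +
      C * (‖y₀ - z.2‖ ^ ε / ‖y₀ - x₀‖ ^ ((n : ℝ) + ε))) (nhds (x₀, y₀)) (nhds 0) := by
    have d1 := ((c1.rpow_const (p := ε) (Or.inr hε.le)).div
      (c3.rpow_const (p := (n : ℝ) + ε) (Or.inl hd.ne'))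
      (Real.rpow_pos_of_pos hd _).ne').const_mul C
    have d2 := ((c2.rpow_const (p := ε) (Or.inr hε.le)).div_const
      (‖y₀ - x₀‖ ^ ((n : ℝ) + ε))).const_mul C
    simpa [Real.zero_rpow hε.ne'] using d1.add d2
  refine squeeze_zero' (Filter.Eventually.of_forall fun z => norm_nonneg _) ?_ hlim
  have e1 : ∀ᶠ z : E n × E n in nhds (x₀, y₀), 2 * ‖x₀ - z.1‖ < ‖x₀ - z.2‖ :=
    (c1.const_mul 2).eventually_lt c3 (by simpa using hd)
  have e2 : ∀ᶠ z : E n × E n in nhds (x₀, y₀), 2 * ‖y₀ - z.2‖ < ‖x₀ - y₀‖ :=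
    (c2.const_mul 2).eventually_lt_const (by simpa using hd)
  have e3 : ∀ᶠ z : E n × E n in nhds (x₀, y₀), 0 < ‖x₀ - z.2‖ := c3.eventually_const_lt hd
  filter_upwards [e1, e2, e3] with z h1 h2 h3
  have a1 := h x₀ z.2 z.1 (sub_ne_zero.1 (norm_pos_iff.1 h3)) h1.le
  have a2 := h y₀ x₀ z.2 hne.symm (by rw [norm_sub_rev y₀ x₀]; exact h2.le)
  calc ‖k z.1 z.2 - k x₀ y₀‖ = ‖-(k x₀ z.2 - k z.1 z.2) + -(k x₀ y₀ - k x₀ z.2)‖ := by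
        congr 1; ring
    _ ≤ ‖k x₀ z.2 - k z.1 z.2‖ + ‖k x₀ y₀ - k x₀ z.2‖ := by
        refine (norm_add_le _ _).trans ?_
        rw [norm_neg, norm_neg]
    _ ≤ _ := add_le_add (le_trans (le_add_of_nonneg_right (norm_nonneg _)) a1)
        (le_trans (le_add_of_nonneg_left (norm_nonneg _)) a2)

open Classical in
/-- A kernel, with the value `0` on the diagonal. -/
noncomputable def offDiag (k : E n → E n → ℂ) (z : E n × E n) : ℂ :=
  if z.1 ≠ z.2 then k z.1 z.2 else 0

theorem offDiag_of_ne {x y : E n} (h : x ≠ y) : offDiag k (x, y) = k x y := if_pos h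

theorem IsStandardKernel.measurable_offDiag (hk : IsStandardKernel k) :
    Measurable (offDiag k) := by
  classical
  have hopen : IsOpen {z : E n × E n | z.1 ≠ z.2} :=
    (isClosed_eq continuous_fst continuous_snd).isOpen_compl
  have := hk.continuousOn.measurable_piecewise (g := fun _ => (0 : ℂ)) continuousOn_const
    hopen.measurableSet
  convert this using 1
  funext z
  by_cases h : z.1 = z.2 <;> simp [offDiag, Set.piecewise, h, Function.uncurry]

/-- The kernel of the adjoint operator. -/
def adjointKernel (k : E n → E n → ℂ) (x y : E n) : ℂ := (starRingEnd ℂ) (k y x)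

theorem IsStandardKernel.adjoint (hk : IsStandardKernel k) :
    IsStandardKernel (adjointKernel k) := by
  constructor
  · obtain ⟨C, hC, h⟩ := hk.size
    refine ⟨C, hC, fun x y hxy => ?_⟩
    rw [adjointKernel, RCLike.norm_conj, norm_sub_rev]
    exact h y x hxy.symm
  · obtain ⟨ε, C, hε, hC, h⟩ := hk.smooth
    refine ⟨ε, C, hε, hC, fun x y z hxy hz => ?_⟩
    simp only [adjointKernel, ← map_sub, RCLike.norm_conj]
    rw [add_comm]
    exact h x y z hxy hz

/-- The size bound at a positive distance. -/
theorem IsStandardKernel.exists_bound (hk : IsStandardKernel k) {δ : ℝ} (hδ : 0 < δ) :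
    ∃ M : ℝ, 0 ≤ M ∧ ∀ x y, δ ≤ ‖x - y‖ → ‖k x y‖ ≤ M := by
  obtain ⟨C, hC, h⟩ := hk.size
  refine ⟨C / δ ^ n, by positivity, fun x y hxy => (h x y ?_).trans ?_⟩
  · rintro rfl
    simp at hxy
    linarith
  · gcongr

end kernel

/-! ### Singular integral operators on nice functions and their adjoints -/

theorem IsNice.hasCompactSupport {X : Type*} [NormedAddCommGroup X] [ProperSpace X]
    [MeasurableSpace X] {f : X → ℂ} (hf : IsNice f) : HasCompactSupport f := by
  obtain ⟨-, M, R, h⟩ := hf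
  refine HasCompactSupport.intro (isCompact_closedBall 0 R) fun x hx => ?_
  by_contra hne
  exact hx (by simpa using (h x).2 hne)

section sio

variable {n : ℕ} {k : E n → E n → ℂ} {T : L2 n →L[ℂ] L2 n}

theorem IsSingularIntegralOperator.repr_nice (hT : IsSingularIntegralOperator T k) {f : E n → ℂ}
    (hf : IsNice f) : ∀ᵐ x, x ∉ tsupport f → applyNice T hf x = ∫ y, k x y * f y :=
  hT.repr f (hf.memLp 2) (hf.memLp ∞) hf.hasCompactSupport

theorem inner_applyNice (T : L2 n →L[ℂ] L2 n) {f g : E n → ℂ} (hf : IsNice f) (hg : IsNice g) :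
    ∫ x, applyNice (ContinuousLinearMap.adjoint T) hf x * (starRingEnd ℂ) (g x) =
      ∫ x, f x * (starRingEnd ℂ) (applyNice T hg x) := by
  have h := ContinuousLinearMap.adjoint_inner_right T ((hg.memLp 2).toLp g) ((hf.memLp 2).toLp f)
  rw [L2.inner_def, L2.inner_def] at h
  refine Eq.trans (integral_congr_ae ?_) (h.trans (integral_congr_ae ?_))
  · filter_upwards [(hg.memLp 2).coeFn_toLp (μ := volume)] with x hx
    rw [RCLike.inner_apply, hx]
    rfl
  · filter_upwards [(hf.memLp 2).coeFn_toLp (μ := volume)] with x hx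
    rw [RCLike.inner_apply, hx]
    rfl

theorem isNice_indicator_one {S : Set (E n)} (hS : MeasurableSet S) {R : ℝ}
    (hR : ∀ x ∈ S, ‖x‖ ≤ R) : IsNice (S.indicator fun _ => (1 : ℂ)) := by
  refine ⟨measurable_const.indicator hS, 1, R, fun z => ⟨?_, fun hz => hR z ?_⟩⟩
  · exact (norm_indicator_le_norm_self _ _).trans (by simp)
  · by_contra h
    exact hz (Set.indicator_of_notMem h _)

/-- Both sides are tested against indicators of sets `S` at positive distance from the support of
`f`. There `T` of the indicator has its kernel representation on that support, and Fubini's theorem,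
legitimate since the kernel is bounded at a positive distance, yields the kernel of the adjoint. -/
theorem IsSingularIntegralOperator.adjoint (hT : IsSingularIntegralOperator T k) :
    IsSingularIntegralOperator (ContinuousLinearMap.adjoint T) (adjointKernel k) := by
  refine ⟨hT.kernel.adjoint, fun f hf2 hfi hfc => ?_⟩
  -- it is enough to treat nice functions
  suffices H : ∀ (f : E n → ℂ) (hf : IsNice f), ∀ (K : Set (E n)), IsClosed K →
      (∀ x, f x ≠ 0 → x ∈ K) → ∀ᵐ x, x ∉ K →
      applyNice (ContinuousLinearMap.adjoint T) hf x = ∫ y, adjointKernel k x y * f y by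
    obtain ⟨f', hf'm, hff'⟩ : ∃ f' : E n → ℂ, Measurable f' ∧ f =ᵐ[volume] f' :=
      ⟨hf2.1.mk f, hf2.1.stronglyMeasurable_mk.measurable, hf2.1.ae_eq_mk⟩
    set M := (eLpNorm f ∞ volume).toReal with hM
    have hfM : ∀ᵐ x, ‖f x‖ ≤ M := by
      filter_upwards [enorm_ae_le_eLpNormEssSup f volume] with x hx
      rw [hM, eLpNorm_exponent_top, ← toReal_enorm]
      exact ENNReal.toReal_mono (by have := hfi.2; rw [eLpNorm_exponent_top] at this; exact this.ne)
        hx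
    obtain ⟨R, hR⟩ := hfc.isCompact.isBounded.exists_norm_le
    have hSm : MeasurableSet {x | ‖f' x‖ ≤ M ∧ x ∈ tsupport f} :=
      (measurableSet_le hf'm.norm measurable_const).inter (isClosed_tsupport f).measurableSet
    -- The representative is cut off to be bounded everywhere and to vanish off `tsupport f`. The
    -- exceptional closed set stays `tsupport f`, which is why it appears as a separate set `K` in
    -- the reduced claim.
    set g := {x | ‖f' x‖ ≤ M ∧ x ∈ tsupport f}.indicator f' with hg
    have hgmem : ∀ x, g x ≠ 0 → x ∈ tsupport f := fun x hx => by
      by_contra hcon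
      exact hx (Set.indicator_of_notMem (fun h => hcon h.2) _)
    have hgn : IsNice g := by
      refine ⟨hf'm.indicator hSm, M, R, fun z => ⟨?_, fun hz => hR z (hgmem z hz)⟩⟩
      by_cases hz : z ∈ {x | ‖f' x‖ ≤ M ∧ x ∈ tsupport f}
      · rw [hg, Set.indicator_of_mem hz]; exact hz.1
      · rw [hg, Set.indicator_of_notMem hz, norm_zero]; exact ENNReal.toReal_nonneg
    have hfg : f =ᵐ[volume] g := by
      filter_upwards [hff', hfM] with x hx hxM
      by_cases hz : x ∈ tsupport f
      · rw [hg, Set.indicator_of_mem (by exact ⟨hx ▸ hxM, hz⟩), hx]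
      · rw [hg, Set.indicator_of_notMem (fun h => hz h.2), image_eq_zero_of_notMem_tsupport hz]
    filter_upwards [H g hgn (tsupport f) (isClosed_tsupport f) hgmem] with x hx hxs
    rw [MemLp.toLp_congr hf2 (hgn.memLp 2) hfg]
    refine (hx hxs).trans (integral_congr_ae ?_)
    filter_upwards [hfg] with y hy
    rw [hy]
  intro f hf K hK hfK
  obtain ⟨hfm, Mf, Rf, hfb⟩ := id hf
  have hfint : Integrable f := memLp_one_iff_integrable.1 (hf.memLp 1)
  set u := applyNice (ContinuousLinearMap.adjoint T) hf with hu
  -- These bounded sets exhaust the complement of `K`, and each stays at distance at least `1 / (N +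
  -- 1)` from `K`.
  let A : ℕ → Set (E n) := fun N => Metric.closedBall 0 N ∩
    {x | ∀ y ∈ K, 1 / ((N : ℝ) + 1) ≤ ‖x - y‖}
  have hAc : ∀ N, IsClosed (A N) := fun N => by
    refine Metric.isClosed_closedBall.inter ?_
    have : {x : E n | ∀ y ∈ K, 1 / ((N : ℝ) + 1) ≤ ‖x - y‖} =
        ⋂ y ∈ K, {x | 1 / ((N : ℝ) + 1) ≤ ‖x - y‖} := by ext; simp
    rw [this]
    exact isClosed_biInter fun y _ => isClosed_le continuous_const (by fun_prop)
  have hAm : ∀ N, MeasurableSet (A N) := fun N => (hAc N).measurableSet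
  have hAfin : ∀ N, volume (A N) < ∞ := fun N =>
    (measure_mono Set.inter_subset_left).trans_lt (isCompact_closedBall _ _).measure_lt_top
  have hcover : ∀ x, x ∉ K → ∃ N, x ∈ A N := by
    intro x hx
    obtain ⟨δ, hδ, hball⟩ := Metric.isOpen_iff.1 hK.isOpen_compl x hx
    obtain ⟨N₁, hN₁⟩ := exists_nat_one_div_lt hδ
    obtain ⟨N₂, hN₂⟩ := exists_nat_ge ‖x‖
    refine ⟨max N₁ N₂, ?_, fun y hy => ?_⟩
    · rw [mem_closedBall_zero_iff]
      exact hN₂.trans (by exact_mod_cast le_max_right _ _)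
    · have h1 : δ ≤ ‖x - y‖ := by
        by_contra hlt
        exact hball (by rw [mem_ball_iff_norm, norm_sub_rev]; exact not_le.1 hlt) hy
      refine le_trans ?_ (hN₁.le.trans h1)
      gcongr
      exact le_max_left _ _
  suffices H : ∀ N, ∀ᵐ x ∂(volume.restrict (A N)), u x = ∫ y, adjointKernel k x y * f y by
    have H' : ∀ᵐ x, ∀ N, x ∈ A N → u x = ∫ y, adjointKernel k x y * f y :=
      ae_all_iff.2 fun N => (ae_restrict_iff' (hAm N)).1 (H N)
    filter_upwards [H'] with x hx hxK
    obtain ⟨N, hN⟩ := hcover x hxK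
    exact hx N hN
  intro N
  have hδ : (0 : ℝ) < 1 / ((N : ℝ) + 1) := by positivity
  obtain ⟨B, hB0, hB⟩ := hT.kernel.exists_bound hδ
  have hneA : ∀ x ∈ A N, ∀ y ∈ K, y ≠ x := by
    rintro x hx y hy rfl
    have := hx.2 y hy
    rw [sub_self, norm_zero] at this
    linarith
  -- the product integrand
  let H : E n → E n → ℂ := fun x y => (A N).indicator 1 x *
    ((K.indicator 1 y * (starRingEnd ℂ) (offDiag k (y, x))) * f y)
  have hHeq : ∀ x ∈ A N, ∀ y, H x y = adjointKernel k x y * f y := by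
    intro x hx y
    by_cases hy : f y = 0
    · simp [H, hy]
    · have hyK := hfK y hy
      simp only [H, adjointKernel, Set.indicator_of_mem hx, Set.indicator_of_mem hyK,
        Pi.one_apply, one_mul, offDiag_of_ne (hneA x hx y hyK)]
  have hHm : Measurable (Function.uncurry H) := by
    have m1 : Measurable ((A N).indicator (1 : E n → ℂ)) := measurable_one.indicator (hAm N)
    have m2 : Measurable (K.indicator (1 : E n → ℂ)) := measurable_one.indicator hK.measurableSet
    exact (m1.comp measurable_fst).mul (((m2.comp measurable_snd).mul
      (Complex.continuous_conj.measurable.comp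
        (hT.kernel.measurable_offDiag.comp measurable_swap))).mul (hfm.comp measurable_snd))
  have hHint : Integrable (Function.uncurry H)
      ((volume.restrict (A N)).prod (volume : Measure (E n))) := by
    have : IsFiniteMeasure (volume.restrict (A N)) :=
      ⟨by rw [Measure.restrict_apply_univ]; exact hAfin N⟩
    have hdom : Integrable (fun z : E n × E n => (B : ℝ) * ‖f z.2‖)
        ((volume.restrict (A N)).prod (volume : Measure (E n))) :=
      (hfint.norm.comp_snd _).const_mul B
    refine hdom.mono' hHm.aestronglyMeasurable (Filter.Eventually.of_forall fun z => ?_)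
    by_cases hx : z.1 ∈ A N
    · by_cases hy : f z.2 = 0
      · simp [H, Function.uncurry, hy]
      · have := hHeq z.1 hx z.2
        rw [Function.uncurry, this, norm_mul, adjointKernel, RCLike.norm_conj]
        gcongr
        refine hB _ _ ?_
        rw [norm_sub_rev]
        exact hx.2 _ (hfK _ hy)
    · simp only [H, Function.uncurry, Set.indicator_of_notMem hx, zero_mul, norm_zero]
      positivity
  have hw : ∀ x ∈ A N, ∫ y, adjointKernel k x y * f y = ∫ y, H x y := fun x hx =>
    integral_congr_ae (Filter.Eventually.of_forall fun y => (hHeq x hx y).symm)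
  have hae : u =ᵐ[volume.restrict (A N)] fun x => ∫ y, H x y := by
    refine Integrable.ae_eq_of_forall_setIntegral_eq _ _ ?_ hHint.integral_prod_left ?_
    · exact integrableOn_Lp_of_measure_ne_top _ (by norm_num) (hAfin N).ne
    · intro s hs _
      rw [Measure.restrict_restrict hs]
      set S := s ∩ A N with hS
      have hSm : MeasurableSet S := hs.inter (hAm N)
      have hSn : IsNice (S.indicator fun _ => (1 : ℂ)) :=
        isNice_indicator_one hSm (R := N) fun x hx => by simpa using hx.2.1
      have h1 : ∫ x in S, u x = ∫ x, u x * (starRingEnd ℂ) (S.indicator (fun _ => (1 : ℂ)) x) := by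
        rw [← integral_indicator hSm]
        refine integral_congr_ae (Filter.Eventually.of_forall fun x => ?_)
        by_cases hx : x ∈ S <;> simp [hx]
      have hTS : ∀ᵐ y, y ∈ K → applyNice T hSn y = ∫ x in S, k y x := by
        filter_upwards [hT.repr_nice hSn] with y hy hyK
        have hyS : y ∉ tsupport (S.indicator fun _ => (1 : ℂ)) := by
          intro hmem
          have hsub : tsupport (S.indicator fun _ => (1 : ℂ)) ⊆ A N :=
            closure_minimal (fun z hz => by
              by_contra hcon
              exact hz (Set.indicator_of_notMem (fun h => hcon h.2) _)) (hAc N)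
          exact hneA y (hsub hmem) y hyK rfl
        rw [hy hyS, ← integral_indicator hSm]
        refine integral_congr_ae (Filter.Eventually.of_forall fun x => ?_)
        by_cases hx : x ∈ S <;> simp [hx]
      rw [h1, hu, inner_applyNice T hf hSn]
      have hHS : Integrable (Function.uncurry H)
          ((volume.restrict S).prod (volume : Measure (E n))) :=
        hHint.mono_measure (Measure.prod_mono (Measure.restrict_mono Set.inter_subset_right le_rfl)
          le_rfl)
      rw [integral_integral_swap hHS]
      refine integral_congr_ae ?_
      filter_upwards [hTS] with y hy
      by_cases hy0 : f y = 0
      · simp [H, hy0]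
      · rw [hy (hfK y hy0), ← integral_conj, ← integral_const_mul]
        refine setIntegral_congr_fun hSm fun x hx => ?_
        rw [hHeq x hx.2 y, adjointKernel, mul_comm]
  filter_upwards [hae, ae_restrict_mem (hAm N)] with x hx hxA
  rw [hw x hxA]
  exact hx

end sio


/-! ### Mixed Lebesgue norms -/

section norms

variable {n : ℕ} {q q' : Fin n → ℝ} {f g : E n → ℂ}

theorem measurePreserving_toLp (n : ℕ) :
    MeasurePreserving (fun v : Fin n → ℝ => (WithLp.toLp 2 v : E n)) volume volume :=
  PiLp.volume_preserving_toLp (Fin n)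

theorem measurable_ofLp_euclidean (n : ℕ) : Measurable fun x : E n => (WithLp.ofLp x) :=
  (PiLp.volume_preserving_ofLp (Fin n)).measurable

theorem measurable_enorm_toLp (hf : Measurable f) :
    Measurable fun v : Fin n → ℝ => ‖f (WithLp.toLp 2 v)‖ₑ :=
  (hf.comp (measurePreserving_toLp n).measurable).enorm

theorem lintegral_toLp {F : E n → ℝ≥0∞} (hF : Measurable F) :
    ∫⁻ v : Fin n → ℝ, F (WithLp.toLp 2 v) = ∫⁻ x, F x :=
  (measurePreserving_toLp n).lintegral_comp hF

theorem mixedLebesgueNorm_mono_ae (hq : ∀ i, 0 ≤ q i) (h : ∀ᵐ x, ‖f x‖ₑ ≤ ‖g x‖ₑ) :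
    mixedLebesgueNorm q f ≤ mixedLebesgueNorm q g :=
  iteratedNorm_mono_ae hq ((measurePreserving_toLp n).quasiMeasurePreserving.ae h)

theorem mixedLebesgueNorm_congr_ae (hq : ∀ i, 0 ≤ q i) (h : f =ᵐ[volume] g) :
    mixedLebesgueNorm q f = mixedLebesgueNorm q g :=
  iteratedNorm_congr_ae hq (by
    filter_upwards [(measurePreserving_toLp n).quasiMeasurePreserving.ae h] with v hv
    rw [hv])

theorem mixedLebesgueNorm_add_le (hq : ∀ i, 1 ≤ q i) (hf : Measurable f) (hg : Measurable g) :
    mixedLebesgueNorm q (fun x => f x + g x) ≤ mixedLebesgueNorm q f + mixedLebesgueNorm q g :=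
  (iteratedNorm_mono (fun i => zero_le_one.trans (hq i)) fun _ => enorm_add_le _ _).trans
    (iteratedNorm_add_le hq (measurable_enorm_toLp hf) (measurable_enorm_toLp hg))

theorem mixedLebesgueNorm_const_mul (hq : ∀ i, 0 < q i) (hf : Measurable f) (c : ℂ) :
    mixedLebesgueNorm q (fun x => c * f x) = ‖c‖ₑ * mixedLebesgueNorm q f := by
  unfold mixedLebesgueNorm
  simp_rw [enorm_mul]
  exact iteratedNorm_const_mul hq (measurable_enorm_toLp hf) _

theorem mixedLebesgueNorm_const_exponent {s : ℝ} (hs : 0 < s) (hf : Measurable f) :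
    mixedLebesgueNorm (fun _ => s) f = eLpNorm f (ENNReal.ofReal s) volume := by
  rw [mixedLebesgueNorm, iteratedNorm_const_exponent hs (measurable_enorm_toLp hf),
    eLpNorm_eq_lintegral_rpow_enorm_toReal (by simpa using hs) ENNReal.ofReal_ne_top,
    ENNReal.toReal_ofReal hs.le, lintegral_toLp (F := fun x => ‖f x‖ₑ ^ s) (by fun_prop)]

theorem lintegral_enorm_mul_le (hq : ∀ i, (q i).HolderConjugate (q' i)) (hf : Measurable f)
    (hg : Measurable g) :
    ∫⁻ x, ‖f x‖ₑ * ‖g x‖ₑ ≤ mixedLebesgueNorm q f * mixedLebesgueNorm q' g := by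
  rw [← lintegral_toLp (F := fun x => ‖f x‖ₑ * ‖g x‖ₑ) (by fun_prop)]
  exact lintegral_mul_le_iteratedNorm_mul hq (measurable_enorm_toLp hf) (measurable_enorm_toLp hg)

/-- Truncation in the space variable and in size. -/
noncomputable def trunc (N : ℕ) (f : E n → ℂ) : E n → ℂ :=
  {x | ‖x‖ ≤ N ∧ ‖f x‖ ≤ N}.indicator f

theorem trunc_of_mem {N : ℕ} {x : E n} (h : ‖x‖ ≤ N ∧ ‖f x‖ ≤ N) : trunc N f x = f x :=
  Set.indicator_of_mem (s := {x | ‖x‖ ≤ N ∧ ‖f x‖ ≤ N}) h _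

theorem trunc_of_notMem {N : ℕ} {x : E n} (h : ¬ (‖x‖ ≤ N ∧ ‖f x‖ ≤ N)) : trunc N f x = 0 :=
  Set.indicator_of_notMem (s := {x | ‖x‖ ≤ N ∧ ‖f x‖ ≤ N}) h _

theorem trunc_eq_of_ne_zero {N : ℕ} {x : E n} (h : trunc N f x ≠ 0) : trunc N f x = f x := by
  by_cases hx : ‖x‖ ≤ N ∧ ‖f x‖ ≤ N
  · exact trunc_of_mem hx
  · exact absurd (trunc_of_notMem hx) h

theorem measurableSet_trunc (hf : Measurable f) (N : ℕ) :
    MeasurableSet {x | ‖x‖ ≤ N ∧ ‖f x‖ ≤ N} :=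
  (measurableSet_le measurable_norm measurable_const).inter
    (measurableSet_le hf.norm measurable_const)

theorem isNice_trunc (hf : Measurable f) (N : ℕ) : IsNice (trunc N f) := by
  refine ⟨hf.indicator (measurableSet_trunc hf N), N, N, fun x => ?_⟩
  by_cases hx : ‖x‖ ≤ N ∧ ‖f x‖ ≤ N
  · rw [trunc_of_mem hx]
    exact ⟨hx.2, fun _ => hx.1⟩
  · simp [trunc_of_notMem hx]

theorem enorm_trunc_le (N : ℕ) (f : E n → ℂ) (x : E n) : ‖trunc N f x‖ₑ ≤ ‖f x‖ₑ :=
  enorm_indicator_le_enorm_self _ _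

theorem trunc_eventually_eq (f : E n → ℂ) (x : E n) :
    ∀ᶠ N : ℕ in Filter.atTop, trunc N f x = f x := by
  obtain ⟨N₁, h₁⟩ := exists_nat_ge ‖x‖
  obtain ⟨N₂, h₂⟩ := exists_nat_ge ‖f x‖
  filter_upwards [Filter.eventually_ge_atTop N₁, Filter.eventually_ge_atTop N₂] with N h h'
  exact trunc_of_mem ⟨h₁.trans (by exact_mod_cast h), h₂.trans (by exact_mod_cast h')⟩

/-- Fatou's lemma for mixed Lebesgue norms. -/
theorem mixedLebesgueNorm_le_of_tendsto (hq : ∀ i, 0 < q i) {F : ℕ → E n → ℂ}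
    (hF : ∀ k, Measurable (F k))
    (h : ∀ᵐ x, Filter.Tendsto (fun k => F k x) Filter.atTop (nhds (f x))) {B : ℝ≥0∞}
    (hB : ∀ k, mixedLebesgueNorm q (F k) ≤ B) : mixedLebesgueNorm q f ≤ B := by
  calc mixedLebesgueNorm q f ≤ iteratedNorm n q (fun v =>
        Filter.liminf (fun k => ‖F k (WithLp.toLp 2 v)‖ₑ) Filter.atTop) := by
        refine iteratedNorm_mono_ae (fun i => (hq i).le) ?_
        filter_upwards [(measurePreserving_toLp n).quasiMeasurePreserving.ae h] with v hv
        rw [(hv.enorm).liminf_eq]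
    _ ≤ Filter.liminf (fun k => mixedLebesgueNorm q (F k)) Filter.atTop :=
        iteratedNorm_liminf_le hq fun k => measurable_enorm_toLp (hF k)
    _ ≤ B := Filter.liminf_le_of_frequently_le' (Filter.Frequently.of_forall hB)

theorem mixedLebesgueNorm_le_of_trunc (hq : ∀ i, 0 < q i) (hf : Measurable f) {B : ℝ≥0∞}
    (hB : ∀ N, mixedLebesgueNorm q (trunc N f) ≤ B) : mixedLebesgueNorm q f ≤ B :=
  mixedLebesgueNorm_le_of_tendsto hq (fun N => (isNice_trunc hf N).1)
    (Filter.Eventually.of_forall fun x => tendsto_const_nhds.congr'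
      ((trunc_eventually_eq f x).mono fun _ h => h.symm)) hB

/-- The converse of Hölder's inequality. -/
theorem mixedLebesgueNorm_le_of_forall (hq : ∀ i, (q i).HolderConjugate (q' i)) {w : E n → ℂ}
    (hw : IsNice w) {B : ℝ≥0∞} (hB : ∀ g : E n → ℂ, IsNice g → (∀ x, w x = 0 → g x = 0) →
      ‖∫ x, w x * (starRingEnd ℂ) (g x)‖ₑ ≤ B * mixedLebesgueNorm q g) :
    mixedLebesgueNorm q' w ≤ B := by
  obtain ⟨hwm, M, R, hMR⟩ := id hw
  have hwm' := measurable_enorm_toLp hwm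
  obtain ⟨G, hG, hG1, hG2⟩ := exists_lintegral_mul_eq_iteratedNorm (q := q') (q' := q)
    (fun i => (hq i).symm) hwm' (M := ENNReal.ofReal M) ENNReal.ofReal_ne_top (c := 0) (R := R)
    (fun v => by
      rw [← ofReal_norm]
      exact ENNReal.ofReal_le_ofReal (hMR _).1)
    (fun v hv i => by
      have h1 := (hMR (WithLp.toLp 2 v)).2 (by simpa using hv)
      have h2 := PiLp.norm_apply_le (WithLp.toLp 2 v : E n) i
      simpa using h2.trans h1)
  -- The extremal function `G` need not be bounded, so it is replaced by `min G N` to obtain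
  -- admissible test functions.
  have hlim : ∫⁻ v : Fin n → ℝ, ‖w (WithLp.toLp 2 v)‖ₑ * G v =
      ⨆ N : ℕ, ∫⁻ v : Fin n → ℝ, ‖w (WithLp.toLp 2 v)‖ₑ * min (G v) N := by
    rw [← lintegral_iSup (f := fun (N : ℕ) v => ‖w (WithLp.toLp 2 v)‖ₑ * min (G v) N)
      (fun N => hwm'.mul (hG.min measurable_const))
      (fun a b hab v => mul_le_mul_right (min_le_min le_rfl (by exact_mod_cast hab)) _)]
    refine lintegral_congr fun v => ?_
    rw [← ENNReal.mul_iSup]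
    congr 1
    rw [← inf_iSup_eq, ENNReal.iSup_natCast, inf_top_eq]
  rw [mixedLebesgueNorm, ← hG1, hlim]
  refine iSup_le fun N => ?_
  let t : E n → ℝ := fun x => (min (G (WithLp.ofLp x)) N).toReal
  have htop : ∀ v, min (G v) (N : ℝ≥0∞) ≠ ∞ := fun v =>
    ne_top_of_le_ne_top (ENNReal.natCast_ne_top N) (min_le_right _ _)
  have ht : Measurable t :=
    ((hG.comp (measurable_ofLp_euclidean n)).min measurable_const).ennreal_toReal
  -- The phase of `w` turns `w * conj g` into `‖w‖ * t`. Division by zero gives `0`, so `g` vanishes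
  -- wherever `w` does.
  let g : E n → ℂ := fun x => w x / ‖w x‖ * t x
  have ht0 : ∀ x, 0 ≤ t x := fun x => ENNReal.toReal_nonneg
  have hgt : ∀ x, ‖g x‖ ≤ t x := fun x => by
    simp only [g, norm_mul, norm_div, Complex.norm_real, norm_norm, Real.norm_of_nonneg (ht0 x)]
    exact mul_le_of_le_one_left (ht0 x) (div_self_le_one _)
  have hg0 : ∀ x, w x = 0 → g x = 0 := fun x hx => by simp [g, hx]
  have hgn : IsNice g := by
    refine ⟨(hwm.div (Complex.measurable_ofReal.comp hwm.norm)).mul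
      (Complex.measurable_ofReal.comp ht), N, R, fun x => ⟨(hgt x).trans ?_, fun hx =>
        (hMR x).2 fun h => hx (hg0 x h)⟩⟩
    exact ENNReal.toReal_le_of_le_ofReal (by positivity) (by simp)
  have hprod : ∀ x, w x * (starRingEnd ℂ) (g x) = ((‖w x‖ * t x : ℝ) : ℂ) := fun x => by
    by_cases hx : w x = 0
    · simp [hx]
    · have : (‖w x‖ : ℂ) ≠ 0 := by simpa using hx
      simp only [g, map_mul, map_div₀, Complex.conj_ofReal, Complex.ofReal_mul]
      rw [← mul_assoc, ← mul_div_assoc, Complex.mul_conj']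
      field_simp
  have hint : Integrable fun x => ‖w x‖ * t x := by
    have h1 : Integrable fun x => w x * (starRingEnd ℂ) (g x) :=
      MemLp.integrable_mul (hw.memLp 2) ((hgn.memLp 2).star)
    simp_rw [hprod] at h1
    exact h1.re
  have hG' : mixedLebesgueNorm q g ≤ 1 := by
    refine (iteratedNorm_mono (fun i => (hq i).nonneg) fun v => ?_).trans hG2
    rw [← ofReal_norm]
    refine (ENNReal.ofReal_le_ofReal (hgt _)).trans ?_
    simp only [t, ENNReal.ofReal_toReal (htop _)]
    exact min_le_left _ _
  calc ∫⁻ v : Fin n → ℝ, ‖w (WithLp.toLp 2 v)‖ₑ * min (G v) N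
      = ∫⁻ x : E n, ENNReal.ofReal (‖w x‖ * t x) := by
        rw [← lintegral_toLp (F := fun x => ENNReal.ofReal (‖w x‖ * t x)) (by fun_prop)]
        refine lintegral_congr fun v => ?_
        rw [ENNReal.ofReal_mul (norm_nonneg _), ofReal_norm]
        simp only [t, ENNReal.ofReal_toReal (htop _)]
    _ = ‖∫ x, w x * (starRingEnd ℂ) (g x)‖ₑ := by
        simp_rw [hprod]
        rw [integral_complex_ofReal, ← ofReal_integral_eq_lintegral_ofReal hint
          (Filter.Eventually.of_forall fun x => mul_nonneg (norm_nonneg _) (ht0 x)),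
          ← ofReal_norm, Complex.norm_real, Real.norm_of_nonneg
          (integral_nonneg fun x => mul_nonneg (norm_nonneg _) (ht0 x))]
    _ ≤ B * mixedLebesgueNorm q g := hB g hgn hg0
    _ ≤ B * 1 := mul_le_mul_right hG' _
    _ = B := mul_one _

end norms

/-! ### Boundedness on mixed Lebesgue spaces, and duality -/

section bounded

variable {n : ℕ} {q q' : Fin n → ℝ} {T : L2 n →L[ℂ] L2 n}

/-- Boundedness for the mixed norm, on nice functions. -/
def MixedBounded (T : L2 n →L[ℂ] L2 n) (q : Fin n → ℝ) : Prop :=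
  ∃ C : ℝ≥0, ∀ (f : E n → ℂ) (hf : IsNice f),
    mixedLebesgueNorm q (applyNice T hf) ≤ C * mixedLebesgueNorm q f

theorem mixedBounded_two (T : L2 n →L[ℂ] L2 n) : MixedBounded T fun _ => 2 := by
  refine ⟨‖T‖₊, fun f hf => ?_⟩
  rw [mixedLebesgueNorm_const_exponent two_pos (measurable_applyNice T hf),
    mixedLebesgueNorm_const_exponent two_pos hf.1, ENNReal.ofReal_ofNat]
  have h := T.le_opENorm ((hf.memLp 2).toLp f)
  rw [Lp.enorm_def, Lp.enorm_def, eLpNorm_congr_ae ((hf.memLp 2).coeFn_toLp)] at h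
  exact h

/-- The norm of the adjoint's value is recovered by the converse of Hölder's inequality, applied to
its truncations because that converse is available for nice functions only. -/
theorem MixedBounded.adjoint (hq : ∀ i, (q i).HolderConjugate (q' i)) (h : MixedBounded T q) :
    MixedBounded (ContinuousLinearMap.adjoint T) q' := by
  obtain ⟨C, hC⟩ := h
  refine ⟨C, fun f hf => ?_⟩
  set u := applyNice (ContinuousLinearMap.adjoint T) hf with hu
  have hum : Measurable u := measurable_applyNice _ _
  refine mixedLebesgueNorm_le_of_trunc (fun i => (hq i).symm.pos) hum fun N => ?_
  refine mixedLebesgueNorm_le_of_forall hq (isNice_trunc hum N) fun g hg hg0 => ?_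
  -- The test functions vanish where the truncation does, so the truncation can be removed from the
  -- pairing.
  have e : ∀ x, trunc N u x * (starRingEnd ℂ) (g x) = u x * (starRingEnd ℂ) (g x) := fun x => by
    by_cases hx : trunc N u x = 0
    · simp [hg0 x hx]
    · rw [trunc_eq_of_ne_zero hx]
  simp_rw [e]
  rw [hu, inner_applyNice T hf hg]
  calc ‖∫ x, f x * (starRingEnd ℂ) (applyNice T hg x)‖ₑ
      ≤ ∫⁻ x, ‖f x * (starRingEnd ℂ) (applyNice T hg x)‖ₑ := enorm_integral_le_lintegral_enorm _
    _ = ∫⁻ x, ‖f x‖ₑ * ‖applyNice T hg x‖ₑ := by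
        refine lintegral_congr fun x => ?_
        rw [enorm_mul, ← ofReal_norm ((starRingEnd ℂ) _), RCLike.norm_conj, ofReal_norm]
    _ ≤ mixedLebesgueNorm q' f * mixedLebesgueNorm q (applyNice T hg) :=
        lintegral_enorm_mul_le (fun i => (hq i).symm) hf.1 (measurable_applyNice T hg)
    _ ≤ mixedLebesgueNorm q' f * (C * mixedLebesgueNorm q g) := mul_le_mul_right (hC g hg) _
    _ = _ := by ring

theorem mixedBounded_adjoint_iff (hq : ∀ i, (q i).HolderConjugate (q' i)) :
    MixedBounded (ContinuousLinearMap.adjoint T) q' ↔ MixedBounded T q :=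
  ⟨fun h => by simpa using h.adjoint fun i => (hq i).symm, fun h => h.adjoint hq⟩

end bounded


/-! ### Separating the variables into two groups -/

section glue

variable {m j : ℕ}

theorem EuclideanSpace.norm_le_card_mul {n : ℕ} (x : E n) {M : ℝ} (hM : 0 ≤ M)
    (h : ∀ i, |x i| ≤ M) : ‖x‖ ≤ n * M := by
  have h1 : ‖x‖ ^ 2 ≤ (n * M) ^ 2 := by
    rw [EuclideanSpace.norm_sq_eq]
    calc ∑ i, ‖x i‖ ^ 2 ≤ ∑ _i : Fin n, M ^ 2 := by
          gcongr with i
          exact h i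
      _ = n * M ^ 2 := by simp
      _ ≤ (n : ℝ) ^ 2 * M ^ 2 := by
          gcongr
          exact_mod_cast Nat.le_self_pow two_ne_zero n
      _ = (n * M) ^ 2 := by ring
  exact le_of_sq_le_sq h1 (by positivity)

/-- The measurable equivalence `ℝʲ × ℝᵐ ≃ ℝᵐ⁺ʲ`, with values in Euclidean space. -/
noncomputable def glueE (m j : ℕ) : (Fin j → ℝ) × (Fin m → ℝ) ≃ᵐ E (m + j) :=
  (glue m j).trans (MeasurableEquiv.toLp 2 _)

theorem measurePreserving_glueE (m j : ℕ) : MeasurePreserving (glueE m j) volume volume :=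
  (measurePreserving_toLp (m + j)).comp (measurePreserving_glue m j)

theorem glueE_apply_left (z : (Fin j → ℝ) × (Fin m → ℝ)) (i : Fin j) :
    glueE m j z (finCongr (add_comm j m) (Fin.castAdd m i)) = z.1 i :=
  glue_apply_left m j z i

theorem glueE_apply_right (z : (Fin j → ℝ) × (Fin m → ℝ)) (i : Fin m) :
    glueE m j z (finCongr (add_comm j m) (Fin.natAdd j i)) = z.2 i :=
  glue_apply_right m j z i

theorem glueE_sub (z w : (Fin j → ℝ) × (Fin m → ℝ)) :
    glueE m j z - glueE m j w = glueE m j (z - w) := by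
  ext i
  revert i
  rw [forall_fin_glue]
  refine ⟨fun i => ?_, fun i => ?_⟩
  · rw [PiLp.sub_apply, glueE_apply_left, glueE_apply_left, glueE_apply_left]
    rfl
  · rw [PiLp.sub_apply, glueE_apply_right, glueE_apply_right, glueE_apply_right]
    rfl

theorem norm_le_norm_glueE (z : (Fin j → ℝ) × (Fin m → ℝ)) : ‖z‖ ≤ ‖glueE m j z‖ := by
  refine max_le ((pi_norm_le_iff_of_nonneg (norm_nonneg _)).2 fun i => ?_)
    ((pi_norm_le_iff_of_nonneg (norm_nonneg _)).2 fun i => ?_)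
  · rw [← glueE_apply_left z i]
    exact PiLp.norm_apply_le _ _
  · rw [← glueE_apply_right z i]
    exact PiLp.norm_apply_le _ _

theorem norm_glueE_le (z : (Fin j → ℝ) × (Fin m → ℝ)) : ‖glueE m j z‖ ≤ (m + j : ℕ) * ‖z‖ := by
  refine EuclideanSpace.norm_le_card_mul _ (norm_nonneg _) ?_
  rw [forall_fin_glue]
  refine ⟨fun i => ?_, fun i => ?_⟩
  · rw [glueE_apply_left]
    exact (norm_le_pi_norm z.1 i).trans (norm_fst_le z)
  · rw [glueE_apply_right]
    exact (norm_le_pi_norm z.2 i).trans (norm_snd_le z)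

theorem IsNice.comp_glueE {f : E (m + j) → ℂ} (hf : IsNice f) :
    IsNice fun z => f (glueE m j z) := by
  obtain ⟨hm, M, R, h⟩ := hf
  exact ⟨hm.comp (glueE m j).measurable, M, R, fun z =>
    ⟨(h _).1, fun hz => (norm_le_norm_glueE z).trans ((h _).2 hz)⟩⟩

theorem IsNice.comp_glueE_symm {b : (Fin j → ℝ) × (Fin m → ℝ) → ℂ} (hb : IsNice b) :
    IsNice fun x => b ((glueE m j).symm x) := by
  obtain ⟨hm, M, R, h⟩ := hb
  refine ⟨hm.comp (glueE m j).symm.measurable, M, (m + j : ℕ) * R, fun x =>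
    ⟨(h _).1, fun hx => ?_⟩⟩
  have h1 := norm_glueE_le ((glueE m j).symm x)
  rw [MeasurableEquiv.apply_symm_apply] at h1
  exact h1.trans (by have := (h _).2 hx; gcongr)

/-- The operator on `L²(ℝʲ × ℝᵐ)` that corresponds to an operator on `L²(ℝᵐ⁺ʲ)`. -/
noncomputable def conjGlue (T : L2 (m + j) →L[ℂ] L2 (m + j)) :
    Lp ℂ 2 (volume : Measure ((Fin j → ℝ) × (Fin m → ℝ))) →L[ℂ]
      Lp ℂ 2 (volume : Measure ((Fin j → ℝ) × (Fin m → ℝ))) :=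
  (Lp.compMeasurePreservingₗᵢ ℂ (glueE m j) (measurePreserving_glueE m j)).toContinuousLinearMap ∘L
    T ∘L (Lp.compMeasurePreservingₗᵢ ℂ (glueE m j).symm
      (measurePreserving_glueE m j).symm).toContinuousLinearMap

theorem applyNice_conjGlue (T : L2 (m + j) →L[ℂ] L2 (m + j))
    {b : (Fin j → ℝ) × (Fin m → ℝ) → ℂ} (hb : IsNice b) :
    applyNice (conjGlue T) hb =ᵐ[volume] fun z => applyNice T hb.comp_glueE_symm (glueE m j z) :=
  Lp.coeFn_compMeasurePreserving _ (measurePreserving_glueE m j)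

theorem mixedLebesgueNorm_eq_sliceNorm {q : Fin (m + j) → ℝ} {r : ℝ} (hr : 0 < r)
    (hq : ∀ i : Fin m, q (finCongr (add_comm j m) (Fin.natAdd j i)) = r)
    {f : E (m + j) → ℂ} (hf : Measurable f) :
    mixedLebesgueNorm q f = (∫⁻ y : Fin m → ℝ, sliceNorm
      (fun i => q (finCongr (add_comm j m) (Fin.castAdd m i)))
      (fun z => f (glueE m j z)) y ^ r) ^ (1 / r) :=
  iteratedNorm_glue hr hq (measurable_enorm_toLp hf)

theorem sliceNorm_congr_ae {q : Fin j → ℝ} (hq : ∀ i, 0 ≤ q i)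
    {f g : (Fin j → ℝ) × (Fin m → ℝ) → ℂ} (h : f =ᵐ[volume] g) :
    ∀ᵐ y, sliceNorm q f y = sliceNorm q g y := by
  filter_upwards [ae_ae_snd h] with y hy
  refine iteratedNorm_congr_ae hq ?_
  filter_upwards [hy] with x hx
  rw [hx]

/-- Since `b` has mean zero in the second variable for each first coordinate, `k (e z) (e (w.1, c))`
may be subtracted from the kernel. The smoothness condition then compares `w` with `(w.1, c)`, which
differ only in the second group. -/
theorem IsSingularIntegralOperator.hasCancellation {T : L2 (m + j) →L[ℂ] L2 (m + j)}
    {k : E (m + j) → E (m + j) → ℂ} (hT : IsSingularIntegralOperator T k) (hmj : 0 < m + j) :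
    ∃ (ε : ℝ) (K C : ℝ≥0), 0 < ε ∧ HasCancellation (conjGlue T) ε K C := by
  obtain ⟨ε, C₀, hε, hC₀, hsm⟩ := hT.kernel.smooth
  set D : ℝ := ((m + j : ℕ) : ℝ) with hD
  have hD1 : (1 : ℝ) ≤ D := Nat.one_le_cast.2 hmj
  -- The power of `D` comes from comparing the Euclidean norm with the sup norm, and that of `2`
  -- from `ℓ + σ ≤ 2 * σ`.
  set C : ℝ := C₀ * (D ^ ε * 2 ^ (D + ε)) with hC
  have hCpos : 0 < C := by positivity
  -- The points compared are at Euclidean distance at most `(m + j) * ℓ`; the dilation by `2 * (m +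
  -- j)` secures the factor `2` required by the smoothness condition.
  refine ⟨ε, 2 * (m + j : ℕ), C.toNNReal, hε, fun b hb c ℓ hℓ hsupp hmean => ?_⟩
  set f : E (m + j) → ℂ := fun x => b ((glueE m j).symm x) with hf
  have hfn : IsNice f := hb.comp_glueE_symm
  set e := glueE m j with he
  have hsym : ∀ x, e (e.symm x) = x := fun x => e.apply_symm_apply x
  have hbint : Integrable b := memLp_one_iff_integrable.1 (hb.memLp 1)
  have hclosed : IsClosed {x : E (m + j) | ∀ i : Fin m,
      |x (finCongr (add_comm j m) (Fin.natAdd j i)) - c i| ≤ ℓ} := by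
    rw [Set.ofPred_forall]
    refine isClosed_iInter fun i => isClosed_le ?_ continuous_const
    fun_prop
  have hts : ∀ z : (Fin j → ℝ) × (Fin m → ℝ), ℓ < ‖z.2 - c‖ → e z ∉ tsupport f := by
    intro z hz hmem
    have hsub : tsupport f ⊆ {x : E (m + j) | ∀ i : Fin m,
        |x (finCongr (add_comm j m) (Fin.natAdd j i)) - c i| ≤ ℓ} := by
      refine closure_minimal (fun x hx i => ?_) hclosed
      have h1 := hsupp (e.symm x) hx
      have h2 := (pi_norm_le_iff_of_nonneg hℓ.le).1 h1 i
      rwa [Pi.sub_apply, ← glueE_apply_right, ← he, hsym] at h2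
    refine hz.not_ge ((pi_norm_le_iff_of_nonneg hℓ.le).2 fun i => ?_)
    have := hsub hmem i
    rwa [he, glueE_apply_right] at this
  have hrepr := (measurePreserving_glueE m j).quasiMeasurePreserving.ae (hT.repr_nice hfn)
  filter_upwards [hrepr, applyNice_conjGlue T hb] with z hz1 hz2 hz
  have hz : 2 * D * ℓ < ‖z.2 - c‖ := by simpa [hD] using hz
  have hℓz : ℓ < ‖z.2 - c‖ := by nlinarith
  change ‖applyNice (conjGlue T) hb z‖ₑ ≤ _
  rw [hz2, hz1 (hts z hℓz)]
  -- distances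
  have hdist : ∀ w w' : (Fin j → ℝ) × (Fin m → ℝ), ‖w - w'‖ ≤ ‖e w - e w'‖ := fun w w' => by
    rw [he, glueE_sub]
    exact norm_le_norm_glueE _
  have hd1 : ∀ w : (Fin j → ℝ) × (Fin m → ℝ), ‖z.2 - c‖ ≤ ‖e z - e (w.1, c)‖ := fun w =>
    (norm_snd_le (z - (w.1, c))).trans (hdist _ _)
  have hd2 : ∀ w, b w ≠ 0 → ℓ ≤ ‖e z - e w‖ := fun w hw => by
    have h1 : ‖z.2 - w.2‖ ≤ ‖e z - e w‖ := (norm_snd_le (z - w)).trans (hdist _ _)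
    have h2 := hsupp w hw
    have h3 := norm_sub_le_norm_sub_add_norm_sub z.2 w.2 c
    nlinarith
  obtain ⟨M, hM0, hM⟩ := hT.kernel.exists_bound hℓ
  have hne : ∀ {x y : E (m + j)}, ℓ ≤ ‖x - y‖ → x ≠ y := fun h heq => by
    rw [heq, sub_self, norm_zero] at h
    exact h.not_gt hℓ
  have hme : Measurable e := e.measurable
  have hmk := hT.kernel.measurable_offDiag
  have int1 : Integrable fun w => k (e z) (e w) * b w := by
    have e1 : (fun w => k (e z) (e w) * b w) = fun w => offDiag k (e z, e w) * b w := by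
      funext w
      by_cases hw : b w = 0
      · simp [hw]
      · rw [offDiag_of_ne (hne (hd2 w hw))]
    refine (hbint.norm.const_mul M).mono' ?_ (Filter.Eventually.of_forall fun w => ?_)
    · rw [e1]
      exact ((hmk.comp (measurable_const.prodMk hme)).mul hb.1).aestronglyMeasurable
    · rw [norm_mul]
      by_cases hw : b w = 0
      · simp [hw]
      · gcongr
        exact hM _ _ (hd2 w hw)
  have int2 : Integrable fun w => k (e z) (e (w.1, c)) * b w := by
    have e1 : (fun w => k (e z) (e (w.1, c)) * b w) =
        fun w => offDiag k (e z, e (w.1, c)) * b w := by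
      funext w
      rw [offDiag_of_ne (hne (hℓz.le.trans (hd1 w)))]
    refine (hbint.norm.const_mul M).mono' ?_ (Filter.Eventually.of_forall fun w => ?_)
    · rw [e1]
      exact ((hmk.comp (measurable_const.prodMk (hme.comp
        (measurable_fst.prodMk measurable_const)))).mul hb.1).aestronglyMeasurable
    · rw [norm_mul]
      gcongr
      exact hM _ _ (hℓz.le.trans (hd1 w))
  have hzero : ∫ w, k (e z) (e (w.1, c)) * b w = 0 := by
    rw [Measure.volume_eq_prod, integral_prod _ int2]
    refine (integral_congr_ae (Filter.Eventually.of_forall fun x => ?_)).trans (integral_zero _ _)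
    change ∫ y, k (e z) (e (x, c)) * b (x, y) = 0
    rw [integral_const_mul, hmean x, mul_zero]
  have heq : ∫ y, k (e z) y * f y = ∫ w, (k (e z) (e w) - k (e z) (e (w.1, c))) * b w := by
    rw [← (measurePreserving_glueE m j).integral_comp' (f := glueE m j)]
    simp_rw [sub_mul]
    rw [integral_sub int1 int2, hzero, sub_zero]
    refine integral_congr_ae (Filter.Eventually.of_forall fun w => ?_)
    simp only [hf, he, MeasurableEquiv.symm_apply_apply]
  rw [heq]
  refine (enorm_integral_le_lintegral_enorm _).trans ?_
  rw [← lintegral_const_mul' _ _ ENNReal.coe_ne_top]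
  refine lintegral_mono fun w => ?_
  rw [enorm_mul, ← mul_assoc]
  by_cases hw : b w = 0
  · simp [hw]
  gcongr
  have hfr : (Module.finrank ℝ ((Fin j → ℝ) × (Fin m → ℝ)) : ℝ) = D := by
    rw [Module.finrank_prod, Module.finrank_fin_fun, Module.finrank_fin_fun, hD, add_comm]
  rw [bracket, hfr, ENNReal.ofNNReal_toNNReal, ← ENNReal.ofReal_mul hCpos.le, ← ofReal_norm]
  refine ENNReal.ofReal_le_ofReal ?_
  have hxz : ‖e (w.1, c) - e w‖ ≤ D * ℓ := by
    rw [he, glueE_sub]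
    refine (norm_glueE_le _).trans ?_
    gcongr
    have : ((w.1, c) : (Fin j → ℝ) × (Fin m → ℝ)) - w = (0, c - w.2) := by ext <;> simp
    rw [this, Prod.norm_def, norm_zero]
    refine max_le hℓ.le ?_
    rw [norm_sub_rev]
    exact hsupp w hw
  set σ := ‖z - (w.1, c)‖ with hσ
  have hσρ : σ ≤ ‖e (w.1, c) - e z‖ := by
    rw [norm_sub_rev (e (w.1, c))]
    exact hdist _ _
  have hℓσ : ℓ ≤ σ := hℓz.le.trans (norm_snd_le (z - (w.1, c)))
  have h1 := hsm (e (w.1, c)) (e z) (e w) (hne (hℓz.le.trans (hd1 w))).symm (by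
    have := hd1 w
    rw [norm_sub_rev (e z)] at this
    linarith)
  have hσ0 : 0 < σ := hℓ.trans_le hℓσ
  calc ‖k (e z) (e w) - k (e z) (e (w.1, c))‖
      ≤ C₀ * (‖e (w.1, c) - e w‖ ^ ε / ‖e (w.1, c) - e z‖ ^ (D + ε)) := by
        rw [norm_sub_rev]
        exact (le_add_of_nonneg_left (norm_nonneg _)).trans h1
    _ ≤ C₀ * ((D * ℓ) ^ ε / ((ℓ + σ) / 2) ^ (D + ε)) := by
        gcongr
        linarith
    _ = C * (ℓ ^ ε * (ℓ + σ) ^ (-(D + ε))) := by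
        rw [Real.mul_rpow (by positivity) hℓ.le, Real.div_rpow (by positivity) two_pos.le,
          Real.rpow_neg (by positivity), hC]
        field_simp

/-- This carries the result on products over to Euclidean space: since the last exponents are all
equal, the mixed norm is an `L^r` norm of slice norms. -/
theorem MixedBounded.of_lt {T : L2 (m + j) →L[ℂ] L2 (m + j)} {k : E (m + j) → E (m + j) → ℂ}
    (hT : IsSingularIntegralOperator T k) (hm : 0 < m) {q q' : Fin (m + j) → ℝ}
    (hq : ∀ i, 1 ≤ q i) {r s : ℝ} (hs : 1 < s) (hsr : s < r)
    (hqr : ∀ i : Fin m, q (finCongr (add_comm j m) (Fin.natAdd j i)) = r)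
    (hqs : ∀ i : Fin m, q' (finCongr (add_comm j m) (Fin.natAdd j i)) = s)
    (hqq : ∀ i : Fin j, q' (finCongr (add_comm j m) (Fin.castAdd m i)) =
      q (finCongr (add_comm j m) (Fin.castAdd m i)))
    (h : MixedBounded T q) : MixedBounded T q' := by
  obtain ⟨ε, K, C, hε, hcan⟩ := hT.hasCancellation (by omega)
  obtain ⟨D, hD⟩ := h
  have hr : 0 < r := by linarith
  have hs0 : 0 < s := by linarith
  set q₀ : Fin j → ℝ := fun i => q (finCongr (add_comm j m) (Fin.castAdd m i)) with hq₀
  have hq₀' : (fun i => q' (finCongr (add_comm j m) (Fin.castAdd m i))) = q₀ := funext hqq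
  have hq₀1 : ∀ i, 1 ≤ q₀ i := fun i => hq _
  have hstep : ∀ (g : (Fin j → ℝ) × (Fin m → ℝ) → ℂ) (hg : IsNice g),
      ∫⁻ y, sliceNorm q₀ (applyNice (conjGlue T) hg) y ^ r ≤
        (D ^ r : ℝ≥0) * ∫⁻ y, sliceNorm q₀ g y ^ r := by
    intro g hg
    have h1 := hD _ hg.comp_glueE_symm
    rw [mixedLebesgueNorm_eq_sliceNorm hr hqr (measurable_applyNice T _),
      mixedLebesgueNorm_eq_sliceNorm hr hqr hg.comp_glueE_symm.1] at h1
    have h2 := ENNReal.rpow_le_rpow h1 hr.le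
    rw [ENNReal.mul_rpow_of_nonneg _ _ hr.le, ← ENNReal.rpow_mul, ← ENNReal.rpow_mul,
      one_div, inv_mul_cancel₀ hr.ne', ENNReal.rpow_one, ENNReal.rpow_one] at h2
    simp only [MeasurableEquiv.symm_apply_apply] at h2
    rw [ENNReal.coe_rpow_of_nonneg _ hr.le]
    refine le_trans (le_of_eq (lintegral_congr_ae ?_)) h2
    filter_upwards [sliceNorm_congr_ae (fun i => zero_le_one.trans (hq₀1 i))
      (applyNice_conjGlue T hg)] with y hy
    rw [hy]
  obtain ⟨D', hD'⟩ := exists_lintegral_sliceNorm_applyNice_le hm hq₀1 hε hcan hs hsr hstep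
  refine ⟨D' ^ (1 / s), fun f hf => ?_⟩
  have h1 := hD' _ (hf.comp_glueE (m := m) (j := j))
  rw [mixedLebesgueNorm_eq_sliceNorm hs0 hqs (measurable_applyNice T _),
    mixedLebesgueNorm_eq_sliceNorm hs0 hqs hf.1, hq₀',
    ENNReal.coe_rpow_of_nonneg _ (by positivity), ← ENNReal.mul_rpow_of_nonneg _ _ (by positivity)]
  refine ENNReal.rpow_le_rpow (le_trans (le_of_eq (lintegral_congr_ae ?_)) h1) (by positivity)
  filter_upwards [sliceNorm_congr_ae (fun i => zero_le_one.trans (hq₀1 i))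
    (applyNice_conjGlue T hf.comp_glueE)] with y hy
  rw [hy]
  congr 2
  funext z
  exact congrFun (applyNice_congr T hf hf.comp_glueE.comp_glueE_symm
    (Filter.Eventually.of_forall fun x => by simp)) _

/-- The exponents in the last group of variables can be changed. -/
theorem MixedBounded.change {T : L2 (m + j) →L[ℂ] L2 (m + j)} {k : E (m + j) → E (m + j) → ℂ}
    (hT : IsSingularIntegralOperator T k) (hm : 0 < m) {q q' : Fin (m + j) → ℝ}
    (hq : ∀ i, 1 < q i) {r s : ℝ} (hr : 1 < r) (hs : 1 < s)
    (hqr : ∀ i : Fin m, q (finCongr (add_comm j m) (Fin.natAdd j i)) = r)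
    (hqs : ∀ i : Fin m, q' (finCongr (add_comm j m) (Fin.natAdd j i)) = s)
    (hqq : ∀ i : Fin j, q' (finCongr (add_comm j m) (Fin.castAdd m i)) =
      q (finCongr (add_comm j m) (Fin.castAdd m i)))
    (h : MixedBounded T q) : MixedBounded T q' := by
  rcases lt_trichotomy s r with hlt | heq | hlt
  · exact MixedBounded.of_lt hT hm (fun i => (hq i).le) hs hlt hqr hqs hqq h
  · have : q' = q := by
      funext i
      revert i
      rw [forall_fin_glue]
      exact ⟨hqq, fun i => by rw [hqs, hqr, heq]⟩
    rwa [this]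
  -- Conjugation reverses the order of the exponents, so raising an exponent for `T` amounts to
  -- lowering one for the adjoint, with the adjoint kernel.
  · have hq' : ∀ i, 1 < q' i := by
      rw [forall_fin_glue]
      exact ⟨fun i => by rw [hqq]; exact hq _, fun i => by rwa [hqs]⟩
    have c : ∀ i, (q i).HolderConjugate (q i).conjExponent := fun i =>
      Real.HolderConjugate.conjExponent (hq i)
    have c' : ∀ i, (q' i).HolderConjugate (q' i).conjExponent := fun i =>
      Real.HolderConjugate.conjExponent (hq' i)
    refine (mixedBounded_adjoint_iff c').1 ?_
    refine MixedBounded.of_lt hT.adjoint hm (q := fun i => (q i).conjExponent)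
      (fun i => (c i).symm.lt.le) (r := r.conjExponent) (s := s.conjExponent)
      (Real.HolderConjugate.conjExponent hs).symm.lt ?_ (fun i => by rw [hqr])
      (fun i => by rw [hqs]) (fun i => by rw [hqq]) (h.adjoint c)
    rw [Real.conjExponent, Real.conjExponent, div_lt_div_iff₀ (by linarith) (by linarith)]
    nlinarith

end glue

/-- Induction on the number `j` of coordinates that already carry their final exponent; all the
others share a common exponent `s`. Keeping `s` arbitrary lets the next coordinate be settled by a
choice of `s`. -/
theorem mixedBounded {n : ℕ} {T : L2 n →L[ℂ] L2 n} {k : E n → E n → ℂ}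
    (hT : IsSingularIntegralOperator T k) {q : Fin n → ℝ} (hq : ∀ i, 1 < q i) :
    MixedBounded T q := by
  have key : ∀ j, j ≤ n → ∀ s : ℝ, 1 < s →
      MixedBounded T (fun i : Fin n => if i.val < j then q i else s) := by
    intro j
    induction j with
    | zero =>
      intro _ s hs
      rcases Nat.eq_zero_or_pos n with rfl | hn
      · have : (fun i : Fin 0 => if i.val < 0 then q i else s) = fun _ => 2 :=
          funext fun i => i.elim0
        rw [this]
        exact mixedBounded_two T
      · exact MixedBounded.change (m := n) (j := 0) hT hn (q := fun _ => 2) (fun _ => one_lt_two)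
          (r := 2) one_lt_two hs (fun i => rfl) (fun i => by simp) (fun i => i.elim0)
          (mixedBounded_two T)
    | succ j ih =>
      intro hj s hs
      rcases hj.eq_or_lt with h | h
      -- Here the common block consists of the last coordinate alone, and `s = q j` is already the
      -- required exponent.
      · have h1 := ih (by omega) (q ⟨j, by omega⟩) (hq _)
        convert h1 using 2 with i
        have := i.2
        split_ifs with h2 h3 h3
        · rfl
        · congr 1
          ext
          simp
          omega
        · omega
        · omega
      · obtain ⟨m, rfl⟩ : ∃ m, n = m + (j + 1) := ⟨n - (j + 1), by omega⟩
        -- Start from the common exponent `q j`, which is correct at position `j`, and change it to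
        -- `s` in the `m` positions after it.
        refine MixedBounded.change (m := m) (j := j + 1) hT (by omega)
          (q := fun i => if i.val < j then q i else q ⟨j, by omega⟩) (fun i => ?_)
          (r := q ⟨j, by omega⟩) (hq _) hs (fun i => ?_) (fun i => ?_) (fun i => ?_)
          (ih (by omega) _ (hq _))
        · split_ifs <;> exact hq _
        · rw [if_neg]
          simp
          omega
        · rw [if_neg]
          simp
          omega
        · rw [if_pos (by simp; omega)]
          split_ifs with h3
          · rfl
          · congr 1
            ext
            simp at h3 ⊢
            omega
  have h := key n le_rfl 2 one_lt_two
  convert h using 2 with i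
  rw [if_pos i.2]


/-! ### The extension of an operator from `L²` by continuity -/

section extension

variable {n : ℕ} {T : L2 n →L[ℂ] L2 n} {h h' u u' : E n → ℂ} {s : ℝ≥0∞}

/-- `u = Th`, in the sense of the extension of `T` by continuity from `L² ∩ L^s` to `L^s`. -/
def IsLpValueAt (T : L2 n →L[ℂ] L2 n) (s : ℝ≥0∞) (h u : E n → ℂ) : Prop :=
  MemLp h s volume ∧ MemLp u s volume ∧ ∀ ε : ℝ≥0∞, 0 < ε → ∃ φ : L2 n,
    eLpNorm (fun x => φ x - h x) s volume < ε ∧ eLpNorm (fun x => T φ x - u x) s volume < ε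

theorem IsLpValueAt.isLpValue (hu : IsLpValueAt T s h u) (hs : 1 < s) (hst : s < ∞) :
    IsLpValue T h u :=
  ⟨s, hs, hst, hu⟩

theorem IsLpValueAt.congr (hu : IsLpValueAt T s h u) (hh : h =ᵐ[volume] h')
    (huu : u =ᵐ[volume] u') : IsLpValueAt T s h' u' := by
  obtain ⟨h1, h2, h3⟩ := hu
  refine ⟨h1.ae_eq hh, h2.ae_eq huu, fun ε hε => ?_⟩
  obtain ⟨φ, hφ1, hφ2⟩ := h3 ε hε
  refine ⟨φ, lt_of_eq_of_lt (eLpNorm_congr_ae ?_) hφ1, lt_of_eq_of_lt (eLpNorm_congr_ae ?_) hφ2⟩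
  · filter_upwards [hh] with x hx
    rw [hx]
  · filter_upwards [huu] with x hx
    rw [hx]

theorem IsLpValueAt.add (hs : 1 ≤ s) (hu : IsLpValueAt T s h u) (hu' : IsLpValueAt T s h' u') :
    IsLpValueAt T s (fun x => h x + h' x) fun x => u x + u' x := by
  obtain ⟨h1, h2, h3⟩ := hu
  obtain ⟨h1', h2', h3'⟩ := hu'
  refine ⟨h1.add h1', h2.add h2', fun ε hε => ?_⟩
  obtain ⟨φ, a1, a2⟩ := h3 (ε / 2) (ENNReal.half_pos hε.ne')
  obtain ⟨φ', a1', a2'⟩ := h3' (ε / 2) (ENNReal.half_pos hε.ne')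
  refine ⟨φ + φ', ?_, ?_⟩
  · calc eLpNorm (fun x => (φ + φ' : L2 n) x - (h x + h' x)) s volume
        = eLpNorm ((fun x => φ x - h x) + fun x => φ' x - h' x) s volume := by
          refine eLpNorm_congr_ae ?_
          filter_upwards [Lp.coeFn_add φ φ'] with x hx
          rw [hx, Pi.add_apply, Pi.add_apply]
          ring
      _ ≤ _ := eLpNorm_add_le ((Lp.aestronglyMeasurable φ).sub h1.1)
          ((Lp.aestronglyMeasurable φ').sub h1'.1) hs
      _ < ε / 2 + ε / 2 := ENNReal.add_lt_add a1 a1'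
      _ = ε := ENNReal.add_halves ε
  · calc eLpNorm (fun x => T (φ + φ') x - (u x + u' x)) s volume
        = eLpNorm ((fun x => T φ x - u x) + fun x => T φ' x - u' x) s volume := by
          refine eLpNorm_congr_ae ?_
          rw [map_add]
          filter_upwards [Lp.coeFn_add (T φ) (T φ')] with x hx
          rw [hx, Pi.add_apply, Pi.add_apply]
          ring
      _ ≤ _ := eLpNorm_add_le ((Lp.aestronglyMeasurable (T φ)).sub h2.1)
          ((Lp.aestronglyMeasurable (T φ')).sub h2'.1) hs
      _ < ε / 2 + ε / 2 := ENNReal.add_lt_add a2 a2'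
      _ = ε := ENNReal.add_halves ε

theorem IsLpValueAt.const_mul (hu : IsLpValueAt T s h u) (a : ℂ) :
    IsLpValueAt T s (fun x => a * h x) fun x => a * u x := by
  obtain ⟨h1, h2, h3⟩ := hu
  refine ⟨h1.const_mul a, h2.const_mul a, fun ε hε => ?_⟩
  obtain ⟨δ, hδ, hδε⟩ : ∃ δ : ℝ≥0∞, 0 < δ ∧ ∀ x : ℝ≥0∞, x < δ → ‖a‖ₑ * x < ε := by
    rcases eq_or_ne a 0 with rfl | ha
    · exact ⟨1, one_pos, fun x _ => by simpa using hε⟩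
    · have ha0 : ‖a‖ₑ ≠ 0 := by simpa using ha
      refine ⟨ε / ‖a‖ₑ, ENNReal.div_pos hε.ne' enorm_ne_top, fun x hx => ?_⟩
      rw [mul_comm]
      exact ENNReal.mul_lt_of_lt_div hx
  obtain ⟨φ, a1, a2⟩ := h3 δ hδ
  refine ⟨a • φ, ?_, ?_⟩
  · calc eLpNorm (fun x => (a • φ : L2 n) x - a * h x) s volume
        = eLpNorm (a • fun x => φ x - h x) s volume := by
          refine eLpNorm_congr_ae ?_
          filter_upwards [Lp.coeFn_smul a φ] with x hx
          rw [hx, Pi.smul_apply, Pi.smul_apply, smul_eq_mul, smul_eq_mul]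
          ring
      _ = ‖a‖ₑ * eLpNorm (fun x => φ x - h x) s volume := eLpNorm_const_smul _ _ _ _
      _ < ε := hδε _ a1
  · calc eLpNorm (fun x => T (a • φ) x - a * u x) s volume
        = eLpNorm (a • fun x => T φ x - u x) s volume := by
          refine eLpNorm_congr_ae ?_
          rw [map_smul]
          filter_upwards [Lp.coeFn_smul a (T φ)] with x hx
          rw [hx, Pi.smul_apply, Pi.smul_apply, smul_eq_mul, smul_eq_mul]
          ring
      _ = ‖a‖ₑ * eLpNorm (fun x => T φ x - u x) s volume := eLpNorm_const_smul _ _ _ _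
      _ < ε := hδε _ a2

theorem isLpValueAt_two (φ : L2 n) : IsLpValueAt T 2 φ (T φ) :=
  ⟨Lp.memLp φ, Lp.memLp (T φ), fun ε hε => ⟨φ, by simpa using hε, by simpa using hε⟩⟩

theorem tendsto_eLpNorm_trunc_sub (hs : s ≠ 0) (hst : s ≠ ∞) (hm : Measurable h)
    (hh : MemLp h s volume) :
    Filter.Tendsto (fun N => eLpNorm (fun x => trunc N h x - h x) s volume) Filter.atTop
      (nhds 0) := by
  have hs0 : 0 < s.toReal := ENNReal.toReal_pos hs hst
  simp_rw [eLpNorm_eq_lintegral_rpow_enorm_toReal hs hst]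
  have key : Filter.Tendsto (fun N => ∫⁻ x, ‖trunc N h x - h x‖ₑ ^ s.toReal) Filter.atTop
      (nhds (∫⁻ _x : E n, 0)) := by
    refine tendsto_lintegral_of_dominated_convergence (fun x => ‖h x‖ₑ ^ s.toReal)
      (fun N => (((isNice_trunc hm N).1.sub hm).enorm.pow_const _))
      (fun N => Filter.Eventually.of_forall fun x => ?_) ?_
      (Filter.Eventually.of_forall fun x => ?_)
    · refine ENNReal.rpow_le_rpow ?_ hs0.le
      by_cases hx : trunc N h x = 0
      · simp [hx]
      · simp [trunc_eq_of_ne_zero hx]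
    · exact (lintegral_rpow_enorm_lt_top_of_eLpNorm_lt_top hs hst hh.2).ne
    · refine tendsto_const_nhds.congr' ?_
      filter_upwards [trunc_eventually_eq h x] with N hN
      simp [hN, hs0]
  rw [lintegral_zero] at key
  have := key.ennrpow_const (1 / s.toReal)
  rwa [ENNReal.zero_rpow_of_pos (by positivity)] at this

/-- The approximating sequence, the images of the truncations of `h`, does not depend on `s`.
Convergence in measure thus compares values obtained from different exponents. -/
theorem IsLpValueAt.tendstoInMeasure {C : ℝ≥0}
    (hC : ∀ φ : L2 n, eLpNorm (T φ) s volume ≤ C * eLpNorm φ s volume) (hs : 1 ≤ s) (hst : s ≠ ∞)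
    (hm : Measurable h) (hu : IsLpValueAt T s h u) :
    TendstoInMeasure volume (fun N => applyNice T (isNice_trunc hm N)) Filter.atTop u := by
  obtain ⟨h1, h2, h3⟩ := hu
  have hs0 : s ≠ 0 := (one_pos.trans_le hs).ne'
  refine tendstoInMeasure_of_tendsto_eLpNorm hs0
    (fun N => (measurable_applyNice T _).aestronglyMeasurable) h2.1 ?_
  rw [ENNReal.tendsto_nhds_zero]
  intro ε hε
  set δ : ℝ≥0∞ := ε / (2 * C + 1) with hδ
  have hδ0 : 0 < δ := ENNReal.div_pos hε.ne' (by finiteness)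
  obtain ⟨φ, a1, a2⟩ := h3 δ hδ0
  filter_upwards [(tendsto_eLpNorm_trunc_sub hs0 hst hm h1).eventually_lt_const hδ0] with N hN
  set f := ((isNice_trunc hm N).memLp 2 (μ := volume)).toLp (trunc N h) with hf
  have hfe := ((isNice_trunc hm N).memLp 2 (μ := volume)).coeFn_toLp
  have b1 : eLpNorm (f - φ : L2 n) s volume ≤ 2 * δ := by
    calc eLpNorm (f - φ : L2 n) s volume
        = eLpNorm ((fun x => trunc N h x - h x) - fun x => φ x - h x) s volume := by
          refine eLpNorm_congr_ae ?_
          filter_upwards [Lp.coeFn_sub f φ, hfe] with x hx hx'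
          rw [hx, Pi.sub_apply, Pi.sub_apply, hx']
          ring
      _ ≤ _ := eLpNorm_sub_le (((isNice_trunc hm N).1.sub hm).aestronglyMeasurable)
          ((Lp.aestronglyMeasurable φ).sub h1.1) hs
      _ ≤ δ + δ := add_le_add hN.le a1.le
      _ = 2 * δ := (two_mul δ).symm
  calc eLpNorm (applyNice T (isNice_trunc hm N) - u) s volume
      = eLpNorm ((T (f - φ) : E n → ℂ) + fun x => T φ x - u x) s volume := by
        refine eLpNorm_congr_ae ?_
        rw [map_sub]
        filter_upwards [Lp.coeFn_sub (T f) (T φ)] with x hx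
        rw [Pi.add_apply, hx, Pi.sub_apply, Pi.sub_apply, applyNice]
        ring
    _ ≤ eLpNorm (T (f - φ)) s volume + eLpNorm (fun x => T φ x - u x) s volume :=
        eLpNorm_add_le (Lp.aestronglyMeasurable _) ((Lp.aestronglyMeasurable (T φ)).sub h2.1) hs
    _ ≤ C * (2 * δ) + δ := add_le_add ((hC _).trans (mul_le_mul_right b1 _)) a2.le
    _ = (2 * C + 1) * δ := by ring
    _ = ε := ENNReal.mul_div_cancel (by simp) (by finiteness)

theorem eLpNorm_two_apply_le (T : L2 n →L[ℂ] L2 n) (φ : L2 n) :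
    eLpNorm (T φ) 2 volume ≤ ‖T‖₊ * eLpNorm φ 2 volume := by
  rw [← Lp.enorm_def, ← Lp.enorm_def]
  exact T.le_opENorm φ

/-- A bound for nice functions passes to limits in measure. -/
theorem mixedLebesgueNorm_le_of_tendstoInMeasure {q : Fin n → ℝ} (hq : ∀ i, 0 < q i) {C : ℝ≥0}
    (hC : ∀ (f : E n → ℂ) (hf : IsNice f),
      mixedLebesgueNorm q (applyNice T hf) ≤ C * mixedLebesgueNorm q f) (hm : Measurable h)
    (hu : TendstoInMeasure volume (fun N => applyNice T (isNice_trunc hm N)) Filter.atTop u) :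
    mixedLebesgueNorm q u ≤ C * mixedLebesgueNorm q h := by
  obtain ⟨ns, -, hns⟩ := hu.exists_seq_tendsto_ae
  refine mixedLebesgueNorm_le_of_tendsto hq (fun N => measurable_applyNice T _) hns fun N => ?_
  refine (hC _ (isNice_trunc hm (ns N))).trans (mul_le_mul_right ?_ _)
  exact mixedLebesgueNorm_mono_ae (fun i => (hq i).le)
    (Filter.Eventually.of_forall fun x => enorm_trunc_le _ _ _)

variable {k : E n → E n → ℂ}

/-- This is the case of equal exponents in `mixedBounded`, extended from nice functions to all of
`L²` by convergence of the truncations in `L²` and Fatou's lemma. -/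
theorem IsSingularIntegralOperator.exists_eLpNorm_apply_le (hT : IsSingularIntegralOperator T k)
    (hs : 1 < s) (hst : s ≠ ∞) :
    ∃ C : ℝ≥0, ∀ φ : L2 n, eLpNorm (T φ) s volume ≤ C * eLpNorm φ s volume := by
  have hs1 : 1 < s.toReal := by
    rw [← ENNReal.toReal_one]
    exact (ENNReal.toReal_lt_toReal ENNReal.one_ne_top hst).2 hs
  have hs0 : 0 < s.toReal := one_pos.trans hs1
  obtain ⟨C, hC⟩ := mixedBounded hT (q := fun _ => s.toReal) fun _ => hs1
  refine ⟨C, fun φ => ?_⟩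
  have hm : Measurable (φ : E n → ℂ) := (Lp.stronglyMeasurable φ).measurable
  have h1 := mixedLebesgueNorm_le_of_tendstoInMeasure (fun _ => hs0) hC hm
    ((isLpValueAt_two φ).tendstoInMeasure (eLpNorm_two_apply_le T) one_le_two
      ENNReal.ofNat_ne_top hm)
  rwa [mixedLebesgueNorm_const_exponent hs0 (Lp.stronglyMeasurable (T φ)).measurable,
    mixedLebesgueNorm_const_exponent hs0 hm, ENNReal.ofReal_toReal hst] at h1

theorem IsSingularIntegralOperator.tendstoInMeasure (hT : IsSingularIntegralOperator T k)
    (hm : Measurable h) (hu : IsLpValue T h u) :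
    TendstoInMeasure volume (fun N => applyNice T (isNice_trunc hm N)) Filter.atTop u := by
  obtain ⟨s, hs, hst, hu⟩ := hu
  obtain ⟨C, hC⟩ := hT.exists_eLpNorm_apply_le hs hst.ne
  exact IsLpValueAt.tendstoInMeasure hC hs.le hst.ne hm hu

/-- The truncations converge to `h` in `L^s`, so by the `L^s` bound their images form a Cauchy
sequence there. -/
theorem IsSingularIntegralOperator.exists_isLpValueAt (hT : IsSingularIntegralOperator T k)
    (hs : 1 < s) (hst : s ≠ ∞) (hm : Measurable h) (hh : MemLp h s volume) :
    ∃ u : L0 n, IsLpValueAt T s h u := by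
  have : Fact (1 ≤ s) := ⟨hs.le⟩
  have hs0 : s ≠ 0 := (one_pos.trans hs).ne'
  obtain ⟨C, hC⟩ := hT.exists_eLpNorm_apply_le hs hst
  have hfn : ∀ N, IsNice (trunc N h) := fun N => isNice_trunc hm N
  let f : ℕ → L2 n := fun N => ((hfn N).memLp 2).toLp (trunc N h)
  have hfe : ∀ N, f N =ᵐ[volume] trunc N h := fun N => ((hfn N).memLp 2).coeFn_toLp
  let x : ℕ → Lp ℂ s (volume : Measure (E n)) := fun N => ((hfn N).memLp s).toLp (trunc N h)
  have hTf : ∀ N, MemLp (T (f N)) s volume := fun N => by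
    refine ⟨Lp.aestronglyMeasurable _, (hC (f N)).trans_lt ?_⟩
    rw [eLpNorm_congr_ae (hfe N)]
    exact ENNReal.mul_lt_top ENNReal.coe_lt_top ((hfn N).memLp s).2
  let y : ℕ → Lp ℂ s (volume : Measure (E n)) := fun N => (hTf N).toLp _
  have hx : Filter.Tendsto x Filter.atTop (nhds (hh.toLp h)) :=
    (Lp.tendsto_Lp_iff_tendsto_eLpNorm'' _ (fun N => (hfn N).memLp s) _ hh).2
      (tendsto_eLpNorm_trunc_sub hs0 hst hm hh)
  have hxy : ∀ N M, edist (y N) (y M) ≤ C * edist (x N) (x M) := by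
    intro N M
    rw [Lp.edist_toLp_toLp, Lp.edist_toLp_toLp]
    refine le_trans (le_of_eq (eLpNorm_congr_ae ?_)) ((hC (f N - f M)).trans (le_of_eq ?_))
    · rw [map_sub]
      exact (Lp.coeFn_sub _ _).symm
    · congr 1
      refine eLpNorm_congr_ae ?_
      filter_upwards [Lp.coeFn_sub (f N) (f M), hfe N, hfe M] with z h1 h2 h3
      rw [h1, Pi.sub_apply, Pi.sub_apply, h2, h3]
  have hcau : CauchySeq y := by
    have hxc := EMetric.cauchySeq_iff.1 hx.cauchySeq
    refine EMetric.cauchySeq_iff.2 fun ε hε => ?_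
    obtain ⟨N₀, hN₀⟩ := hxc (ε / (C + 1)) (ENNReal.div_pos hε.ne' (by finiteness))
    refine ⟨N₀, fun N hN M hM => (hxy N M).trans_lt ?_⟩
    have h1 := ENNReal.mul_lt_of_lt_div (hN₀ N hN M hM)
    refine lt_of_le_of_lt ?_ h1
    rw [mul_comm]
    exact mul_le_mul_right le_self_add _
  obtain ⟨u, hu⟩ := cauchySeq_tendsto_of_complete hcau
  refine ⟨(u : L0 n), hh, Lp.memLp u, fun ε hε => ?_⟩
  have e1 := (EMetric.tendsto_nhds.1 hx ε hε)
  have e2 := (EMetric.tendsto_nhds.1 hu ε hε)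
  obtain ⟨N, h1, h2⟩ := (e1.and e2).exists
  refine ⟨f N, ?_, ?_⟩
  · rw [Lp.edist_toLp_toLp] at h1
    refine lt_of_eq_of_lt (eLpNorm_congr_ae ?_) h1
    filter_upwards [hfe N] with z hz
    rw [hz, Pi.sub_apply]
  · rw [Lp.edist_def] at h2
    refine lt_of_eq_of_lt (eLpNorm_congr_ae ?_) h2
    filter_upwards [(hTf N).coeFn_toLp] with z hz
    rw [Pi.sub_apply, hz]

theorem IsSingularIntegralOperator.ae_eq_of_isLpValue (hT : IsSingularIntegralOperator T k)
    (hm : Measurable h) (hu : IsLpValue T h u) (hu' : IsLpValue T h u') : u =ᵐ[volume] u' :=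
  tendstoInMeasure_ae_unique (hT.tendstoInMeasure hm hu) (hT.tendstoInMeasure hm hu')

/-- The kernel representation on a cube, for functions that vanish on the double cube. -/
theorem IsSingularIntegralOperator.repr_of_isLpValue (hT : IsSingularIntegralOperator T k)
    (hm : Measurable h) (hu : IsLpValue T h u) {c : E n} {r : ℝ} (hr : 0 < r)
    (h0 : ∀ y ∈ cube c (2 * r), h y = 0)
    (hint : ∀ x ∈ cube c r, Integrable fun y => k x y * h y) :
    ∀ᵐ x, x ∈ cube c r → u x = ∫ y, k x y * h y := by
  obtain ⟨ns, hns, hlim⟩ := (hT.tendstoInMeasure hm hu).exists_seq_tendsto_ae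
  have hrepr : ∀ᵐ x, ∀ N, x ∉ tsupport (trunc N h) →
      applyNice T (isNice_trunc hm N) x = ∫ y, k x y * trunc N h y :=
    ae_all_iff.2 fun N => hT.repr_nice (isNice_trunc hm N)
  filter_upwards [hlim, hrepr] with x hx1 hx2 hxQ
  have hopen : IsOpen {y : E n | ∀ i, |y i - c i| < 2 * r} := by
    rw [Set.ofPred_forall]
    exact isOpen_iInter_of_finite fun i => isOpen_lt (by fun_prop) continuous_const
  -- The closed cube of radius `r` lies in the open cube of radius `2 * r`, which the support of `h`
  -- avoids even after closure.
  have hts : ∀ N, x ∉ tsupport (trunc N h) := fun N hmem => by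
    have hsub : tsupport (trunc N h) ⊆ {y : E n | ∀ i, |y i - c i| < 2 * r}ᶜ := by
      refine closure_minimal (fun y hy hcon => hy ?_) hopen.isClosed_compl
      by_contra hne
      exact hne ((trunc_eq_of_ne_zero hne).trans (h0 y fun i => (hcon i).le))
    refine hsub hmem fun i => (hxQ i).trans_lt (by linarith)
  refine tendsto_nhds_unique hx1 ?_
  simp_rw [fun N => hx2 N (hts N)]
  have e : ∀ N, (fun y => k x y * trunc N h y) =
      {y | ‖y‖ ≤ N ∧ ‖h y‖ ≤ N}.indicator fun y => k x y * h y := by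
    intro N
    funext y
    by_cases hy : ‖y‖ ≤ N ∧ ‖h y‖ ≤ N
    · rw [trunc_of_mem hy, Set.indicator_of_mem (by exact hy)]
    · rw [trunc_of_notMem hy, Set.indicator_of_notMem (by exact hy), mul_zero]
  have hd : Filter.Tendsto (fun N : ℕ => ∫ y, k x y * trunc N h y) Filter.atTop
      (nhds (∫ y, k x y * h y)) := by
    refine tendsto_integral_of_dominated_convergence (fun y => ‖k x y * h y‖) (fun N => ?_)
      (hint x hxQ).norm (fun N => Filter.Eventually.of_forall fun y => ?_)
      (Filter.Eventually.of_forall fun y => ?_)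
    · rw [e N]
      exact (hint x hxQ).1.indicator (measurableSet_trunc hm N)
    · exact (congrFun (e N) y ▸ norm_indicator_le_norm_self _ _)
    · refine tendsto_const_nhds.congr' ?_
      filter_upwards [trunc_eventually_eq h y] with N hN
      rw [hN]
  exact hd.comp hns.tendsto_atTop

end extension


/-! ### Mixed Morrey norms -/

section morrey

variable {n : ℕ} {p : ℝ} {q : Fin n → ℝ} {f g : E n → ℂ}

theorem measurableSet_cube (c : E n) (r : ℝ) : MeasurableSet (cube c r) := by
  have : IsClosed (cube c r) := by
    rw [cube, Set.ofPred_forall]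
    exact isClosed_iInter fun i => isClosed_le (by fun_prop) continuous_const
  exact this.measurableSet

theorem volume_cube (c : E n) (r : ℝ) : volume (cube c r) = ENNReal.ofReal (2 * r) ^ n := by
  rw [← (measurePreserving_toLp n).measure_preimage (measurableSet_cube c r).nullMeasurableSet]
  have : (fun v : Fin n → ℝ => (WithLp.toLp 2 v : E n)) ⁻¹' cube c r =
      Set.Icc (fun i => c i - r) (fun i => c i + r) := by
    ext v
    simp only [cube, Set.mem_preimage, Set.mem_ofPred_eq, Set.mem_Icc, Pi.le_def, abs_le,
      ← forall_and]
    refine forall_congr' fun i => ⟨fun h => ⟨?_, ?_⟩, fun h => ⟨?_, ?_⟩⟩ <;> linarith [h.1, h.2]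
  rw [this, Real.volume_Icc_pi]
  simp only [add_sub_sub_cancel, ← two_mul, Finset.prod_const, Finset.card_univ, Fintype.card_fin]

theorem ofReal_two_mul_ne_zero {r : ℝ} (hr : 0 < r) : ENNReal.ofReal (2 * r) ≠ 0 := by
  simpa using hr

theorem volume_cube_rpow (hn : 1 ≤ n) (c : E n) (r : ℝ) :
    volume (cube c r) ^ (1 / p - (1 / (n : ℝ)) * ∑ j, 1 / q j) =
      ENNReal.ofReal (2 * r) ^ ((n : ℝ) / p - ∑ j, 1 / q j) := by
  have : (n : ℝ) ≠ 0 := by positivity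
  rw [volume_cube, ← ENNReal.rpow_natCast, ← ENNReal.rpow_mul]
  congr 1
  field_simp

theorem mixedMorreyNorm_le (hn : 1 ≤ n) {M : ℝ≥0∞} (h : ∀ (c : E n) (r : ℝ), 0 < r →
    ENNReal.ofReal (2 * r) ^ ((n : ℝ) / p - ∑ j, 1 / q j) *
      mixedLebesgueNorm q ((cube c r).indicator f) ≤ M) : mixedMorreyNorm p q f ≤ M := by
  refine iSup_le fun c => iSup_le fun r => iSup_le fun hr => ?_
  rw [volume_cube_rpow hn]
  exact h c r hr

theorem le_mixedMorreyNorm (hn : 1 ≤ n) (f : E n → ℂ) (c : E n) {r : ℝ} (hr : 0 < r) :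
    ENNReal.ofReal (2 * r) ^ ((n : ℝ) / p - ∑ j, 1 / q j) *
      mixedLebesgueNorm q ((cube c r).indicator f) ≤ mixedMorreyNorm p q f := by
  rw [← volume_cube_rpow hn c]
  exact le_iSup_of_le c (le_iSup_of_le r (le_iSup_of_le hr le_rfl))

theorem mixedLebesgueNorm_cube_le (hn : 1 ≤ n) (f : E n → ℂ) (c : E n) {r : ℝ} (hr : 0 < r) :
    mixedLebesgueNorm q ((cube c r).indicator f) ≤
      ENNReal.ofReal (2 * r) ^ (∑ j, 1 / q j - (n : ℝ) / p) * mixedMorreyNorm p q f := by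
  refine le_trans (le_of_eq ?_) (mul_le_mul_right (le_mixedMorreyNorm hn f c hr) _)
  rw [← mul_assoc, ← ENNReal.rpow_add _ _ (ofReal_two_mul_ne_zero hr) ENNReal.ofReal_ne_top]
  simp

theorem mixedMorreyNorm_congr_ae (hq : ∀ i, 0 ≤ q i) (h : f =ᵐ[volume] g) :
    mixedMorreyNorm p q f = mixedMorreyNorm p q g := by
  unfold mixedMorreyNorm
  refine iSup_congr fun c => iSup_congr fun r => iSup_congr fun _ => congrArg _ ?_
  refine mixedLebesgueNorm_congr_ae hq ?_
  filter_upwards [h] with x hx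
  simp only [Set.indicator, hx]

theorem mixedMorreyNorm_linear_le (hn : 1 ≤ n) (hq : ∀ i, 1 ≤ q i) (hf : Measurable f)
    (hg : Measurable g) (a b : ℂ) :
    mixedMorreyNorm p q (fun x => a * f x + b * g x) ≤
      ‖a‖ₑ * mixedMorreyNorm p q f + ‖b‖ₑ * mixedMorreyNorm p q g := by
  have hq0 : ∀ i, 0 < q i := fun i => zero_lt_one.trans_le (hq i)
  refine mixedMorreyNorm_le hn fun c r hr => ?_
  have hfm := hf.indicator (measurableSet_cube c r)
  have hgm := hg.indicator (measurableSet_cube c r)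
  have e : (cube c r).indicator (fun x => a * f x + b * g x) =
      fun x => a * (cube c r).indicator f x + b * (cube c r).indicator g x := by
    funext x
    by_cases hx : x ∈ cube c r <;> simp [hx]
  rw [e]
  calc _ ≤ ENNReal.ofReal (2 * r) ^ ((n : ℝ) / p - ∑ j, 1 / q j) *
        (‖a‖ₑ * mixedLebesgueNorm q ((cube c r).indicator f) +
          ‖b‖ₑ * mixedLebesgueNorm q ((cube c r).indicator g)) := by
        refine mul_le_mul_right ?_ _
        rw [← mixedLebesgueNorm_const_mul hq0 hfm, ← mixedLebesgueNorm_const_mul hq0 hgm]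
        exact mixedLebesgueNorm_add_le hq (hfm.const_mul a) (hgm.const_mul b)
    _ = ‖a‖ₑ * (ENNReal.ofReal (2 * r) ^ ((n : ℝ) / p - ∑ j, 1 / q j) *
          mixedLebesgueNorm q ((cube c r).indicator f)) +
        ‖b‖ₑ * (ENNReal.ofReal (2 * r) ^ ((n : ℝ) / p - ∑ j, 1 / q j) *
          mixedLebesgueNorm q ((cube c r).indicator g)) := by ring
    _ ≤ _ := add_le_add (mul_le_mul_right (le_mixedMorreyNorm hn f c hr) _)
        (mul_le_mul_right (le_mixedMorreyNorm hn g c hr) _)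

/-- Hölder's inequality on the cube contributes the exponent `n / s - ∑ 1 / q j` and the Morrey
bound `∑ 1 / q j - n / p`; the sums cancel. -/
theorem lintegral_cube_rpow_le (hn : 1 ≤ n) {s : ℝ} (hs : 0 < s) (hq : ∀ i, s ≤ q i)
    (hf : Measurable f) (c : E n) {r : ℝ} (hr : 0 < r) :
    (∫⁻ x in cube c r, ‖f x‖ₑ ^ s) ^ (1 / s) ≤
      ENNReal.ofReal (2 * r) ^ (n * (1 / s) - (n : ℝ) / p) * mixedMorreyNorm p q f := by
  have hfm := hf.indicator (measurableSet_cube c r)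
  have h1 := iteratedNorm_holder hs hq (measurable_enorm_toLp hfm) (c := WithLp.ofLp c) hr
    (fun v hv => by
      by_contra hcon
      exact hv (by rw [Set.indicator_of_notMem (by exact hcon), enorm_zero]))
  have e : ∫⁻ x in cube c r, ‖f x‖ₑ ^ s =
      ∫⁻ v : Fin n → ℝ, ‖(cube c r).indicator f (WithLp.toLp 2 v)‖ₑ ^ s := by
    rw [lintegral_toLp (F := fun x => ‖(cube c r).indicator f x‖ₑ ^ s) (by fun_prop),
      ← lintegral_indicator (measurableSet_cube c r)]
    refine lintegral_congr fun x => ?_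
    by_cases hx : x ∈ cube c r <;> simp [hx, hs]
  rw [e]
  refine h1.trans ((mul_le_mul_right (mixedLebesgueNorm_cube_le (p := p) hn f c hr) _).trans
    (le_of_eq ?_))
  rw [← mul_assoc, ← ENNReal.rpow_add _ _ (ofReal_two_mul_ne_zero hr) ENNReal.ofReal_ne_top]
  congr 2
  rw [Finset.sum_sub_distrib]
  simp

theorem memLp_indicator_cube (hn : 1 ≤ n) {s : ℝ} (hs : 0 < s) (hq : ∀ i, s ≤ q i)
    (hf : Measurable f) (hM : mixedMorreyNorm p q f < ∞) (c : E n) {r : ℝ} (hr : 0 < r) :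
    MemLp ((cube c r).indicator f) (ENNReal.ofReal s) volume := by
  rw [memLp_indicator_iff_restrict (measurableSet_cube c r)]
  refine ⟨hf.aestronglyMeasurable, ?_⟩
  rw [eLpNorm_eq_lintegral_rpow_enorm_toReal (by simpa using hs) ENNReal.ofReal_ne_top,
    ENNReal.toReal_ofReal hs.le]
  refine (lintegral_cube_rpow_le (p := p) hn hs hq hf c hr).trans_lt (ENNReal.mul_lt_top ?_ hM)
  exact (ENNReal.rpow_ne_top_of_ne_zero (ofReal_two_mul_ne_zero hr) ENNReal.ofReal_ne_top).lt_top

/-! ### The contribution of the complement of the double cube -/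

/-- A point off the double cube lies in the annulus just below the least dyadic dilation that
contains it. -/
theorem subset_iUnion_cube_diff (c : E n) {r : ℝ} (hr : 0 < r) :
    (cube c (2 * r))ᶜ ⊆ ⋃ i : ℕ, cube c (2 * (2 * (2 ^ i * r))) \ cube c (2 * (2 ^ i * r)) := by
  classical
  intro y hy
  have hex : ∃ i : ℕ, y ∈ cube c (2 * (2 ^ i * r)) := by
    obtain ⟨i, hi⟩ := pow_unbounded_of_one_lt (‖y - c‖ / r) (one_lt_two (α := ℝ))
    rw [div_lt_iff₀ hr] at hi
    refine ⟨i, fun l => ?_⟩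
    have h1 : |y l - c l| ≤ ‖y - c‖ := PiLp.norm_apply_le (y - c) l
    have : 0 < 2 ^ i * r := by positivity
    linarith
  rcases hf : Nat.find hex with _ | i
  · have := Nat.find_spec hex
    rw [hf, pow_zero, one_mul] at this
    exact absurd this hy
  · refine Set.mem_iUnion.2 ⟨i, ?_, ?_⟩
    · have := Nat.find_spec hex
      rwa [hf, pow_succ', mul_assoc] at this
    · exact Nat.find_min hex (by omega)

variable {k : E n → E n → ℂ}

theorem le_norm_sub_of_notMem_cube {c x y : E n} {r a : ℝ} (hra : r ≤ a) (hx : x ∈ cube c r)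
    (hy : y ∉ cube c (2 * a)) : a ≤ ‖x - y‖ := by
  simp only [cube, Set.mem_ofPred_eq, not_forall, not_le] at hy
  obtain ⟨l, hl⟩ := hy
  have h1 : |x l - y l| ≤ ‖x - y‖ := PiLp.norm_apply_le (x - y) l
  have h2 := hx l
  have h3 := abs_sub_le (y l) (x l) (c l)
  rw [abs_sub_comm (y l) (x l)] at h3
  linarith

/-- On the annulus at scale `a = 2 ^ i * r` the kernel is at most `C₀ / a ^ n`, while the integral
of `‖f‖` over the cube of side `8 * a` is at most a multiple of `a ^ (n - n / p)`. The product
decays geometrically in `i` because `n / p > 0`. -/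
theorem IsStandardKernel.exists_lintegral_tail_le (hk : IsStandardKernel k) (hn : 1 ≤ n)
    (hp : 1 < p) (hq : ∀ i, 1 ≤ q i) :
    ∃ C : ℝ≥0, ∀ f : E n → ℂ, Measurable f → ∀ (c : E n) (r : ℝ), 0 < r → ∀ x ∈ cube c r,
      ∫⁻ y in (cube c (2 * r))ᶜ, ‖k x y * f y‖ₑ ≤
        C * (ENNReal.ofReal (2 * r) ^ (-((n : ℝ) / p)) * mixedMorreyNorm p q f) := by
  obtain ⟨C₀, hC₀, hsize⟩ := hk.size
  have hn0 : (0 : ℝ) < n := by exact_mod_cast hn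
  have hnp : 0 < (n : ℝ) / p := by positivity
  -- This is the ratio of the geometric series: each doubling of the scale gains `2 ^ (-(n / p))`.
  set θ : ℝ := 2 ^ (-((n : ℝ) / p)) with hθ
  have hθ0 : 0 < θ := by positivity
  have hθ1 : θ < 1 := Real.rpow_lt_one_of_one_lt_of_neg one_lt_two (by linarith)
  refine ⟨(C₀ * 8 ^ n / (1 - θ)).toNNReal, fun f hf c r hr x hx => ?_⟩
  set M := mixedMorreyNorm p q f with hM
  set B : ℝ := C₀ * 8 ^ n * (2 * r) ^ (-((n : ℝ) / p)) with hB
  have hB0 : 0 ≤ B := by positivity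
  have hterm : ∀ i : ℕ, ∫⁻ y in cube c (2 * (2 * (2 ^ i * r))) \ cube c (2 * (2 ^ i * r)),
      ‖k x y * f y‖ₑ ≤ ENNReal.ofReal (B * θ ^ i) * M := by
    intro i
    set a : ℝ := 2 ^ i * r with ha
    have ha0 : 0 < a := by positivity
    have hra : r ≤ a := le_mul_of_one_le_left hr.le (one_le_pow₀ one_le_two)
    have hint := lintegral_cube_rpow_le (p := p) hn one_pos hq hf c (r := 2 * (2 * a))
      (by positivity)
    simp only [ENNReal.rpow_one, one_div, inv_one, mul_one] at hint
    calc ∫⁻ y in cube c (2 * (2 * a)) \ cube c (2 * a), ‖k x y * f y‖ₑ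
        ≤ ∫⁻ y in cube c (2 * (2 * a)) \ cube c (2 * a), ENNReal.ofReal (C₀ / a ^ n) * ‖f y‖ₑ := by
          refine setLIntegral_mono' ((measurableSet_cube _ _).diff (measurableSet_cube _ _))
            fun y hy => ?_
          have hd := le_norm_sub_of_notMem_cube hra hx hy.2
          rw [enorm_mul]
          gcongr
          rw [← ofReal_norm]
          refine ENNReal.ofReal_le_ofReal ((hsize x y ?_).trans ?_)
          · rintro rfl
            rw [sub_self, norm_zero] at hd
            exact hd.not_gt ha0
          · gcongr
      _ ≤ ∫⁻ y in cube c (2 * (2 * a)), ENNReal.ofReal (C₀ / a ^ n) * ‖f y‖ₑ :=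
          lintegral_mono_set Set.sdiff_subset
      _ = ENNReal.ofReal (C₀ / a ^ n) * ∫⁻ y in cube c (2 * (2 * a)), ‖f y‖ₑ :=
          lintegral_const_mul' _ _ ENNReal.ofReal_ne_top
      _ ≤ ENNReal.ofReal (C₀ / a ^ n) *
          (ENNReal.ofReal (2 * (2 * (2 * a))) ^ ((n : ℝ) - n / p) * M) := mul_le_mul_right hint _
      _ = ENNReal.ofReal (C₀ / a ^ n * (2 * (2 * (2 * a))) ^ ((n : ℝ) - n / p)) * M := by
          rw [← mul_assoc, ENNReal.ofReal_rpow_of_pos (by positivity),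
            ← ENNReal.ofReal_mul (by positivity)]
      _ ≤ ENNReal.ofReal (B * θ ^ i) * M := by
          refine mul_le_mul_left (ENNReal.ofReal_le_ofReal ?_) _
          -- The factor `a ^ n` cancels the kernel bound, and `8 ^ n` remains in the constant.
          have e1 : (2 * (2 * (2 * a))) ^ ((n : ℝ) - n / p) =
              8 ^ n * a ^ n * (2 * (2 * (2 * a))) ^ (-((n : ℝ) / p)) := by
            rw [sub_eq_add_neg, Real.rpow_add (by positivity), Real.rpow_natCast, ← mul_pow]
            ring
          have e2 : θ ^ i = (2 ^ i) ^ (-((n : ℝ) / p)) := by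
            rw [hθ, ← Real.rpow_natCast, ← Real.rpow_mul two_pos.le, mul_comm,
              Real.rpow_mul two_pos.le, Real.rpow_natCast]
          rw [e1, hB, e2]
          calc C₀ / a ^ n * (8 ^ n * a ^ n * (2 * (2 * (2 * a))) ^ (-((n : ℝ) / p)))
              = C₀ * 8 ^ n * (2 * (2 * (2 * a))) ^ (-((n : ℝ) / p)) := by field_simp
            _ ≤ C₀ * 8 ^ n * (2 * r * 2 ^ i) ^ (-((n : ℝ) / p)) := by
                refine mul_le_mul_of_nonneg_left ?_ (by positivity)
                refine Real.rpow_le_rpow_of_nonpos (by positivity) ?_ (by linarith)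
                rw [ha]
                nlinarith
            _ = _ := by
                rw [Real.mul_rpow (by positivity) (by positivity)]
                ring
  calc ∫⁻ y in (cube c (2 * r))ᶜ, ‖k x y * f y‖ₑ
      ≤ ∫⁻ y in ⋃ i : ℕ, cube c (2 * (2 * (2 ^ i * r))) \ cube c (2 * (2 ^ i * r)),
          ‖k x y * f y‖ₑ := lintegral_mono_set (subset_iUnion_cube_diff c hr)
    _ ≤ ∑' i : ℕ, ∫⁻ y in cube c (2 * (2 * (2 ^ i * r))) \ cube c (2 * (2 ^ i * r)),
          ‖k x y * f y‖ₑ := lintegral_iUnion_le _ _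
    _ ≤ ∑' i : ℕ, ENNReal.ofReal (B * θ ^ i) * M := ENNReal.tsum_le_tsum hterm
    _ = ENNReal.ofReal (B * (1 - θ)⁻¹) * M := by
        rw [ENNReal.tsum_mul_right, ← ENNReal.ofReal_tsum_of_nonneg (fun i => by positivity)
          ((summable_geometric_of_lt_one hθ0.le hθ1).mul_left B), tsum_mul_left,
          tsum_geometric_of_lt_one hθ0.le hθ1]
    _ = _ := by
        have : 0 < 1 - θ := by linarith
        rw [ENNReal.ofNNReal_toNNReal, ENNReal.ofReal_rpow_of_pos (by positivity), ← mul_assoc,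
          ← ENNReal.ofReal_mul (by positivity), hB]
        congr 2
        ring

theorem IsStandardKernel.integrableOn_tail (hk : IsStandardKernel k) (hn : 1 ≤ n)
    (hp : 1 < p) (hq : ∀ i, 1 ≤ q i) (hf : Measurable f) (hM : mixedMorreyNorm p q f < ∞)
    (c : E n) {r : ℝ} (hr : 0 < r) {x : E n} (hx : x ∈ cube c r) :
    IntegrableOn (fun y => k x y * f y) (cube c (2 * r))ᶜ volume := by
  obtain ⟨C, hC⟩ := hk.exists_lintegral_tail_le hn hp hq
  refine ⟨?_, (hC f hf c r hr x hx).trans_lt ?_⟩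
  · have hm : Measurable fun y => offDiag k (x, y) * f y :=
      (hk.measurable_offDiag.comp measurable_prodMk_left).mul hf
    refine hm.aestronglyMeasurable.congr ?_
    filter_upwards [ae_restrict_mem (measurableSet_cube c (2 * r)).compl] with y hy
    rw [offDiag_of_ne]
    rintro rfl
    exact hy fun i => (hx i).trans (by linarith)
  · refine ENNReal.mul_lt_top ENNReal.coe_lt_top (ENNReal.mul_lt_top ?_ hM)
    exact (ENNReal.rpow_ne_top_of_ne_zero (ofReal_two_mul_ne_zero hr)
      ENNReal.ofReal_ne_top).lt_top

end morrey


/-! ### Singular integral operators on mixed Morrey spaces -/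

section main

variable {n : ℕ} {p : ℝ} {q : Fin n → ℝ} {k : E n → E n → ℂ} {T : L2 n →L[ℂ] L2 n}

theorem measurable_L0 (f : L0 n) : Measurable (f : E n → ℂ) := f.stronglyMeasurable.measurable

/-- The version of `IsValue` with a fixed exponent for the local parts. -/
def IsValueAt (T : L2 n →L[ℂ] L2 n) (k : E n → E n → ℂ) (s : ℝ≥0∞) (f g : L0 n) : Prop :=
  ∀ (c : E n) (r : ℝ), 0 < r → ∃ u : L0 n,
    IsLpValueAt T s ((cube c (2 * r)).indicator f) u ∧
    ∀ᵐ x : E n, x ∈ cube c r →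
      IntegrableOn (fun y => k x y * f y) (cube c (2 * r))ᶜ volume ∧
      g x = u x + ∫ y in (cube c (2 * r))ᶜ, k x y * f y

theorem IsValueAt.isValue {s : ℝ≥0∞} (hs : 1 < s) (hst : s < ∞) {f g : L0 n}
    (h : IsValueAt T k s f g) : IsValue T k f g := fun c r hr => by
  obtain ⟨u, hu, h⟩ := h c r hr
  exact ⟨u, hu.isLpValue hs hst, h⟩

/-- A common exponent for the local parts is needed here, since approximations in different `L^s`
cannot simply be added. -/
theorem IsValueAt.linear {s : ℝ≥0∞} (hs : 1 ≤ s) {f₁ f₂ g₁ g₂ : L0 n}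
    (h₁ : IsValueAt T k s f₁ g₁) (h₂ : IsValueAt T k s f₂ g₂) (a b : ℂ) :
    IsValueAt T k s (a • f₁ + b • f₂) (a • g₁ + b • g₂) := by
  intro c r hr
  obtain ⟨u₁, hu₁, h₁⟩ := h₁ c r hr
  obtain ⟨u₂, hu₂, h₂⟩ := h₂ c r hr
  have hlin : ∀ v w : L0 n, (a • v + b • w : L0 n) =ᵐ[volume] fun x => a * v x + b * w x := by
    intro v w
    filter_upwards [AEEqFun.coeFn_add (a • v) (b • w), AEEqFun.coeFn_smul a v,
      AEEqFun.coeFn_smul b w] with x h1 h2 h3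
    rw [h1, Pi.add_apply, h2, h3, Pi.smul_apply, Pi.smul_apply, smul_eq_mul, smul_eq_mul]
  refine ⟨a • u₁ + b • u₂, ((hu₁.const_mul a).add hs (hu₂.const_mul b)).congr ?_
    (hlin u₁ u₂).symm, ?_⟩
  · filter_upwards [hlin f₁ f₂] with x hx
    by_cases hxQ : x ∈ cube c (2 * r) <;> simp [hxQ, hx]
  · filter_upwards [h₁, h₂, hlin u₁ u₂, hlin g₁ g₂] with x hx₁ hx₂ hxu hxg hxQ
    obtain ⟨i₁, e₁⟩ := hx₁ hxQ
    obtain ⟨i₂, e₂⟩ := hx₂ hxQ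
    have e : (fun y => a * (k x y * f₁ y) + b * (k x y * f₂ y)) =ᵐ[volume.restrict
        (cube c (2 * r))ᶜ] fun y => k x y * (a • f₁ + b • f₂ : L0 n) y := by
      filter_upwards [ae_restrict_of_ae (hlin f₁ f₂)] with y hy
      rw [hy]
      ring
    refine ⟨((i₁.const_mul a).add (i₂.const_mul b)).congr e, ?_⟩
    rw [← integral_congr_ae e, integral_add (i₁.const_mul a) (i₂.const_mul b),
      integral_const_mul, integral_const_mul, hxg, hxu, e₁, e₂]
    ring

/-- The tail integral is the same for both values, and the local parts agree almost everywhere even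
if they use different `L^s`; countably many cubes cover the space. -/
theorem IsSingularIntegralOperator.eq_of_isValue (hT : IsSingularIntegralOperator T k)
    {f g g' : L0 n} (h : IsValue T k f g) (h' : IsValue T k f g') : g = g' := by
  refine AEEqFun.ext ?_
  have key : ∀ R : ℕ, ∀ᵐ x, x ∈ cube (0 : E n) (R + 1) → g x = g' x := by
    intro R
    have hR : (0 : ℝ) < R + 1 := by positivity
    obtain ⟨u, hu, hx⟩ := h 0 _ hR
    obtain ⟨u', hu', hx'⟩ := h' 0 _ hR
    filter_upwards [hx, hx', hT.ae_eq_of_isLpValue ((measurable_L0 f).indicator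
      (measurableSet_cube _ _)) hu hu'] with x h1 h2 h3 hxQ
    rw [(h1 hxQ).2, (h2 hxQ).2, h3]
  filter_upwards [ae_all_iff.2 key] with x hx
  obtain ⟨R, hR⟩ := exists_nat_ge ‖x‖
  refine hx R fun i => ?_
  have h1 : |x i| ≤ ‖x‖ := PiLp.norm_apply_le x i
  simp only [PiLp.zero_apply, sub_zero]
  linarith

/-- The local definitions of the value on two nested cubes agree. -/
theorem IsSingularIntegralOperator.ae_eq_of_nested (hT : IsSingularIntegralOperator T k)
    {s : ℝ≥0∞} (hs : 1 < s) (hst : s < ∞) {f : E n → ℂ} (hf : Measurable f) {c c' : E n} {r r' : ℝ}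
    (hr : 0 < r) (hcc : ∀ i, |c i - c' i| + r ≤ r')
    (hint : ∀ x ∈ cube c r, IntegrableOn (fun y => k x y * f y) (cube c (2 * r))ᶜ volume)
    {u u' : E n → ℂ} (hu : IsLpValueAt T s ((cube c (2 * r)).indicator f) u)
    (hu' : IsLpValueAt T s ((cube c' (2 * r')).indicator f) u') :
    ∀ᵐ x, x ∈ cube c r → u x + ∫ y in (cube c (2 * r))ᶜ, k x y * f y =
      u' x + ∫ y in (cube c' (2 * r'))ᶜ, k x y * f y := by
  have hsub : cube c (2 * r) ⊆ cube c' (2 * r') := fun y hy i => by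
    have h1 := hy i
    have h2 := hcc i
    have h3 := abs_sub_le (y i) (c i) (c' i)
    have h4 := abs_nonneg (c i - c' i)
    linarith
  set D := cube c' (2 * r') \ cube c (2 * r) with hD
  have hDm : MeasurableSet D := (measurableSet_cube _ _).diff (measurableSet_cube _ _)
  -- The difference of the local parts is a value of `T` at `f χ_D`. This function vanishes on the
  -- smaller double cube, so the difference is given by the kernel integral over `D`, exactly the
  -- amount by which the tails differ.
  have hv : IsLpValueAt T s (D.indicator f) fun x => u' x + -1 * u x := by
    refine (hu'.add hs.le (hu.const_mul (-1))).congr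
      (Filter.Eventually.of_forall fun x => ?_) Filter.EventuallyEq.rfl
    by_cases h1 : x ∈ cube c (2 * r)
    · have h2 := hsub h1
      have h3 : x ∉ D := fun h => h.2 h1
      simp [h1, h2, h3]
    · by_cases h2 : x ∈ cube c' (2 * r')
      · have h3 : x ∈ D := ⟨h2, h1⟩
        simp [h1, h2, h3]
      · have h3 : x ∉ D := fun h => h2 h.1
        simp [h1, h2, h3]
  have e : ∀ x, (fun y => k x y * D.indicator f y) = D.indicator fun y => k x y * f y := by
    intro x
    funext y
    by_cases hy : y ∈ D <;> simp [hy]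
  have hDsub : D ⊆ (cube c (2 * r))ᶜ := fun y hy => hy.2
  have hrep := hT.repr_of_isLpValue (hf.indicator hDm) (hv.isLpValue hs hst) hr
    (fun y hy => Set.indicator_of_notMem (fun h => h.2 hy) _) (fun x hx => by
      rw [e, integrable_indicator_iff hDm]
      exact (hint x hx).mono_set hDsub)
  filter_upwards [hrep] with x hx hxQ
  have h1 := hx hxQ
  rw [e, integral_indicator hDm] at h1
  have hunion : (cube c (2 * r))ᶜ = D ∪ (cube c' (2 * r'))ᶜ := by
    ext y
    constructor
    · intro hy
      by_cases h2 : y ∈ cube c' (2 * r')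
      · exact Or.inl ⟨h2, hy⟩
      · exact Or.inr h2
    · rintro (hy | hy)
      · exact hy.2
      · exact fun h => hy (hsub h)
  have hdisj : Disjoint D (cube c' (2 * r'))ᶜ :=
    Set.disjoint_left.2 fun y (hy : y ∈ D) (hy' : y ∉ cube c' (2 * r')) => hy' hy.1
  rw [hunion, setIntegral_union hdisj
    (measurableSet_cube _ _).compl ((hint x hxQ).mono_set hDsub)
    ((hint x hxQ).mono_set (Set.compl_subset_compl.2 hsub)), ← h1]
  ring

/-- The local definitions on the cubes of radius `R + 1` about the origin are eventually constant in
`R` at almost every point, by consistency on nested cubes. Their limit is the value, and comparing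
an arbitrary cube with these large ones proves its defining formula. -/
theorem IsSingularIntegralOperator.exists_isValueAt (hT : IsSingularIntegralOperator T k)
    (hn : 1 ≤ n) (hp : 1 < p) {s : ℝ} (hs : 1 < s) (hq : ∀ i, s ≤ q i) {f : L0 n}
    (hf : f ∈ mixedMorreySpace p q) : ∃ g : L0 n, IsValueAt T k (ENNReal.ofReal s) f g := by
  have hfm := measurable_L0 f
  have hq1 : ∀ i, 1 ≤ q i := fun i => hs.le.trans (hq i)
  have hs' : 1 < ENNReal.ofReal s := by simpa using hs
  have hst : ENNReal.ofReal s < ∞ := ENNReal.ofReal_lt_top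
  have hint : ∀ (c : E n) (r : ℝ), 0 < r → ∀ x ∈ cube c r,
      IntegrableOn (fun y => k x y * f y) (cube c (2 * r))ᶜ volume := fun c r hr x hx =>
    hT.kernel.integrableOn_tail hn hp hq1 hfm hf c hr hx
  have hex : ∀ (c : E n) (r : ℝ), 0 < r → ∃ u : L0 n,
      IsLpValueAt T (ENNReal.ofReal s) ((cube c (2 * r)).indicator f) u := fun c r hr =>
    hT.exists_isLpValueAt hs' hst.ne (hfm.indicator (measurableSet_cube _ _))
      (memLp_indicator_cube hn (one_pos.trans hs) hq hfm hf c (by linarith))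
  have hR : ∀ R : ℕ, (0 : ℝ) < R + 1 := fun R => by positivity
  choose U hU using fun R : ℕ => hex 0 (R + 1) (hR R)
  -- Using `offDiag` makes the tail integral measurable in `x` on the whole space; on the cube
  -- itself it coincides with the integral against `k`.
  let v : ℕ → E n → ℂ := fun R x =>
    U R x + ∫ y in (cube (0 : E n) (2 * (R + 1)))ᶜ, offDiag k (x, y) * f y
  have hvm : ∀ R, Measurable (v R) := by
    intro R
    refine (measurable_L0 (U R)).add ?_
    exact (StronglyMeasurable.integral_prod_right (f := fun x y => offDiag k (x, y) * f y)
      ((hT.kernel.measurable_offDiag.mul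
        (hfm.comp measurable_snd)).stronglyMeasurable)).measurable
  have hv : ∀ (R : ℕ), ∀ x ∈ cube (0 : E n) (R + 1),
      v R x = U R x + ∫ y in (cube (0 : E n) (2 * (R + 1)))ᶜ, k x y * f y := by
    intro R x hx
    simp only [v]
    congr 1
    refine setIntegral_congr_fun (measurableSet_cube _ _).compl fun y hy => ?_
    have hne : x ≠ y := by
      rintro rfl
      exact hy fun i => (hx i).trans (by linarith [hR R])
    simp only [offDiag_of_ne hne]
  have hnest : ∀ (c : E n) (r : ℝ) (hr : 0 < r) (u : E n → ℂ)
      (hu : IsLpValueAt T (ENNReal.ofReal s) ((cube c (2 * r)).indicator f) u),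
      ∃ R₀ : ℕ, ∀ᵐ x, ∀ R ≥ R₀, x ∈ cube c r →
        u x + ∫ y in (cube c (2 * r))ᶜ, k x y * f y = v R x := by
    intro c r hr u hu
    obtain ⟨R₀, hR₀⟩ := exists_nat_ge (‖c‖ + r)
    refine ⟨R₀, ae_all_iff.2 fun R => ?_⟩
    by_cases hRR : R₀ ≤ R
    · have hcc : ∀ i, |c i - (0 : E n) i| + r ≤ (R : ℝ) + 1 := fun i => by
        have h1 : |c i| ≤ ‖c‖ := PiLp.norm_apply_le c i
        have h2 : (R₀ : ℝ) ≤ R := by exact_mod_cast hRR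
        simp only [PiLp.zero_apply, sub_zero]
        linarith
      filter_upwards [hT.ae_eq_of_nested hs' hst hfm hr hcc (hint c r hr) hu (hU R)] with
        x hx _ hxQ
      rw [hx hxQ, hv R x fun i => ?_]
      have h1 := hxQ i
      have h2 := hcc i
      have h3 := abs_sub_le (x i) (c i) ((0 : E n) i)
      linarith
    · exact Filter.Eventually.of_forall fun x h => absurd h hRR
  choose R₀ hR₀ using fun S : ℕ => hnest 0 (S + 1) (hR S) (U S) (hU S)
  obtain ⟨g, hgm, hg⟩ : ∃ g : E n → ℂ, Measurable g ∧
      ∀ᵐ x, Filter.Tendsto (fun R => v R x) Filter.atTop (nhds (g x)) := by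
    refine measurable_limit_of_tendsto_metrizable_ae (fun R => (hvm R).aemeasurable) ?_
    filter_upwards [ae_all_iff.2 hR₀] with x hx
    obtain ⟨S, hS⟩ := exists_nat_ge ‖x‖
    have hxS : x ∈ cube (0 : E n) (S + 1) := fun i => by
      have h1 : |x i| ≤ ‖x‖ := PiLp.norm_apply_le x i
      simp only [PiLp.zero_apply, sub_zero]
      linarith
    refine ⟨U S x + ∫ y in (cube (0 : E n) (2 * (S + 1)))ᶜ, k x y * f y,
      tendsto_const_nhds.congr' ?_⟩
    filter_upwards [Filter.eventually_ge_atTop (R₀ S)] with R hRS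
    exact hx S R hRS hxS
  refine ⟨AEEqFun.mk g hgm.aestronglyMeasurable, fun c r hr => ?_⟩
  obtain ⟨u, hu⟩ := hex c r hr
  obtain ⟨S, hS⟩ := hnest c r hr u hu
  refine ⟨u, hu, ?_⟩
  filter_upwards [hS, hg, AEEqFun.coeFn_mk g hgm.aestronglyMeasurable] with x h1 h2 h3 hxQ
  refine ⟨hint c r hr x hxQ, ?_⟩
  rw [h3]
  refine tendsto_nhds_unique h2 (tendsto_const_nhds.congr' ?_)
  filter_upwards [Filter.eventually_ge_atTop S] with R hRS
  exact h1 R hRS hxQ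

/-- For functions in `L²` the exponent `2` serves for the local part. The part off the double cube
lies in `L²` as well, and its image on the cube is the absolutely convergent kernel integral. -/
theorem IsSingularIntegralOperator.isValue_apply (hT : IsSingularIntegralOperator T k)
    (hn : 1 ≤ n) (hp : 1 < p) (hq : ∀ i, 1 ≤ q i) {h : L2 n}
    (hh : (h : L0 n) ∈ mixedMorreySpace p q) : IsValue T k (h : L0 n) (T h : L0 n) := by
  intro c r hr
  have hm : Measurable (h : E n → ℂ) := (Lp.stronglyMeasurable h).measurable
  have hQ := measurableSet_cube c (2 * r)
  have hin : MemLp ((cube c (2 * r)).indicator (h : E n → ℂ)) 2 volume := (Lp.memLp h).indicator hQ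
  have hout : MemLp ((cube c (2 * r))ᶜ.indicator (h : E n → ℂ)) 2 volume :=
    (Lp.memLp h).indicator hQ.compl
  have hlt : (2 : ℝ≥0∞) < ∞ := ENNReal.ofNat_lt_top
  have hone : (1 : ℝ≥0∞) < 2 := ENNReal.one_lt_two
  have hint : ∀ x ∈ cube c r, IntegrableOn (fun y => k x y * h y) (cube c (2 * r))ᶜ volume :=
    fun x hx => hT.kernel.integrableOn_tail hn hp hq hm hh c hr hx
  have e : ∀ x, (fun y => k x y * (cube c (2 * r))ᶜ.indicator (h : E n → ℂ) y) =
      (cube c (2 * r))ᶜ.indicator fun y => k x y * h y := by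
    intro x
    funext y
    by_cases hy : y ∈ (cube c (2 * r))ᶜ
    · rw [Set.indicator_of_mem hy, Set.indicator_of_mem hy]
    · rw [Set.indicator_of_notMem hy, Set.indicator_of_notMem hy, mul_zero]
  have hsum : h = hin.toLp _ + hout.toLp _ := by
    rw [← MemLp.toLp_add]
    refine Lp.ext ?_
    filter_upwards [(hin.add hout).coeFn_toLp] with x hx
    rw [hx, Pi.add_apply]
    exact (congrFun (Set.indicator_self_add_compl (cube c (2 * r)) (h : E n → ℂ)) x).symm
  have hrep := hT.repr_of_isLpValue (u := T (hout.toLp _)) (hm.indicator hQ.compl)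
    (((isLpValueAt_two (hout.toLp _)).congr hout.coeFn_toLp
      Filter.EventuallyEq.rfl).isLpValue hone hlt) hr
    (fun y hy => Set.indicator_of_notMem (Set.notMem_compl_iff.2 hy) _) (fun x hx => by
      rw [e, integrable_indicator_iff hQ.compl]
      exact hint x hx)
  refine ⟨(T (hin.toLp _) : L0 n), ((isLpValueAt_two (hin.toLp _)).congr hin.coeFn_toLp
    Filter.EventuallyEq.rfl).isLpValue hone hlt, ?_⟩
  have hadd : T h =ᵐ[volume] fun x => T (hin.toLp _) x + T (hout.toLp _) x := by
    conv_lhs => rw [hsum, map_add]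
    exact Lp.coeFn_add _ _
  filter_upwards [hrep, hadd] with x h1 h2 hxQ
  refine ⟨hint x hxQ, ?_⟩
  have h3 := h1 hxQ
  rw [e, integral_indicator hQ.compl] at h3
  exact h2.trans (by rw [h3])

/-- On a cube of side `L` the local part is bounded through the Morrey norm on the double cube, and
the tail by a constant function on the cube; in both terms the powers of `L` cancel. -/
theorem IsSingularIntegralOperator.exists_mixedMorreyNorm_le
    (hT : IsSingularIntegralOperator T k) (hn : 1 ≤ n) (hp : 1 < p) (hq : ∀ i, 1 < q i) :
    ∃ C : ℝ≥0, ∀ f g : L0 n, IsValue T k f g →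
      mixedMorreyNorm p q g ≤ C * mixedMorreyNorm p q f := by
  have hq1 : ∀ i, 1 ≤ q i := fun i => (hq i).le
  have hq0 : ∀ i, 0 < q i := fun i => one_pos.trans (hq i)
  obtain ⟨C₁, hC₁⟩ := mixedBounded hT hq
  obtain ⟨C₂, hC₂⟩ := hT.kernel.exists_lintegral_tail_le (q := q) hn hp hq1
  set σ := ∑ j, 1 / q j with hσ
  -- The power of `2` comes from applying the Morrey condition on the double cube, of side `2 * L`.
  refine ⟨C₁ * 2 ^ (σ - (n : ℝ) / p) + C₂, fun f g hfg => mixedMorreyNorm_le hn fun c r hr => ?_⟩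
  set M := mixedMorreyNorm p q f with hM
  set L := ENNReal.ofReal (2 * r) with hL
  have hL0 : L ≠ 0 := ofReal_two_mul_ne_zero hr
  have hLt : L ≠ ∞ := ENNReal.ofReal_ne_top
  have hfm := measurable_L0 f
  obtain ⟨u, hu, hx⟩ := hfg c r hr
  have hum := measurable_L0 u
  have hu1 : mixedLebesgueNorm q u ≤ C₁ * ((2 * L) ^ (σ - (n : ℝ) / p) * M) := by
    have hfi := hfm.indicator (measurableSet_cube c (2 * r))
    refine (mixedLebesgueNorm_le_of_tendstoInMeasure hq0 hC₁ hfi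
      (hT.tendstoInMeasure hfi hu)).trans (mul_le_mul_right ?_ _)
    have := mixedLebesgueNorm_cube_le (p := p) (q := q) hn f c (r := 2 * r) (by linarith)
    rwa [ENNReal.ofReal_mul two_pos.le, ENNReal.ofReal_ofNat] at this
  set B : ℝ≥0∞ := C₂ * (L ^ (-((n : ℝ) / p)) * M) with hB
  have hbox : MeasurableSet {v : Fin n → ℝ | ∀ i, |v i - c i| ≤ r} :=
    (measurePreserving_toLp n).measurable (measurableSet_cube c r)
  have hind : Measurable ({v : Fin n → ℝ | ∀ i, |v i - c i| ≤ r}.indicator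
      fun _ => (1 : ℝ≥0∞)) := measurable_const.indicator hbox
  have hg1 : mixedLebesgueNorm q ((cube c r).indicator g) ≤
      mixedLebesgueNorm q u + B * L ^ σ := by
    calc mixedLebesgueNorm q ((cube c r).indicator g)
        ≤ iteratedNorm n q (fun v => ‖u (WithLp.toLp 2 v)‖ₑ +
            B * {v : Fin n → ℝ | ∀ i, |v i - c i| ≤ r}.indicator (fun _ => 1) v) := by
          refine iteratedNorm_mono_ae (fun i => (hq0 i).le) ?_
          filter_upwards [(measurePreserving_toLp n).quasiMeasurePreserving.ae hx] with v hv
          by_cases hvQ : WithLp.toLp 2 v ∈ cube c r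
          · rw [Set.indicator_of_mem hvQ,
              Set.indicator_of_mem (s := {v : Fin n → ℝ | ∀ i, |v i - c i| ≤ r}) hvQ, mul_one,
              (hv hvQ).2]
            refine (enorm_add_le _ _).trans (add_le_add_right ?_ _)
            exact (enorm_integral_le_lintegral_enorm _).trans (hC₂ f hfm c r hr _ hvQ)
          · rw [Set.indicator_of_notMem hvQ, enorm_zero]
            exact zero_le
      _ ≤ mixedLebesgueNorm q u + B * L ^ σ := by
          refine (iteratedNorm_add_le hq1 (measurable_enorm_toLp hum)
            (hind.const_mul B)).trans (add_le_add_right ?_ _)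
          rw [iteratedNorm_const_mul hq0 hind]
          exact mul_le_mul_right (iteratedNorm_cube_le hq0 hr) _
  calc L ^ ((n : ℝ) / p - σ) * mixedLebesgueNorm q ((cube c r).indicator g)
      ≤ L ^ ((n : ℝ) / p - σ) * (C₁ * ((2 * L) ^ (σ - (n : ℝ) / p) * M) + B * L ^ σ) :=
        mul_le_mul_right (hg1.trans (add_le_add_left hu1 _)) _
    _ = (L ^ ((n : ℝ) / p - σ) * L ^ (σ - (n : ℝ) / p)) *
          (C₁ * (2 : ℝ≥0∞) ^ (σ - (n : ℝ) / p) * M) +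
        (L ^ ((n : ℝ) / p - σ) * L ^ (-((n : ℝ) / p)) * L ^ σ) * (C₂ * M) := by
        rw [ENNReal.mul_rpow_of_ne_top ENNReal.ofNat_ne_top hLt, hB]
        ring
    _ = C₁ * (2 : ℝ≥0∞) ^ (σ - (n : ℝ) / p) * M + C₂ * M := by
        rw [← ENNReal.rpow_add _ _ hL0 hLt, ← ENNReal.rpow_add _ _ hL0 hLt,
          ← ENNReal.rpow_add _ _ hL0 hLt]
        ring_nf
        simp
    _ = _ := by
        rw [ENNReal.coe_add, ENNReal.coe_mul, ENNReal.coe_rpow_of_ne_zero two_ne_zero,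
          ENNReal.coe_ofNat]
        ring

end main

end MixedMorrey

/-! ### The operator on the mixed Morrey space -/

theorem theorem7 {n : ℕ} (hn : 1 ≤ n) (p : ℝ) (q : Fin n → ℝ) (hp : 1 < p) (hq : ∀ j, 1 < q j)
    (hpq : (n : ℝ) / p ≤ ∑ j, 1 / q j)
    (k : MixedMorrey.E n → MixedMorrey.E n → ℂ)
    (T : MixedMorrey.L2 n →L[ℂ] MixedMorrey.L2 n)
    (hT : MixedMorrey.IsSingularIntegralOperator T k) :
    ∃ S : MixedMorrey.L0 n → MixedMorrey.L0 n,
      -- on the mixed Morrey space, `S f` is the one and only value of `T f`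
      (∀ f ∈ MixedMorrey.mixedMorreySpace p q, ∀ g : MixedMorrey.L0 n,
        MixedMorrey.IsValue T k f g ↔ g = S f) ∧
      -- it agrees with the given operator on `L²`
      (∀ h : MixedMorrey.L2 n, (h : MixedMorrey.L0 n) ∈ MixedMorrey.mixedMorreySpace p q →
        S (h : MixedMorrey.L0 n) = (T h : MixedMorrey.L0 n)) ∧
      -- it is linear
      (∀ f₁ ∈ MixedMorrey.mixedMorreySpace p q, ∀ f₂ ∈ MixedMorrey.mixedMorreySpace p q,
        ∀ a b : ℂ, S (a • f₁ + b • f₂) = a • S f₁ + b • S f₂) ∧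
      -- it is bounded on the mixed Morrey space
      ∃ C : ℝ≥0, ∀ f ∈ MixedMorrey.mixedMorreySpace p q,
        MixedMorrey.mixedMorreyNorm p q (S f) ≤ C * MixedMorrey.mixedMorreyNorm p q f := by
  classical
  have hq1 : ∀ i, 1 ≤ q i := fun i => (hq i).le
  have : Nonempty (Fin n) := ⟨⟨0, hn⟩⟩
  -- The least exponent serves as a common `s`: by Hölder's inequality on cubes, every function of
  -- the Morrey space is in `L^s` on each cube. This uniform choice is what makes linearity
  -- accessible.
  obtain ⟨j, hj⟩ := Finite.exists_min q
  have hs : 1 < ENNReal.ofReal (q j) := by simpa using hq j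
  have hst : ENNReal.ofReal (q j) < ∞ := ENNReal.ofReal_lt_top
  have hex : ∀ f : MixedMorrey.L0 n, ∃ g : MixedMorrey.L0 n,
      f ∈ MixedMorrey.mixedMorreySpace p q →
        MixedMorrey.IsValueAt T k (ENNReal.ofReal (q j)) f g := by
    intro f
    by_cases hf : f ∈ MixedMorrey.mixedMorreySpace p q
    · obtain ⟨g, hg⟩ := hT.exists_isValueAt hn hp (hq j) hj hf
      exact ⟨g, fun _ => hg⟩
    -- Outside the Morrey space `S` may take any value; nothing is asserted there.
    · exact ⟨0, fun h => absurd h hf⟩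
  choose S hS using hex
  have hSv : ∀ f ∈ MixedMorrey.mixedMorreySpace p q, MixedMorrey.IsValue T k f (S f) :=
    fun f hf => (hS f hf).isValue hs hst
  have hiff : ∀ f ∈ MixedMorrey.mixedMorreySpace p q, ∀ g : MixedMorrey.L0 n,
      MixedMorrey.IsValue T k f g ↔ g = S f := fun f hf g =>
    ⟨fun h => hT.eq_of_isValue h (hSv f hf), fun h => h ▸ hSv f hf⟩
  refine ⟨S, hiff, fun h hh => ((hiff _ hh _).1 (hT.isValue_apply hn hp hq1 hh)).symm,
    fun f₁ h₁ f₂ h₂ a b => ?_, ?_⟩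
  -- Once the combination is known to lie in the space, uniqueness identifies `S` of it with the
  -- combination of values.
  · have hmem : a • f₁ + b • f₂ ∈ MixedMorrey.mixedMorreySpace p q := by
      have e : (a • f₁ + b • f₂ : MixedMorrey.L0 n) =ᵐ[volume] fun x => a * f₁ x + b * f₂ x := by
        filter_upwards [AEEqFun.coeFn_add (a • f₁) (b • f₂), AEEqFun.coeFn_smul a f₁,
          AEEqFun.coeFn_smul b f₂] with x h1 h2 h3
        rw [h1, Pi.add_apply, h2, h3, Pi.smul_apply, Pi.smul_apply, smul_eq_mul, smul_eq_mul]
      change MixedMorrey.mixedMorreyNorm p q _ < ∞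
      rw [MixedMorrey.mixedMorreyNorm_congr_ae (fun i => zero_le_one.trans (hq1 i)) e]
      refine (MixedMorrey.mixedMorreyNorm_linear_le hn hq1 (MixedMorrey.measurable_L0 f₁)
        (MixedMorrey.measurable_L0 f₂) a b).trans_lt (ENNReal.add_lt_top.2 ⟨?_, ?_⟩)
      · exact ENNReal.mul_lt_top enorm_lt_top h₁
      · exact ENNReal.mul_lt_top enorm_lt_top h₂
    exact ((hiff _ hmem _).1
      (((hS f₁ h₁).linear hs.le (hS f₂ h₂) a b).isValue hs hst)).symm
  · obtain ⟨C, hC⟩ := hT.exists_mixedMorreyNorm_le (p := p) hn hp hq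
    exact ⟨C, fun f hf => hC f (S f) (hSv f hf)⟩
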